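/- **Setting.** Let $A\in\mathbb R^{p\times p}$, $B\in\mathbb R^{p\times q}$, and let $x_{t+1}=Ax_t+Bw_t$, $t\ge 0$, where $x_0\sim\mathcal N(0,\Sigma_{x_0})$ and $(w_t)$ is an i.i.d. $\mathcal N(0,I)$ sequence independent of $x_0$. A Gaussian test channel is a sequence of conditional laws $P(dy_t\mid y_{t-1},x_t)=\mathcal N(C_tx_t+F_ty_{t-1},V_t)$ (with $y_{-1}=0$). For $D\in(0,\infty]$ let $$R^{\mathrm{na}}_{GM,0,n}(D)=\inf\ \tfrac1{n+1}I(x^n;y^n),$$ the infimum being over all Gaussian test channels with $\frac1{n+1}\mathbb E\sum_{t=0}^n\|x_t-y_t\|_2^2\le D$, where $I(x^n;y^n)$ is the mutual information (in nats) of $(x_0,\dots,x_n)$ and $(y_0,\dots,y_n)$. For a symmetric matrix $\Pi$ put $$\Lambda=A\Pi A^{\mathsf T}+BB^{\mathsf T},\qquad H=I-\Pi\Lambda^{-1},\qquad \Sigma_v=\Pi H^{\mathsf T},$$ call $\Pi$ feasible if $0\prec\Pi\preceq\Lambda$ and $\operatorname{tr}\Pi\le D$, and for feasible $\Pi$ consider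 the time-invariant test channel $$y_t=Hx_t+(I-H)Ay_{t-1}+v_t,\qquad v_t\sim\mathcal N(0,\Sigma_v)\ \text{independent},\tag{1}$$ whose output has the transition probability $P(dy_t\mid y_{t-1})=\int P(dy_t\mid y_{t-1},x_t)\,P(dx_t\mid y_{t-1})$ with $P(dx_t\mid y_{t-1})=\mathcal N(Ay_{t-1},\Lambda)$. **Theorem.** Let $D\in(0,\infty]$. Assume that $A$ is full rank or $B$ is square and full rank, and that there is a feasible $\Pi$ (for instance an optimal one) for which the transition probability $P(dy_t\mid y_{t-1})$ of (1) has a unique invariant probability distribution. Then: 1. The limit $\lim_{n\to\infty}R^{\mathrm{na}}_{GM,0,n}(D)$ exists, is finite, and equals $$R^{\mathrm{na}}_{GM}(D)=\min_{0\prec\Pi\preceq\Lambda,\ \operatorname{tr}\Pi\le D}\ \tfrac12\log\frac{|\Lambda|}{|\Pi|}\ \ge 0,$$ the minimum being attained. The same limit is obtained when the infimum defining $R^{\mathrm{na}}_{GM,0,n}(D)$ is restricted to time-invariant Gaussian test channels. 2. The limit is realized by (1), for every minimizer $\Pi$. That is: $\Lambda\succ0$; $\Sigma_v\succeq0$; $H$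 is similar to a diagonal matrix with nonnegative entries; and under (1), as $n\to\infty$ (resp. $t\to\infty$), $\frac1{n+1}I(x^n;y^n)\to R^{\mathrm{na}}_{GM}(D)$, $\frac1{n+1}\mathbb E\sum_{t\le n}\|x_t-y_t\|_2^2\to\operatorname{tr}\Pi\le D$ and $\mathbb E(x_t-y_t)(x_t-y_t)^{\mathsf T}\to\Pi$. If moreover $\Sigma_{x_0}=\Lambda$, then under (1) $\frac1{n+1}I(x^n;y^n)=R^{\mathrm{na}}_{GM}(D)$ and $\frac1{n+1}\mathbb E\sum_{t\le n}\|x_t-y_t\|_2^2=\operatorname{tr}\Pi$ for every $n$, and for every $t$, $\mathbb E[x_t\mid y^t]=y_t$ and $\mathbb E[x_t\mid y^{t-1}]=Ay_{t-1}$, with conditional error covariances $\Sigma_{t|t}=\Pi$ and $\Sigma_{t|t-1}=\Lambda$. -/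

import Mathlib

open MeasureTheory ProbabilityTheory Filter Topology
open scoped ENNReal Matrix

noncomputable section

namespace GaussMarkov

/-- Euclidean space of dimension `n`, with the Euclidean norm. -/
abbrev Vec (n : ℕ) : Type := EuclideanSpace ℝ (Fin n)

/-! ### The source and the Gaussian test channels -/

/-- A sequence of Gaussian test channels `P(dy_t | y_{t-1}, x_t)`, with linear mean in
`(x_t, y_{t-1})` and non-random covariance:
`P(dy_t | y_{t-1}, x_t) = N(gain t * x_t + feedback t * y_{t-1}, noiseCov t)`. -/
structure TestChannel (p : ℕ) where
  gain : ℕ → Matrix (Fin p) (Fin p) ℝ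
  feedback : ℕ → Matrix (Fin p) (Fin p) ℝ
  noiseCov : ℕ → Matrix (Fin p) (Fin p) ℝ

/-- The noise covariances are genuine covariance matrices. -/
def TestChannel.IsValid {p : ℕ} (Q : TestChannel p) : Prop :=
  ∀ t, (Q.noiseCov t).PosSemidef

/-- The test channel does not depend on time. -/
def TestChannel.IsTimeInvariant {p : ℕ} (Q : TestChannel p) : Prop :=
  ∀ t, Q.gain t = Q.gain 0 ∧ Q.feedback t = Q.feedback 0 ∧ Q.noiseCov t = Q.noiseCov 0

/-- Sample space: the initial state `x_0`, the source noise `(w_t)`, the channel noise `(v_t)`. -/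
abbrev Sample (p q : ℕ) : Type := Vec p × (ℕ → Vec q) × (ℕ → Vec p)

/-- The law under which `x_0 ∼ N(0, S₀)`, `w_t ∼ N(0, I)` and `v_t ∼ N(0, V_t)` are all
independent. -/
def law {p : ℕ} (q : ℕ) (S₀ : Matrix (Fin p) (Fin p) ℝ) (Q : TestChannel p) :
    Measure (Sample p q) :=
  (multivariateGaussian 0 S₀).prod
    ((Measure.infinitePi fun _ : ℕ => multivariateGaussian (0 : Vec q) 1).prod
      (Measure.infinitePi fun t : ℕ => multivariateGaussian (0 : Vec p) (Q.noiseCov t)))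

/-- The source `x_{t+1} = A x_t + B w_t`. -/
def source {p q : ℕ} (A : Matrix (Fin p) (Fin p) ℝ) (B : Matrix (Fin p) (Fin q) ℝ) :
    ℕ → Sample p q → Vec p
  | 0, ω => ω.1
  | t + 1, ω => Matrix.toEuclideanLin A (source A B t ω) + Matrix.toEuclideanLin B (ω.2.1 t)

/-- The reproduction with time shifted by one: `prevOutput A B Q t` is `y_{t-1}`, where
`y_{-1} = 0` and `y_t = gain t * x_t + feedback t * y_{t-1} + v_t`. -/
def prevOutput {p q : ℕ} (A : Matrix (Fin p) (Fin p) ℝ) (B : Matrix (Fin p) (Fin q) ℝ)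
    (Q : TestChannel p) : ℕ → Sample p q → Vec p
  | 0, _ => 0
  | t + 1, ω => Matrix.toEuclideanLin (Q.gain t) (source A B t ω)
      + Matrix.toEuclideanLin (Q.feedback t) (prevOutput A B Q t ω) + ω.2.2 t

/-- The reproduction `y_t`. -/
def output {p q : ℕ} (A : Matrix (Fin p) (Fin p) ℝ) (B : Matrix (Fin p) (Fin q) ℝ)
    (Q : TestChannel p) (t : ℕ) : Sample p q → Vec p :=
  prevOutput A B Q (t + 1)

/-! ### Information, distortion and the finite-time nonanticipative rate distortion function -/

/-- `I(X; Y) = D(P_{X,Y} ‖ P_X × P_Y)`, in nats. -/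
def mutualInformation {Ω α β : Type*} [MeasurableSpace Ω] [MeasurableSpace α] [MeasurableSpace β]
    (μ : Measure Ω) (X : Ω → α) (Y : Ω → β) : ℝ≥0∞ :=
  InformationTheory.klDiv (μ.map fun ω => (X ω, Y ω)) ((μ.map X).prod (μ.map Y))

/-- `(n + 1)⁻¹ I(x_0, …, x_n; y_0, …, y_n)`. -/
def informationRate {p q : ℕ} (A : Matrix (Fin p) (Fin p) ℝ) (B : Matrix (Fin p) (Fin q) ℝ)
    (S₀ : Matrix (Fin p) (Fin p) ℝ) (Q : TestChannel p) (n : ℕ) : ℝ≥0∞ :=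
  mutualInformation (law q S₀ Q)
    (fun ω (t : Fin (n + 1)) => source A B t ω)
    (fun ω (t : Fin (n + 1)) => output A B Q t ω) / (n + 1)

/-- `(n + 1)⁻¹ E ∑_{t ≤ n} ‖x_t - y_t‖²`. -/
def distortion {p q : ℕ} (A : Matrix (Fin p) (Fin p) ℝ) (B : Matrix (Fin p) (Fin q) ℝ)
    (S₀ : Matrix (Fin p) (Fin p) ℝ) (Q : TestChannel p) (n : ℕ) : ℝ≥0∞ :=
  (∑ t ∈ Finset.range (n + 1),
    ∫⁻ ω, ‖source A B t ω - output A B Q t ω‖ₑ ^ 2 ∂(law q S₀ Q)) / (n + 1)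

/-- The finite-time Gaussian nonanticipative rate distortion function: the infimum of the
information rate over all Gaussian test channels of average distortion at most `D`. -/
def finiteNRDF {p q : ℕ} (A : Matrix (Fin p) (Fin p) ℝ) (B : Matrix (Fin p) (Fin q) ℝ)
    (S₀ : Matrix (Fin p) (Fin p) ℝ) (n : ℕ) (D : ℝ≥0∞) : ℝ≥0∞ :=
  ⨅ (Q : TestChannel p) (_ : Q.IsValid) (_ : distortion A B S₀ Q n ≤ D),
    informationRate A B S₀ Q n

/-- The same infimum, over time-invariant Gaussian test channels only. -/
def finiteNRDFTimeInvariant {p q : ℕ} (A : Matrix (Fin p) (Fin p) ℝ)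
    (B : Matrix (Fin p) (Fin q) ℝ) (S₀ : Matrix (Fin p) (Fin p) ℝ) (n : ℕ) (D : ℝ≥0∞) : ℝ≥0∞ :=
  ⨅ (Q : TestChannel p) (_ : Q.IsValid) (_ : Q.IsTimeInvariant)
    (_ : distortion A B S₀ Q n ≤ D), informationRate A B S₀ Q n

/-! ### The asymptotic problem -/

/-- `Λ = A Π Aᵀ + B Bᵀ`. -/
def predCov {p q : ℕ} (A : Matrix (Fin p) (Fin p) ℝ) (B : Matrix (Fin p) (Fin q) ℝ)
    (P : Matrix (Fin p) (Fin p) ℝ) : Matrix (Fin p) (Fin p) ℝ :=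
  A * P * Aᵀ + B * Bᵀ

/-- The constraint set `0 ≺ Π ⪯ Λ`, `tr Π ≤ D`. -/
def feasibleSet {p q : ℕ} (A : Matrix (Fin p) (Fin p) ℝ) (B : Matrix (Fin p) (Fin q) ℝ)
    (D : ℝ≥0∞) : Set (Matrix (Fin p) (Fin p) ℝ) :=
  {P | P.PosDef ∧ (predCov A B P - P).PosSemidef ∧ ENNReal.ofReal P.trace ≤ D}

/-- The objective `½ log (|Λ| / |Π|)`. -/
def objective {p q : ℕ} (A : Matrix (Fin p) (Fin p) ℝ) (B : Matrix (Fin p) (Fin q) ℝ)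
    (P : Matrix (Fin p) (Fin p) ℝ) : ℝ :=
  1 / 2 * Real.log ((predCov A B P).det / P.det)

/-- `H = I - Π Λ⁻¹`. -/
def gainH {p q : ℕ} (A : Matrix (Fin p) (Fin p) ℝ) (B : Matrix (Fin p) (Fin q) ℝ)
    (P : Matrix (Fin p) (Fin p) ℝ) : Matrix (Fin p) (Fin p) ℝ :=
  1 - P * (predCov A B P)⁻¹

/-- The time-invariant test channel `y_t = H x_t + (I - H) A y_{t-1} + v_t`, `v_t ∼ N(0, Π Hᵀ)`,
with `H = I - Π Λ⁻¹`. -/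
def stationaryChannel {p q : ℕ} (A : Matrix (Fin p) (Fin p) ℝ) (B : Matrix (Fin p) (Fin q) ℝ)
    (P : Matrix (Fin p) (Fin p) ℝ) : TestChannel p where
  gain _ := gainH A B P
  feedback _ := (1 - gainH A B P) * A
  noiseCov _ := P * (gainH A B P)ᵀ

/-- The conditional law `P(dx_t | y_{t-1}) = N(A y_{t-1}, Λ)`, as a kernel. -/
def predictionKernel {p q : ℕ} (A : Matrix (Fin p) (Fin p) ℝ) (B : Matrix (Fin p) (Fin q) ℝ)
    (P : Matrix (Fin p) (Fin p) ℝ) : Kernel (Vec p) (Vec p) :=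
  (Kernel.id ×ₖ Kernel.const (Vec p) (multivariateGaussian (0 : Vec p) (predCov A B P))).map
    fun z => Matrix.toEuclideanLin A z.1 + z.2

/-- The test channel of a channel sequence at time `t`, as a kernel:
`(y_{t-1}, x_t) ↦ N(gain t * x_t + feedback t * y_{t-1}, noiseCov t)`. -/
def TestChannel.kernel {p : ℕ} (Q : TestChannel p) (t : ℕ) : Kernel (Vec p × Vec p) (Vec p) :=
  (Kernel.id ×ₖ
      Kernel.const (Vec p × Vec p) (multivariateGaussian (0 : Vec p) (Q.noiseCov t))).map
    fun z => Matrix.toEuclideanLin (Q.gain t) z.1.2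
      + Matrix.toEuclideanLin (Q.feedback t) z.1.1 + z.2

/-- The transition probability of the reproduction under the time-invariant test channel,
`P(dy_t | y_{t-1}) = ∫ P(dy_t | y_{t-1}, x_t) P(dx_t | y_{t-1})`. -/
def outputKernel {p q : ℕ} (A : Matrix (Fin p) (Fin p) ℝ) (B : Matrix (Fin p) (Fin q) ℝ)
    (P : Matrix (Fin p) (Fin p) ℝ) : Kernel (Vec p) (Vec p) :=
  (stationaryChannel A B P).kernel 0 ∘ₖ (Kernel.id ×ₖ predictionKernel A B P)

/-! ### Filtering -/

/-- The σ-algebra generated by `y_0, …, y_{k-1}`. -/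
abbrev pastOutputs {p q : ℕ} (A : Matrix (Fin p) (Fin p) ℝ) (B : Matrix (Fin p) (Fin q) ℝ)
    (Q : TestChannel p) (k : ℕ) : MeasurableSpace (Sample p q) :=
  MeasurableSpace.comap (fun ω (s : Fin k) => output A B Q s ω) inferInstance

/-- The `(i, j)` entry of the conditional error covariance
`E[(X - E[X | m]) (X - E[X | m])ᵀ | m]`. -/
def condErrorCov {Ω : Type*} {m₀ : MeasurableSpace Ω} {p : ℕ} (μ : Measure Ω)
    (m : MeasurableSpace Ω) (X : Ω → Vec p) (i j : Fin p) : Ω → ℝ :=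
  μ[fun ω => (X ω - (μ[X | m]) ω) i * (X ω - (μ[X | m]) ω) j | m]

/-- For the source with initial covariance `L` and the channels `Q`, the Kalman filter is in steady
state at all times: `E[x_t | y_0, …, y_t] = y_t` with conditional error covariance `P`, and
`E[x_t | y_0, …, y_{t-1}] = A y_{t-1}` with conditional error covariance `L`. -/
def FilterInSteadyState {p q : ℕ} (A : Matrix (Fin p) (Fin p) ℝ) (B : Matrix (Fin p) (Fin q) ℝ)
    (Q : TestChannel p) (L P : Matrix (Fin p) (Fin p) ℝ) : Prop :=
  ∀ t : ℕ,
    (law q L Q)[source A B t | pastOutputs A B Q (t + 1)] =ᵐ[law q L Q] output A B Q t ∧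
    (law q L Q)[source A B t | pastOutputs A B Q t] =ᵐ[law q L Q]
      (fun ω => Matrix.toEuclideanLin A (prevOutput A B Q t ω)) ∧
    ∀ i j : Fin p,
      condErrorCov (law q L Q) (pastOutputs A B Q (t + 1)) (source A B t) i j
        =ᵐ[law q L Q] (fun _ => P i j) ∧
      condErrorCov (law q L Q) (pastOutputs A B Q t) (source A B t) i j
        =ᵐ[law q L Q] (fun _ => L i j)

/-- The covariance matrix `E[(x_t - y_t) (x_t - y_t)ᵀ]` of the reproduction error. -/
def reproductionErrorCov {p q : ℕ} (A : Matrix (Fin p) (Fin p) ℝ) (B : Matrix (Fin p) (Fin q) ℝ)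
    (S₀ : Matrix (Fin p) (Fin p) ℝ) (Q : TestChannel p) (t : ℕ) : Matrix (Fin p) (Fin p) ℝ :=
  Matrix.of fun i j => ∫ ω, (source A B t ω - output A B Q t ω) i *
    (source A B t ω - output A B Q t ω) j ∂(law q S₀ Q)

end GaussMarkov

end

/-!
Throughout, `P` stands for the matrix `Π`, `predCov A B P` for `Λ`, `ξ_t = x_t - A y_{t-1}` for the
prediction error and `v_t ∼ N(0, Σ_v)` for the channel noise. Symmetric matrices are compared in the
Loewner order.

**Stability.** Under the stationary channel the reproduction is the Markov chain `y ↦ A y + η` with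
`η ∼ N(0, Λ - Π)`. An invariant law keeps the covariances `∑_{k < n} Aᵏ (Λ - Π) Aᵏᵀ` bounded, hence
also `Aⁿ Π Aⁿᵀ`, since `A Π Aᵀ ≤ Λ`. An averaged limit `M` of these satisfies `A M Aᵀ = M`, and
convolution with `N(0, M)` preserves invariant laws, so uniqueness gives `M = 0` and then `Aⁿ → 0`
(`tendsto_pow_zero_of_existsUnique_invariant`). This is the only use of the invariant law.

**The asymptotic problem.** If `A` is stable, the constraint set is bounded. The rank hypothesis
prevents minimizing sequences from degenerating to singular matrices, so a minimizer exists
(`exists_minimizer`). At a minimizer the differential `slope` of the objective is nonnegative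
towards every point of the closed constraint set, and by compactness almost nonnegative towards
points that satisfy the constraints almost (`exists_slope_ge`).

**Converse.** For arbitrary estimates `z_t` of `x_t` from the reproductions, the law of the source
can be reweighted by a reference posterior, in which `x_t` is `N(z_t, Π)` distributed relative to
the prediction `N(A z_{t-1}, Λ)`. This is a probability density for every value of the
reproductions (`lintegral_mul_exp_logPosterior`), so the Donsker–Varadhan inequality bounds the
mutual information from below by an expression affine in the error covariances of the estimates
(`ofReal_le_mutualInformation`). With conditional means as estimates, the averaged error covariance
satisfies the constraints of the asymptotic problem up to `O(1/n)`, and the affine expression is the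
minimum plus half the slope towards that average, so it is at least the minimum up to `o(1)`
(`exists_le_informationRate`). Neither stationarity nor nonsingular channel noise is needed.

**Achievability.** The pair `((I - H) ξ - v, H ξ + v)` is a rotation of `(ξ, v)` with independent
components `N(0, Π)` and `N(0, Λ - Π)`. By Bayes' rule, the stationary channel therefore has a
density with respect to the chain `y ↦ A y + η`, even where `Σ_v` is singular
(`map_gain_add_noise`), and the product of these densities over time gives an upper bound of the
mutual information (`map_source_output_eq_withDensity`, `mutualInformation_le`). The error
recursion under the stationary channel is stable (`tendsto_closedLoop_pow`), so the error covariance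
tends to `Π`, the distortion to `tr Π`, and the upper bound to the objective at `Π`. Shrinking a
minimizer to `s Π` with `s < 1` leaves room in the distortion constraint at finite times
(`eventually_finiteNRDFTimeInvariant_le`).

**Filtering.** If the source starts with covariance `Λ`, the same rotation shows inductively that
`x_t - y_t` is independent of `y_0, …, y_t` and that `ξ_t` is independent of `y_0, …, y_{t-1}`, with
laws `N(0, Π)` and `N(0, Λ)`; the conditional means and covariances can be read off
(`filterInSteadyState_stationary`).
-/

namespace GaussMarkov

/-! ### The Loewner order of real symmetric matrices -/

section Loewner

open scoped MatrixOrder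

variable {n m : Type*} [Fintype n] [Fintype m]

lemma dotProduct_conj_mulVec (M : Matrix m n ℝ) (X : Matrix n n ℝ) (x : m → ℝ) :
    x ⬝ᵥ (M * X * Mᵀ) *ᵥ x = (Mᵀ *ᵥ x) ⬝ᵥ X *ᵥ (Mᵀ *ᵥ x) := by
  rw [← Matrix.mulVec_mulVec, ← Matrix.mulVec_mulVec, Matrix.dotProduct_mulVec,
    ← Matrix.mulVec_transpose]

lemma dotProduct_mulVec_mono {X Y : Matrix n n ℝ} (h : X ≤ Y) (x : n → ℝ) :
    x ⬝ᵥ X *ᵥ x ≤ x ⬝ᵥ Y *ᵥ x := by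
  have := (Matrix.le_iff.1 h).dotProduct_mulVec_nonneg x
  simp only [star_trivial, Matrix.sub_mulVec, dotProduct_sub] at this
  linarith

lemma le_of_forall_dotProduct_mulVec_le {X Y : Matrix n n ℝ} (hX : Xᵀ = X) (hY : Yᵀ = Y)
    (h : ∀ x : n → ℝ, x ⬝ᵥ X *ᵥ x ≤ x ⬝ᵥ Y *ᵥ x) : X ≤ Y := by
  refine Matrix.le_iff.2 (.of_dotProduct_mulVec_nonneg ?_ fun x => ?_)
  · simp [Matrix.IsHermitian, Matrix.conjTranspose_eq_transpose_of_trivial, hX, hY]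
  · simp only [star_trivial, Matrix.sub_mulVec, dotProduct_sub]
    linarith [h x]

omit [Fintype n] in
lemma transpose_eq_of_nonneg {X : Matrix n n ℝ} (h : 0 ≤ X) : Xᵀ = X := by
  simpa [Matrix.IsHermitian, Matrix.conjTranspose_eq_transpose_of_trivial] using
    (Matrix.nonneg_iff_posSemidef.1 h).isHermitian

lemma conj_nonneg {X : Matrix n n ℝ} (h : 0 ≤ X) (M : Matrix m n ℝ) : 0 ≤ M * X * Mᵀ := by
  simpa [Matrix.conjTranspose_eq_transpose_of_trivial] using
    ((Matrix.nonneg_iff_posSemidef.1 h).mul_mul_conjTranspose_same M).nonneg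

lemma conj_mono {X Y : Matrix n n ℝ} (h : X ≤ Y) (M : Matrix m n ℝ) :
    M * X * Mᵀ ≤ M * Y * Mᵀ := by
  have := conj_nonneg (sub_nonneg.2 h) M
  rwa [Matrix.mul_sub, Matrix.sub_mul, sub_nonneg] at this

lemma mul_transpose_self_nonneg (M : Matrix m n ℝ) : 0 ≤ M * Mᵀ := by
  simpa [Matrix.conjTranspose_eq_transpose_of_trivial] using
    (Matrix.posSemidef_self_mul_conjTranspose M).nonneg

lemma isClosed_nonneg : IsClosed {X : Matrix n n ℝ | 0 ≤ X} := by
  have : {X : Matrix n n ℝ | 0 ≤ X} =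
      {X | Xᵀ = X} ∩ ⋂ x : n → ℝ, {X | 0 ≤ x ⬝ᵥ X *ᵥ x} := by
    ext X
    simp only [Set.mem_ofPred_eq, Set.mem_inter_iff, Set.mem_iInter]
    refine ⟨fun h => ⟨transpose_eq_of_nonneg h, fun x => ?_⟩, fun h => ?_⟩
    · simpa using dotProduct_mulVec_mono h x
    · exact le_of_forall_dotProduct_mulVec_le (by simp) h.1 (by simpa using h.2)
  rw [this]
  refine (isClosed_eq (by fun_prop) (by fun_prop)).inter
    (isClosed_iInter fun x => isClosed_le (by fun_prop) (by fun_prop))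

instance : OrderClosedTopology (Matrix n n ℝ) where
  isClosed_le' := by
    have : {p : Matrix n n ℝ × Matrix n n ℝ | p.1 ≤ p.2} =
        (fun p : Matrix n n ℝ × Matrix n n ℝ => p.2 - p.1) ⁻¹' {X | 0 ≤ X} := by
      ext p; simp
    rw [this]
    exact isClosed_nonneg.preimage (by fun_prop)

variable [DecidableEq n] [DecidableEq m]

lemma trace_mul_nonneg {X Y : Matrix n n ℝ} (hX : 0 ≤ X) (hY : 0 ≤ Y) :
    0 ≤ (X * Y).trace := by
  have hs := CFC.sqrt_nonneg X
  have h2 : CFC.sqrt X * CFC.sqrt X = X := CFC.sqrt_mul_sqrt_self X hX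
  have h := (Matrix.nonneg_iff_posSemidef.1 (conj_nonneg hY (CFC.sqrt X))).trace_nonneg
  rwa [transpose_eq_of_nonneg hs, Matrix.trace_mul_comm, ← mul_assoc, h2] at h

lemma trace_mul_mono {X Y Z : Matrix n n ℝ} (hX : 0 ≤ X) (h : Y ≤ Z) :
    (X * Y).trace ≤ (X * Z).trace := by
  have := trace_mul_nonneg hX (sub_nonneg.2 h)
  rw [mul_sub, Matrix.trace_sub] at this
  linarith

lemma trace_mono {Y Z : Matrix n n ℝ} (h : Y ≤ Z) : Y.trace ≤ Z.trace := by
  simpa using trace_mul_mono (Matrix.PosSemidef.one.nonneg : (0 : Matrix n n ℝ) ≤ 1) h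

lemma le_sum_abs_smul_one {X : Matrix n n ℝ} (hX : Xᵀ = X) :
    X ≤ (∑ i, ∑ j, |X i j|) • (1 : Matrix n n ℝ) := by
  refine le_of_forall_dotProduct_mulVec_le hX (by simp) fun x => ?_
  have hx : ∀ i, x i ^ 2 ≤ x ⬝ᵥ x := fun i => by
    simp only [dotProduct, ← sq]
    exact Finset.single_le_sum (f := fun i => x i ^ 2) (fun i _ => sq_nonneg _) (Finset.mem_univ i)
  calc x ⬝ᵥ X *ᵥ x = ∑ i, ∑ j, X i j * (x i * x j) := by
        simp only [dotProduct, Matrix.mulVec, Finset.mul_sum]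
        exact Finset.sum_congr rfl fun i _ => Finset.sum_congr rfl fun j _ => by ring
    _ ≤ ∑ i, ∑ j, |X i j| * (x ⬝ᵥ x) := by
        refine Finset.sum_le_sum fun i _ => Finset.sum_le_sum fun j _ => ?_
        calc X i j * (x i * x j) ≤ |X i j * (x i * x j)| := le_abs_self _
          _ = |X i j| * |x i * x j| := abs_mul _ _
          _ ≤ |X i j| * (x ⬝ᵥ x) := by
            refine mul_le_mul_of_nonneg_left ?_ (abs_nonneg _)
            rw [abs_le]
            constructor <;> nlinarith [hx i, hx j, sq_nonneg (x i + x j), sq_nonneg (x i - x j)]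
    _ = x ⬝ᵥ ((∑ i, ∑ j, |X i j|) • (1 : Matrix n n ℝ)) *ᵥ x := by
        simp only [Matrix.smul_mulVec, Matrix.one_mulVec, dotProduct_smul, smul_eq_mul,
          Finset.sum_mul]

omit [Fintype n] in
lemma smul_one_mono {c d : ℝ} (h : c ≤ d) :
    c • (1 : Matrix n n ℝ) ≤ d • (1 : Matrix n n ℝ) := by
  rw [Matrix.le_iff, ← sub_smul]
  exact Matrix.PosSemidef.one.smul (sub_nonneg.2 h)

lemma exists_le_smul_one {X : Matrix n n ℝ} (hX : Xᵀ = X) :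
    ∃ c : ℝ, 0 < c ∧ X ≤ c • (1 : Matrix n n ℝ) :=
  ⟨∑ i, ∑ j, |X i j| + 1, by positivity,
    (le_sum_abs_smul_one hX).trans (smul_one_mono (by linarith))⟩

omit [Fintype n] [DecidableEq n] in
lemma posDef_of_le {X Y : Matrix n n ℝ} (hX : X.PosDef) (h : X ≤ Y) : Y.PosDef := by
  have := hX.add_posSemidef (Matrix.le_iff.1 h)
  rwa [add_sub_cancel] at this

/-- Both sides say that the block matrix with blocks `Y`, `Z`, `Zᵀ`, `X` is positive semidefinite. -/
lemma conj_inv_le_iff {X Y Z : Matrix n n ℝ} (hX : X.PosDef) (hY : Y.PosDef) :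
    Zᵀ * Y⁻¹ * Z ≤ X ↔ Z * X⁻¹ * Zᵀ ≤ Y := by
  let := hX.isUnit.invertible
  let := hY.isUnit.invertible
  rw [Matrix.le_iff, Matrix.le_iff]
  have h1 := Matrix.PosDef.fromBlocks₁₁ Z X hY
  have h2 := Matrix.PosDef.fromBlocks₂₂ Y Z hX
  simp only [Matrix.conjTranspose_eq_transpose_of_trivial] at h1 h2
  exact h1.symm.trans h2

lemma inv_anti {X Y : Matrix n n ℝ} (hX : X.PosDef) (h : X ≤ Y) : Y⁻¹ ≤ X⁻¹ := by
  have := (conj_inv_le_iff (Z := 1) hX.inv (posDef_of_le hX h)).2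
    (by simpa [Matrix.nonsing_inv_nonsing_inv _ ((Matrix.isUnit_iff_isUnit_det _).1 hX.isUnit)])
  simpa using this

lemma exists_smul_one_le {X : Matrix n n ℝ} (hX : X.PosDef) :
    ∃ c : ℝ, 0 < c ∧ c • (1 : Matrix n n ℝ) ≤ X := by
  obtain ⟨c, hc, h⟩ := exists_le_smul_one (transpose_eq_of_nonneg hX.inv.posSemidef.nonneg)
  refine ⟨c⁻¹, by positivity, ?_⟩
  have := inv_anti hX.inv h
  rw [Matrix.nonsing_inv_nonsing_inv _ ((Matrix.isUnit_iff_isUnit_det _).1 hX.isUnit)] at this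
  have h3 : (c • (1 : Matrix n n ℝ))⁻¹ = c⁻¹ • 1 := by
    apply Matrix.inv_eq_left_inv
    simp [smul_smul, hc.ne']
  rwa [h3] at this

lemma abs_apply_le_trace {X : Matrix n n ℝ} (hX : 0 ≤ X) (i j : n) : |X i j| ≤ X.trace := by
  have hP := Matrix.nonneg_iff_posSemidef.1 hX
  have hd : ∀ i, 0 ≤ X i i := fun i => hP.diag_nonneg
  have hs : X j i = X i j := congrFun (congrFun (transpose_eq_of_nonneg hX) i) j
  have ht : ∀ i, X i i ≤ X.trace := fun i =>
    Finset.single_le_sum (f := fun i => X i i) (fun i _ => hd i) (Finset.mem_univ i)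
  have key : ∀ s : ℝ, s ^ 2 = 1 → 0 ≤ X i i + X j j + 2 * s * X i j := fun s h2 => by
    have h := hP.dotProduct_mulVec_nonneg (Pi.single i 1 + Pi.single j s)
    simp only [star_trivial, Matrix.mulVec_add, Matrix.mulVec_single, dotProduct_add,
      add_dotProduct, single_dotProduct, Pi.smul_apply, Matrix.col_apply, MulOpposite.smul_eq_mul_unop,
      MulOpposite.unop_op] at h
    rw [hs] at h
    linear_combination h + X j j * h2
  have h1 := key 1 (by norm_num)
  have h2 := key (-1) (by norm_num)
  have := ht i
  have := ht j
  rw [abs_le]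
  constructor <;> linarith

lemma isCompact_Icc_zero (C : Matrix n n ℝ) : IsCompact (Set.Icc 0 C) := by
  have hK : IsCompact (Set.pi Set.univ fun _ : n => Set.pi Set.univ fun _ : n =>
      Set.Icc (-C.trace) C.trace) :=
    isCompact_univ_pi fun _ => isCompact_univ_pi fun _ => isCompact_Icc
  refine IsCompact.of_isClosed_subset (s := show Set (Matrix n n ℝ) from _) hK isClosed_Icc ?_
  intro X hX i _ j _
  exact abs_le.1 ((abs_apply_le_trace hX.1 i j).trans (trace_mono hX.2))

omit [Fintype n] [DecidableEq n] in
lemma smul_le_smul_of_le {X Y : Matrix n n ℝ} {c : ℝ} (hc : 0 ≤ c) (h : X ≤ Y) :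
    c • X ≤ c • Y := by
  rw [Matrix.le_iff, ← smul_sub]
  exact (Matrix.le_iff.1 h).smul hc

end Loewner

/-! ### Determinants of positive definite matrices -/

section Determinant

open scoped MatrixOrder

variable {n : Type*} [Fintype n] [DecidableEq n]

lemma log_det_le_trace_sub_card {K : Matrix n n ℝ} (hK : K.PosDef) :
    Real.log K.det ≤ K.trace - Fintype.card n := by
  rw [hK.isHermitian.det_eq_prod_eigenvalues, hK.isHermitian.trace_eq_sum_eigenvalues]
  simp only [RCLike.ofReal_real_eq_id, id]
  rw [Real.log_prod fun i _ => (hK.eigenvalues_pos i).ne']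
  calc ∑ i, Real.log (hK.isHermitian.eigenvalues i)
      ≤ ∑ i, (hK.isHermitian.eigenvalues i - 1) :=
        Finset.sum_le_sum fun i _ => Real.log_le_sub_one_of_pos (hK.eigenvalues_pos i)
    _ = _ := by simp [Finset.sum_sub_distrib]

lemma det_ne_zero_of_posDef {M : Matrix n n ℝ} (hM : M.PosDef) : IsUnit M.det :=
  (Matrix.isUnit_iff_isUnit_det _).1 hM.isUnit

/-- A positive definite matrix is congruent to the identity. -/
lemma exists_conj_eq_one {M : Matrix n n ℝ} (hM : M.PosDef) :
    ∃ C : Matrix n n ℝ, IsUnit C.det ∧ C * M * Cᵀ = 1 ∧ Cᵀ * C = M⁻¹ := by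
  set R := CFC.sqrt M⁻¹ with hR
  have hMi : 0 ≤ M⁻¹ := hM.inv.posSemidef.nonneg
  have hRt : Rᵀ = R := transpose_eq_of_nonneg (CFC.sqrt_nonneg _)
  have hRR : R * R = M⁻¹ := CFC.sqrt_mul_sqrt_self _ hMi
  have hMu := det_ne_zero_of_posDef hM
  have hRu : IsUnit R.det := by
    have := det_ne_zero_of_posDef hM.inv
    rw [← hRR, Matrix.det_mul] at this
    exact isUnit_of_mul_isUnit_left this
  refine ⟨R, hRu, ?_, by rw [hRt, hRR]⟩
  have h1 : R * (R * M) = 1 := by rw [← mul_assoc, hRR, Matrix.nonsing_inv_mul _ hMu]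
  rw [hRt, mul_eq_one_comm.1 h1]

/-- Concavity of `log det`, in the form of the tangent inequality at `M`. -/
lemma log_det_sub_log_det_le {M Y : Matrix n n ℝ} (hM : M.PosDef) (hY : Y.PosDef) :
    Real.log Y.det - Real.log M.det ≤ (M⁻¹ * (Y - M)).trace := by
  obtain ⟨C, hC, h1, h2⟩ := exists_conj_eq_one hM
  have hK : (C * Y * Cᵀ).PosDef := by
    have := (Matrix.IsUnit.posDef_star_right_conjugate_iff (x := Y)
      ((Matrix.isUnit_iff_isUnit_det _).2 hC)).2 hY
    simpa [Matrix.star_eq_conjTranspose, Matrix.conjTranspose_eq_transpose_of_trivial] using this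
  have h := log_det_le_trace_sub_card hK
  have e1 : (C * Y * Cᵀ).trace = (M⁻¹ * Y).trace := by
    rw [Matrix.trace_mul_comm, ← mul_assoc, h2]
  have e2 : (C * Y * Cᵀ).det * M.det = Y.det := by
    have := congrArg Matrix.det h1
    simp only [Matrix.det_mul, Matrix.det_one] at this ⊢
    linear_combination Y.det * this
  rw [← e2, Real.log_mul hK.det_pos.ne' hM.det_pos.ne', mul_sub, Matrix.trace_sub,
    Matrix.nonsing_inv_mul _ (det_ne_zero_of_posDef hM), Matrix.trace_one, ← e1]
  linarith

lemma det_le_det {M Y : Matrix n n ℝ} (hM : M.PosDef) (h : M ≤ Y) : M.det ≤ Y.det := by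
  have hY := posDef_of_le hM h
  have h1 := log_det_sub_log_det_le hY hM
  have h2 := trace_mul_nonneg hY.inv.posSemidef.nonneg (sub_nonneg.2 h)
  rw [← neg_sub Y M, mul_neg, Matrix.trace_neg] at h1
  exact (Real.log_le_log_iff hM.det_pos hY.det_pos).1 (by linarith)

/-- The eigenvalues of `K` are at least `1`, so each is at most their product. -/
lemma le_det_smul_one {K : Matrix n n ℝ} (hK : 1 ≤ K) : K ≤ K.det • (1 : Matrix n n ℝ) := by
  have hP : K.PosDef := posDef_of_le Matrix.PosDef.one hK
  set μ := hP.isHermitian.eigenvalues with hμ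
  have h1 : ∀ i, 1 ≤ μ i := fun i => by
    have hv := hP.isHermitian.mulVec_eigenvectorBasis i
    set v : n → ℝ := ⇑(hP.isHermitian.eigenvectorBasis i) with hvdef
    have hn : v ⬝ᵥ v = 1 := by
      have := hP.isHermitian.eigenvectorBasis.orthonormal.1 i
      have h2 := EuclideanSpace.real_norm_sq_eq (hP.isHermitian.eigenvectorBasis i)
      rw [this] at h2
      simp only [dotProduct, ← sq]
      rw [one_pow] at h2
      exact h2.symm
    have h := dotProduct_mulVec_mono hK v
    rw [hv, Matrix.one_mulVec, dotProduct_smul, hn] at h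
    simpa using h
  have hle : ∀ i, μ i ≤ K.det := fun i => by
    rw [hP.isHermitian.det_eq_prod_eigenvalues]
    simp only [RCLike.ofReal_real_eq_id, id]
    rw [← Finset.mul_prod_erase _ _ (Finset.mem_univ i)]
    exact le_mul_of_one_le_right (zero_le_one.trans (h1 i))
      (Finset.one_le_prod fun j _ => h1 j)
  rw [Matrix.le_iff]
  have hs := hP.isHermitian.spectral_theorem
  set U := hP.isHermitian.eigenvectorUnitary
  have : K.det • (1 : Matrix n n ℝ) - K =
      (U : Matrix n n ℝ) * Matrix.diagonal (fun i => K.det - μ i) * (U : Matrix n n ℝ)ᴴ := by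
    have hUU : (U : Matrix n n ℝ) * (U : Matrix n n ℝ)ᴴ = 1 := by
      simpa [Matrix.star_eq_conjTranspose] using Unitary.mul_star_self_of_mem U.2
    have hd : Matrix.diagonal (fun i => K.det - μ i) =
        K.det • (1 : Matrix n n ℝ) - Matrix.diagonal μ := by
      rw [Matrix.smul_one_eq_diagonal, Matrix.diagonal_sub]
    rw [hd, mul_sub, sub_mul, mul_smul_comm, smul_mul_assoc, mul_one, hUU]
    exact congrArg _ hs
  rw [this]
  exact (Matrix.PosSemidef.diagonal fun i => sub_nonneg.2 (hle i)).mul_mul_conjTranspose_same _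

end Determinant

/-! ### Stable matrices -/

section Stability

open scoped MatrixOrder

variable {n : Type*} [Fintype n] [DecidableEq n]

omit [Fintype n] [DecidableEq n] in
lemma smul_le_smul_of_nonneg {P : Matrix n n ℝ} (hP : 0 ≤ P) {c d : ℝ} (h : c ≤ d) :
    c • P ≤ d • P := by
  rw [Matrix.le_iff, ← sub_smul]
  exact (Matrix.nonneg_iff_posSemidef.1 hP).smul (sub_nonneg.2 h)

omit [DecidableEq n] in
lemma conj_conj (M N X : Matrix n n ℝ) : M * (N * X * Nᵀ) * Mᵀ = (M * N) * X * (M * N)ᵀ := by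
  simp only [Matrix.transpose_mul, mul_assoc]

lemma conj_smul (M X : Matrix n n ℝ) (c : ℝ) : M * (c • X) * Mᵀ = c • (M * X * Mᵀ) := by
  simp

lemma tendsto_zero_of_conj_le {N : ℕ → Matrix n n ℝ} {P : Matrix n n ℝ} (hP : P.PosDef)
    {r : ℕ → ℝ} (hr : Tendsto r atTop (𝓝 0)) (h : ∀ k, N k * P * (N k)ᵀ ≤ r k • P) :
    Tendsto N atTop (𝓝 0) := by
  obtain ⟨c, hc, hcP⟩ := exists_smul_one_le hP
  have key : ∀ k i j, |N k i j| ≤ Real.sqrt (r k * P.trace / c) := fun k i j => by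
    have h1 := trace_mono ((conj_mono hcP (N k)).trans (h k))
    rw [conj_smul, Matrix.trace_smul, Matrix.trace_smul, mul_one, smul_eq_mul, smul_eq_mul] at h1
    have h2 : (N k i j) ^ 2 ≤ (N k * (N k)ᵀ).trace := by
      simp only [Matrix.trace, Matrix.diag_apply, Matrix.mul_apply, Matrix.transpose_apply, ← sq]
      exact (Finset.single_le_sum (f := fun j => (N k i j) ^ 2) (fun _ _ => sq_nonneg _)
        (Finset.mem_univ j)).trans (Finset.single_le_sum (f := fun i => ∑ j, (N k i j) ^ 2)
        (fun _ _ => Finset.sum_nonneg fun _ _ => sq_nonneg _) (Finset.mem_univ i))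
    refine Real.abs_le_sqrt ?_
    rw [le_div_iff₀ hc]
    nlinarith
  refine tendsto_pi_nhds.2 fun i => tendsto_pi_nhds.2 fun j => ?_
  refine squeeze_zero_norm (fun k => key k i j) ?_
  have : Tendsto (fun k => Real.sqrt (r k * P.trace / c)) atTop
      (𝓝 (Real.sqrt (0 * P.trace / c))) := ((hr.mul_const _).div_const _).sqrt
  simpa using this

lemma pow_conj_le {M P : Matrix n n ℝ} {ρ : ℝ} (hρ : 0 ≤ ρ) (h : M * P * Mᵀ ≤ ρ • P) (k : ℕ) :
    M ^ k * P * (M ^ k)ᵀ ≤ ρ ^ k • P := by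
  induction k with
  | zero => simp
  | succ k ih =>
    rw [pow_succ', ← conj_conj, pow_succ, mul_smul]
    refine (conj_mono ih M).trans ?_
    rw [conj_smul]
    exact smul_le_smul_of_le (pow_nonneg hρ k) h

/-- A matrix some power of which is a strict contraction in the norm of `P` is stable. -/
lemma tendsto_pow_zero_of_conj_le {M P : Matrix n n ℝ} (hP : P.PosDef) {k : ℕ} (hk : 0 < k)
    {ρ : ℝ} (hρ : ρ < 1) (h : M ^ k * P * (M ^ k)ᵀ ≤ ρ • P) :
    Tendsto (fun j => M ^ j) atTop (𝓝 0) := by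
  wlog hρ0 : 0 ≤ ρ generalizing ρ
  · exact this zero_lt_one
      (h.trans (smul_le_smul_of_nonneg hP.posSemidef.nonneg (not_le.1 hρ0).le)) le_rfl
  obtain ⟨c, hc, hcP⟩ := exists_smul_one_le hP
  have h1 : ∀ j, ∃ b : ℝ, 0 ≤ b ∧ M ^ j * P * (M ^ j)ᵀ ≤ b • P := fun j => by
    obtain ⟨b, hb, hbP⟩ := exists_le_smul_one
      (transpose_eq_of_nonneg (conj_nonneg hP.posSemidef.nonneg (M ^ j)))
    refine ⟨b / c, by positivity, hbP.trans ?_⟩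
    have := smul_le_smul_of_le (by positivity : 0 ≤ b / c) hcP
    rwa [smul_smul, div_mul_cancel₀ _ hc.ne'] at this
  choose b hb0 hb using h1
  set β := ∑ j ∈ Finset.range k, b j
  refine tendsto_zero_of_conj_le hP (r := fun j => β * ρ ^ (j / k)) ?_ fun j => ?_
  · have : Tendsto (fun j => ρ ^ (j / k)) atTop (𝓝 0) :=
      (tendsto_pow_atTop_nhds_zero_of_lt_one hρ0 hρ).comp
        (Nat.tendsto_div_const_atTop hk.ne')
    simpa using this.const_mul β
  · have hj : M ^ j = (M ^ k) ^ (j / k) * M ^ (j % k) := by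
      rw [← pow_mul, ← pow_add, Nat.div_add_mod]
    have hβ : b (j % k) ≤ β := Finset.single_le_sum (f := b) (fun i _ => hb0 i)
      (Finset.mem_range.2 (Nat.mod_lt _ hk))
    rw [hj, ← conj_conj, mul_smul]
    refine (conj_mono ((hb (j % k)).trans
      (smul_le_smul_of_nonneg hP.posSemidef.nonneg hβ)) _).trans ?_
    rw [conj_smul]
    exact smul_le_smul_of_le (Finset.sum_nonneg fun i _ => hb0 i) (pow_conj_le hρ0 h _)

variable {A : Matrix n n ℝ}

lemma tendsto_conj_pow (hA : Tendsto (fun j => A ^ j) atTop (𝓝 0)) (X : Matrix n n ℝ) :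
    Tendsto (fun j => A ^ j * X * (A ^ j)ᵀ) atTop (𝓝 0) := by
  have h : Continuous fun M : Matrix n n ℝ => M * X * Mᵀ := by fun_prop
  simpa [Function.comp_def] using (h.tendsto 0).comp hA

lemma eventually_conj_pow_le (hA : Tendsto (fun j => A ^ j) atTop (𝓝 0)) {P : Matrix n n ℝ}
    (hP : P.PosDef) {ε : ℝ} (hε : 0 < ε) :
    ∀ᶠ j in atTop, A ^ j * P * (A ^ j)ᵀ ≤ ε • P := by
  obtain ⟨c, hc, hcP⟩ := exists_smul_one_le hP
  have h : Continuous fun X : Matrix n n ℝ => ∑ i, ∑ j, |X i j| := by fun_prop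
  have h1 := (h.tendsto 0).comp (tendsto_conj_pow hA P)
  simp only [Matrix.zero_apply, abs_zero, Finset.sum_const_zero] at h1
  filter_upwards [h1.eventually_le_const (show 0 < ε * c by positivity)] with j hj
  refine (le_sum_abs_smul_one (transpose_eq_of_nonneg
    (conj_nonneg hP.posSemidef.nonneg (A ^ j)))).trans ((smul_one_mono hj).trans ?_)
  rw [mul_smul]
  exact smul_le_smul_of_le hε.le hcP

lemma nonpos_of_le_conj (hA : Tendsto (fun j => A ^ j) atTop (𝓝 0)) {Y : Matrix n n ℝ}
    (h : Y ≤ A * Y * Aᵀ) : Y ≤ 0 := by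
  refine ge_of_tendsto' (tendsto_conj_pow hA Y) fun j => ?_
  induction j with
  | zero => simp
  | succ j ih =>
    rw [pow_succ', ← conj_conj]
    exact h.trans (conj_mono ih A)

/-- A stable matrix has a quadratic Lyapunov function. -/
lemma exists_lyapunov (hA : Tendsto (fun j => A ^ j) atTop (𝓝 0)) :
    ∃ Z : Matrix n n ℝ, 0 ≤ Z ∧ A * Z * Aᵀ + 1 ≤ Z := by
  obtain ⟨N, hN⟩ := (eventually_conj_pow_le hA (Matrix.PosDef.one (n := n) (R := ℝ))
    (show (0 : ℝ) < 1 / 2 by norm_num)).exists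
  refine ⟨(2 : ℝ) • ∑ k ∈ Finset.range N, A ^ k * 1 * (A ^ k)ᵀ, ?_, ?_⟩
  · rw [Matrix.nonneg_iff_posSemidef]
    refine (Matrix.posSemidef_sum _ fun k _ => ?_).smul zero_le_two
    exact Matrix.nonneg_iff_posSemidef.1 (conj_nonneg Matrix.PosSemidef.one.nonneg _)
  · rw [conj_smul, Finset.mul_sum, Finset.sum_mul]
    simp only [conj_conj, ← pow_succ']
    have h1 := Finset.sum_range_succ' (fun k => A ^ k * 1 * (A ^ k)ᵀ) N
    rw [Finset.sum_range_succ] at h1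
    have h2 : ∑ k ∈ Finset.range N, A ^ (k + 1) * 1 * (A ^ (k + 1))ᵀ =
        ∑ k ∈ Finset.range N, A ^ k * 1 * (A ^ k)ᵀ + A ^ N * 1 * (A ^ N)ᵀ - 1 := by
      rw [h1]; simp
    rw [h2, smul_sub, smul_add]
    have h3 := smul_le_smul_of_le (zero_le_two (α := ℝ)) hN
    rw [smul_smul, show (2 : ℝ) * (1 / 2) = 1 by norm_num, one_smul] at h3
    calc _ ≤ (2 : ℝ) • ∑ k ∈ Finset.range N, A ^ k * 1 * (A ^ k)ᵀ + 1 - (2 : ℝ) • 1 + 1 := by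
          gcongr
      _ = _ := by rw [two_smul ℝ (1 : Matrix n n ℝ)]; abel

end Stability

/-! ### The gain and the noise covariance of the stationary channel -/

section Feasible

open scoped MatrixOrder

variable {p q : ℕ} {A : Matrix (Fin p) (Fin p) ℝ} {B : Matrix (Fin p) (Fin q) ℝ}
  {P : Matrix (Fin p) (Fin p) ℝ}

lemma le_predCov_iff : (predCov A B P - P).PosSemidef ↔ P ≤ predCov A B P := Iff.rfl

lemma predCov_posDef (hP : P.PosDef) (hL : P ≤ predCov A B P) : (predCov A B P).PosDef :=
  posDef_of_le hP hL

/-- The covariance after `m` steps of the source started at `0`. -/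
def gram (A : Matrix (Fin p) (Fin p) ℝ) (B : Matrix (Fin p) (Fin q) ℝ) (m : ℕ) :
    Matrix (Fin p) (Fin p) ℝ :=
  (fun X => predCov A B X)^[m] 0

lemma predCov_iterate_sub (X Y : Matrix (Fin p) (Fin p) ℝ) (m : ℕ) :
    (fun X => predCov A B X)^[m] X - (fun X => predCov A B X)^[m] Y =
      A ^ m * (X - Y) * (A ^ m)ᵀ := by
  induction m with
  | zero => simp
  | succ m ih =>
    rw [Function.iterate_succ_apply', Function.iterate_succ_apply', pow_succ', ← conj_conj, ← ih]
    simp only [predCov, mul_sub, sub_mul]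
    abel

lemma predCov_mono {X Y : Matrix (Fin p) (Fin p) ℝ} (h : X ≤ Y) :
    predCov A B X ≤ predCov A B Y := by
  unfold predCov
  gcongr
  exact conj_mono h A

lemma le_predCov_iterate (hL : P ≤ predCov A B P) (m : ℕ) :
    P ≤ (fun X => predCov A B X)^[m] P := by
  induction m with
  | zero => simp
  | succ m ih =>
    rw [Function.iterate_succ_apply']
    exact hL.trans (predCov_mono ih)

/-- If the constraint set is nonempty and `A` is stable, then `(A, B)` is controllable. -/
lemma exists_gram_posDef (hA : Tendsto (fun j => A ^ j) atTop (𝓝 0)) (hP : P.PosDef)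
    (hL : P ≤ predCov A B P) : ∃ m, (gram A B m).PosDef := by
  obtain ⟨m, hm⟩ := (eventually_conj_pow_le hA hP (show (0 : ℝ) < 1 / 2 by norm_num)).exists
  refine ⟨m, posDef_of_le (hP.smul (show (0 : ℝ) < 1 / 2 by norm_num)) ?_⟩
  have h1 := predCov_iterate_sub (A := A) (B := B) P 0 m
  rw [sub_zero, sub_eq_iff_eq_add] at h1
  have h2 := le_predCov_iterate hL m
  rw [h1] at h2
  have h3 : (1 / 2 : ℝ) • P + (1 / 2 : ℝ) • P = P := by
    rw [← add_smul]; norm_num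
  have h4 := h2.trans (add_le_add_left hm _)
  nth_rewrite 1 [← h3] at h4
  exact le_of_add_le_add_left h4

lemma conj_gainH_aux (hP : P.PosDef) (hL : P ≤ predCov A B P) :
    (gainH A B P)ᵀ = 1 - (predCov A B P)⁻¹ * P ∧
    (predCov A B P)⁻¹ * predCov A B P = 1 ∧ predCov A B P * (predCov A B P)⁻¹ = 1 := by
  have hLP := predCov_posDef hP hL
  refine ⟨?_, Matrix.nonsing_inv_mul _ (det_ne_zero_of_posDef hLP),
    Matrix.mul_nonsing_inv _ (det_ne_zero_of_posDef hLP)⟩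
  rw [gainH, Matrix.transpose_sub, Matrix.transpose_one, Matrix.transpose_mul,
    transpose_eq_of_nonneg hLP.inv.posSemidef.nonneg, transpose_eq_of_nonneg hP.posSemidef.nonneg]

lemma noise_eq (hP : P.PosDef) (hL : P ≤ predCov A B P) :
    P * (gainH A B P)ᵀ = P - P * (predCov A B P)⁻¹ * P := by
  rw [(conj_gainH_aux hP hL).1, mul_sub, mul_one, mul_assoc]

lemma noise_nonneg (hP : P.PosDef) (hL : P ≤ predCov A B P) : 0 ≤ P * (gainH A B P)ᵀ := by
  rw [noise_eq hP hL, sub_nonneg]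
  have hPt := transpose_eq_of_nonneg hP.posSemidef.nonneg
  have := (conj_inv_le_iff (Z := P) hP (predCov_posDef hP hL)).2 (by
    rwa [hPt, Matrix.mul_nonsing_inv _ (det_ne_zero_of_posDef hP), one_mul])
  rwa [hPt] at this

lemma one_sub_gainH : 1 - gainH A B P = P * (predCov A B P)⁻¹ := sub_sub_cancel _ _

lemma transpose_one_sub_gainH (hP : P.PosDef) (hL : P ≤ predCov A B P) :
    (1 - gainH A B P)ᵀ = (predCov A B P)⁻¹ * P := by
  rw [Matrix.transpose_sub, (conj_gainH_aux hP hL).1, Matrix.transpose_one, sub_sub_cancel]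

/-- The posterior covariance, in Joseph's form. -/
lemma conj_one_sub_gainH (hP : P.PosDef) (hL : P ≤ predCov A B P) :
    (1 - gainH A B P) * predCov A B P * (1 - gainH A B P)ᵀ + P * (gainH A B P)ᵀ = P := by
  obtain ⟨h1, h2, h3⟩ := conj_gainH_aux hP hL
  rw [transpose_one_sub_gainH hP hL, noise_eq hP hL, one_sub_gainH, mul_assoc P, h2, mul_one,
    mul_assoc P]
  abel

/-- The covariance of the increment `H ξ + v` of the reproduction. -/
lemma conj_gainH (hP : P.PosDef) (hL : P ≤ predCov A B P) :
    gainH A B P * predCov A B P * (gainH A B P)ᵀ + P * (gainH A B P)ᵀ = predCov A B P - P := by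
  obtain ⟨h1, h2, h3⟩ := conj_gainH_aux hP hL
  rw [← add_mul, h1, gainH, sub_mul, one_mul, mul_assoc P, h2, mul_one, sub_add_cancel, mul_sub,
    mul_one, ← mul_assoc, h3, one_mul]

/-- The error `(I - H) ξ - v` is uncorrelated with the increment `H ξ + v`. -/
lemma cross_gainH (hP : P.PosDef) (hL : P ≤ predCov A B P) :
    (1 - gainH A B P) * predCov A B P * (gainH A B P)ᵀ = P * (gainH A B P)ᵀ := by
  obtain ⟨h1, h2, h3⟩ := conj_gainH_aux hP hL
  rw [one_sub_gainH, mul_assoc P, h2, mul_one]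

/-- The error recursion of the stationary channel is stable. A state along which the quadratic
form of `P` does not decrease is invisible to the channel noise, hence to the gain `H`, and evolves
as under the stable matrix `A`. -/
lemma tendsto_closedLoop_pow (hA : Tendsto (fun j => A ^ j) atTop (𝓝 0)) (hP : P.PosDef)
    (hL : P ≤ predCov A B P) :
    Tendsto (fun j => ((1 - gainH A B P) * A) ^ j) atTop (𝓝 0) := by
  set H := gainH A B P with hH
  set G := (1 - H) * A with hG
  have hP0 := hP.posSemidef.nonneg
  have step : G * P * Gᵀ + P * Hᵀ ≤ P := by
    have h1 : A * P * Aᵀ ≤ predCov A B P :=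
      le_add_of_nonneg_right (mul_transpose_self_nonneg B)
    have h2 := conj_mono h1 (1 - H)
    rw [conj_conj] at h2
    calc _ ≤ (1 - H) * predCov A B P * (1 - H)ᵀ + P * Hᵀ := by gcongr
      _ = P := conj_one_sub_gainH hP hL
  have step' : ∀ j, G ^ (j + 1) * P * (G ^ (j + 1))ᵀ + G ^ j * (P * Hᵀ) * (G ^ j)ᵀ ≤
      G ^ j * P * (G ^ j)ᵀ := fun j => by
    have := conj_mono step (G ^ j)
    rwa [mul_add, add_mul, conj_conj, ← pow_succ] at this
  have hmono : Antitone fun j => G ^ j * P * (G ^ j)ᵀ := antitone_nat_of_succ_le fun j =>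
    (le_add_of_nonneg_right (conj_nonneg (noise_nonneg hP hL) _)).trans (step' j)
  obtain ⟨k, hk1, hk0⟩ := ((eventually_conj_pow_le hA hP (show (0 : ℝ) < 1 / 2 by norm_num)).and
    (eventually_gt_atTop 0)).exists
  have hD : (P - G ^ k * P * (G ^ k)ᵀ).PosDef := by
    refine .of_dotProduct_mulVec_pos ?_ fun {z} hz => ?_
    · exact hP.isHermitian.sub (Matrix.nonneg_iff_posSemidef.1 (conj_nonneg hP0 _)).isHermitian
    · simp only [star_trivial, Matrix.sub_mulVec, dotProduct_sub, sub_pos]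
      by_contra! hcon
      -- the chain of inequalities `step'` collapses along `z`, so the noise terms vanish
      have hnoise : ∀ j < k, Hᵀ *ᵥ ((G ^ j)ᵀ *ᵥ z) = 0 := fun j hj => by
        have h1 := dotProduct_mulVec_mono (step' j) z
        have h2 := dotProduct_mulVec_mono (hmono (Nat.zero_le j)) z
        have h3 := dotProduct_mulVec_mono (hmono (Nat.succ_le_of_lt hj)) z
        simp only [Matrix.add_mulVec, dotProduct_add, pow_zero, one_mul, Matrix.transpose_one,
          mul_one, Nat.succ_eq_add_one] at h1 h2 h3
        rw [dotProduct_conj_mulVec (G ^ j) (P * Hᵀ)] at h1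
        set u := (G ^ j)ᵀ *ᵥ z
        have h4 := dotProduct_mulVec_mono (noise_nonneg hP hL) u
        simp only [Matrix.zero_mulVec, dotProduct_zero] at h4
        have h5 : u ⬝ᵥ (P * Hᵀ) *ᵥ u = 0 := le_antisymm (by linarith) h4
        have h6 := ((Matrix.nonneg_iff_posSemidef.1
          (noise_nonneg hP hL)).dotProduct_mulVec_zero_iff u).1 (by simpa using h5)
        rw [← Matrix.mulVec_mulVec] at h6
        have hPu := det_ne_zero_of_posDef hP
        have h7 := congrArg (P⁻¹ *ᵥ ·) h6
        simpa only [Matrix.mulVec_mulVec, ← mul_assoc, Matrix.nonsing_inv_mul _ hPu, one_mul,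
          Matrix.mulVec_zero] using h7
      have hAG : ∀ j ≤ k, (G ^ j)ᵀ *ᵥ z = (A ^ j)ᵀ *ᵥ z := fun j => by
        induction j with
        | zero => simp
        | succ j ih =>
          intro hj
          rw [pow_succ, Matrix.transpose_mul, ← Matrix.mulVec_mulVec, hG, Matrix.transpose_mul,
            ← Matrix.mulVec_mulVec, Matrix.transpose_sub, Matrix.sub_mulVec, ← hG,
            hnoise j hj, ih (by omega), pow_succ, Matrix.transpose_mul, ← Matrix.mulVec_mulVec]
          simp
      rw [dotProduct_conj_mulVec, hAG k le_rfl, ← dotProduct_conj_mulVec] at hcon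
      have h1 := dotProduct_mulVec_mono hk1 z
      have h2 := hP.dotProduct_mulVec_pos hz
      simp only [Matrix.smul_mulVec, dotProduct_smul, smul_eq_mul, star_trivial] at h1 h2
      linarith
  obtain ⟨c, hc, hcD⟩ := exists_smul_one_le hD
  obtain ⟨b, hb, hbP⟩ := exists_le_smul_one (transpose_eq_of_nonneg hP0)
  refine tendsto_pow_zero_of_conj_le hP hk0 (ρ := 1 - c / b) (by linarith [div_pos hc hb]) ?_
  have h1 := smul_le_smul_of_le (div_pos hc hb).le hbP
  rw [smul_smul, div_mul_cancel₀ _ hb.ne'] at h1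
  have h2 := h1.trans hcD
  rw [sub_smul, one_smul, le_sub_comm]
  exact h2

end Feasible

/-! ### The asymptotic optimization problem -/

section Optimization

open scoped MatrixOrder

variable {p q : ℕ} {A : Matrix (Fin p) (Fin p) ℝ} {B : Matrix (Fin p) (Fin q) ℝ}
  {P : Matrix (Fin p) (Fin p) ℝ} {D : ℝ≥0∞}

/-- `H = Π (Π⁻¹ - Λ⁻¹)` is a product of a positive definite and a positive semidefinite matrix, so it
is similar to a positive semidefinite matrix. -/
lemma gainH_similar_diagonal (hP : P.PosDef) (hL : P ≤ predCov A B P) :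
    ∃ (E : Matrix (Fin p) (Fin p) ℝ) (d : Fin p → ℝ), IsUnit E.det ∧ (∀ i, 0 ≤ d i) ∧
      gainH A B P = E⁻¹ * Matrix.diagonal d * E := by
  obtain ⟨C, hC, h1, h2⟩ := exists_conj_eq_one hP
  set L := predCov A B P with hLdef
  have hPu := det_ne_zero_of_posDef hP
  have hPt := transpose_eq_of_nonneg hP.posSemidef.nonneg
  set K := (C * P) * (P⁻¹ - L⁻¹) * (C * P)ᵀ with hK
  have hK0 : K.PosSemidef :=
    Matrix.nonneg_iff_posSemidef.1 (conj_nonneg (sub_nonneg.2 (inv_anti hP hL)) _)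
  have hKC : K * C = C * gainH A B P := by
    rw [hK, Matrix.transpose_mul, hPt, mul_assoc, mul_assoc P, h2, Matrix.mul_nonsing_inv _ hPu,
      mul_one, mul_assoc, mul_sub, Matrix.mul_nonsing_inv _ hPu, gainH]
  have hs := hK0.isHermitian.spectral_theorem
  rw [Unitary.conjStarAlgAut_apply] at hs
  set U := hK0.isHermitian.eigenvectorUnitary
  have hUU : star (U : Matrix (Fin p) (Fin p) ℝ) * (U : Matrix (Fin p) (Fin p) ℝ) = 1 :=
    Unitary.star_mul_self_of_mem U.2
  have hUU' : (U : Matrix (Fin p) (Fin p) ℝ) * star (U : Matrix (Fin p) (Fin p) ℝ) = 1 :=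
    Unitary.mul_star_self_of_mem U.2
  have hUdet : IsUnit (star (U : Matrix (Fin p) (Fin p) ℝ)).det := by
    have := congrArg Matrix.det hUU
    rw [Matrix.det_mul, Matrix.det_one] at this
    exact IsUnit.of_mul_eq_one _ this
  refine ⟨star (U : Matrix (Fin p) (Fin p) ℝ) * C, hK0.isHermitian.eigenvalues, ?_,
    fun i => hK0.eigenvalues_nonneg i, ?_⟩
  · rw [Matrix.det_mul]
    exact hUdet.mul hC
  · have hinv : (star (U : Matrix (Fin p) (Fin p) ℝ) * C)⁻¹ = C⁻¹ * U := by
      refine Matrix.inv_eq_left_inv ?_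
      rw [mul_assoc, ← mul_assoc (U : Matrix (Fin p) (Fin p) ℝ), hUU', one_mul,
        Matrix.nonsing_inv_mul _ hC]
    have hd : (RCLike.ofReal ∘ hK0.isHermitian.eigenvalues : Fin p → ℝ) =
        hK0.isHermitian.eigenvalues := rfl
    rw [hd] at hs
    calc gainH A B P = C⁻¹ * (C * gainH A B P) := by
          rw [← mul_assoc, Matrix.nonsing_inv_mul _ hC, one_mul]
      _ = C⁻¹ * (K * C) := by rw [hKC]
      _ = _ := by
        rw [hinv]
        conv_lhs => rw [hs]
        simp only [mul_assoc]

lemma objective_eq (hP : P.PosDef) (hL : P ≤ predCov A B P) :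
    objective A B P = 1 / 2 * (Real.log (predCov A B P).det - Real.log P.det) := by
  rw [objective, Real.log_div (predCov_posDef hP hL).det_pos.ne' hP.det_pos.ne']

lemma objective_nonneg (hP : P.PosDef) (hL : P ≤ predCov A B P) : 0 ≤ objective A B P := by
  rw [objective_eq hP hL]
  have := Real.log_le_log hP.det_pos (det_le_det hP hL)
  linarith

lemma le_smul_lyapunov (hA : Tendsto (fun j => A ^ j) atTop (𝓝 0))
    {Z : Matrix (Fin p) (Fin p) ℝ} (hZ : A * Z * Aᵀ + 1 ≤ Z) {b : ℝ} (hb : 0 ≤ b)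
    {X : Matrix (Fin p) (Fin p) ℝ} (hX : X ≤ A * X * Aᵀ + b • 1) : X ≤ b • Z := by
  rw [← sub_nonpos]
  refine nonpos_of_le_conj hA ?_
  have h := smul_le_smul_of_le hb hZ
  rw [smul_add, ← conj_smul] at h
  rw [mul_sub, sub_mul, sub_le_sub_iff]
  calc X + A * b • Z * Aᵀ ≤ A * X * Aᵀ + b • 1 + A * b • Z * Aᵀ := by gcongr
    _ = A * X * Aᵀ + (A * b • Z * Aᵀ + b • 1) := by abel
    _ ≤ _ := by gcongr

/-- The constraint `X ≤ A X Aᵀ + B Bᵀ` bounds `X` even when it is relaxed by the identity. -/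
lemma exists_bound (hA : Tendsto (fun j => A ^ j) atTop (𝓝 0)) (B : Matrix (Fin p) (Fin q) ℝ) :
    ∃ C : Matrix (Fin p) (Fin p) ℝ, ∀ X, X ≤ predCov A B X + 1 → X ≤ C := by
  obtain ⟨Z, -, hZ⟩ := exists_lyapunov hA
  obtain ⟨b, hb, hB⟩ := exists_le_smul_one (transpose_eq_of_nonneg (mul_transpose_self_nonneg B))
  refine ⟨(b + 1) • Z, fun X hX => le_smul_lyapunov hA hZ (by positivity) (hX.trans ?_)⟩
  rw [predCov, add_smul, one_smul, add_assoc]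
  gcongr

lemma det_predCov_le {J : ℝ} {X : Matrix (Fin p) (Fin p) ℝ} (hX : X.PosDef)
    (hL : X ≤ predCov A B X) (h : objective A B X ≤ J) :
    (predCov A B X).det ≤ Real.exp (2 * J) * X.det := by
  have h1 := (predCov_posDef hX hL).det_pos
  have h2 := hX.det_pos
  rw [objective] at h
  rw [← div_le_iff₀ h2, ← Real.log_le_iff_le_exp (by positivity)]
  linarith

lemma le_of_conj_le {n : Type*} [Fintype n] [DecidableEq n] {C X Y : Matrix n n ℝ}
    (hC : IsUnit C.det) (h : C * X * Cᵀ ≤ C * Y * Cᵀ) : X ≤ Y := by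
  have := conj_mono h C⁻¹
  rwa [conj_conj, conj_conj, Matrix.nonsing_inv_mul _ hC, Matrix.transpose_one, one_mul, one_mul,
    mul_one, mul_one] at this

/-- The part of the constraint set that satisfies a further closed condition `F` is compact. -/
lemma isCompact_constraint (hA : Tendsto (fun j => A ^ j) atTop (𝓝 0))
    (B : Matrix (Fin p) (Fin q) ℝ) (D : ℝ≥0∞) {F : Set (Matrix (Fin p) (Fin p) ℝ)}
    (hF : IsClosed F) :
    IsCompact {X | 0 ≤ X ∧ X ≤ predCov A B X ∧ ENNReal.ofReal X.trace ≤ D ∧ X ∈ F} := by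
  obtain ⟨C, hC⟩ := exists_bound hA B
  refine (isCompact_Icc_zero C).of_isClosed_subset ?_
    fun X hX => ⟨hX.1, hC X (hX.2.1.trans (le_add_of_nonneg_right
      Matrix.PosSemidef.one.nonneg))⟩
  refine (isClosed_nonneg).inter (IsClosed.inter ?_ (IsClosed.inter ?_ hF))
  · exact isClosed_le continuous_id (by unfold predCov; fun_prop)
  · exact isClosed_le (ENNReal.continuous_ofReal.comp
      (continuous_id.matrix_trace)) continuous_const

/-- If `A` is invertible, a bound on the objective forces `B Bᵀ ≤ c A X Aᵀ`. For singular `X`, the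
kernel of `X` would then be a subspace stable under `A⁻ᵀ` and annihilated by `Bᵀ`, on which the
quadratic form of a feasible point would have to grow under the stable matrix `Aᵀ`. -/
lemma posDef_of_le_smul_conj (hA : Tendsto (fun j => A ^ j) atTop (𝓝 0)) (hAu : IsUnit A.det)
    (hP : P.PosDef) (hL : P ≤ predCov A B P) {X : Matrix (Fin p) (Fin p) ℝ} (hX : 0 ≤ X)
    (hXL : X ≤ predCov A B X) {c : ℝ} (hc : B * Bᵀ ≤ c • (A * X * Aᵀ)) : X.PosDef := by
  have hX' := Matrix.nonneg_iff_posSemidef.1 hX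
  refine .of_dotProduct_mulVec_pos hX'.isHermitian fun {z} hz => ?_
  refine lt_of_le_of_ne (hX'.dotProduct_mulVec_nonneg z) fun hcon => hz ?_
  simp only [star_trivial] at hcon
  -- the orbit of `z` under the inverse of `Aᵀ`
  set y : ℕ → Fin p → ℝ := fun k => (Aᵀ)⁻¹ ^ k *ᵥ z with hy
  have hAt : IsUnit (Aᵀ).det := by rwa [Matrix.det_transpose]
  have hy1 : ∀ k, Aᵀ *ᵥ y (k + 1) = y k := fun k => by
    simp only [hy]
    rw [pow_succ', Matrix.mulVec_mulVec, ← mul_assoc, Matrix.mul_nonsing_inv _ hAt, one_mul]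
  have hstep : ∀ k, y (k + 1) ⬝ᵥ (A * X * Aᵀ) *ᵥ y (k + 1) = y k ⬝ᵥ X *ᵥ y k := fun k => by
    rw [dotProduct_conj_mulVec, hy1]
  have hB : ∀ k, y k ⬝ᵥ X *ᵥ y k = 0 → y (k + 1) ⬝ᵥ (B * Bᵀ) *ᵥ y (k + 1) ≤ 0 := fun k hk => by
    have := dotProduct_mulVec_mono hc (y (k + 1))
    rwa [Matrix.smul_mulVec, dotProduct_smul, hstep, hk, smul_zero] at this
  have hker : ∀ k, y k ⬝ᵥ X *ᵥ y k = 0 := fun k => by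
    induction k with
    | zero => simpa [hy] using hcon.symm
    | succ k ih =>
      refine le_antisymm ?_ (by simpa using hX'.dotProduct_mulVec_nonneg (y (k + 1)))
      have := dotProduct_mulVec_mono hXL (y (k + 1))
      rw [predCov, Matrix.add_mulVec, dotProduct_add, hstep, ih] at this
      linarith [hB k ih]
  have hV : ∀ k, y k ⬝ᵥ P *ᵥ y k ≤ z ⬝ᵥ P *ᵥ z := fun k => by
    induction k with
    | zero => simp [hy]
    | succ k ih =>
      have := dotProduct_mulVec_mono hL (y (k + 1))
      rw [predCov, Matrix.add_mulVec, dotProduct_add, dotProduct_conj_mulVec, hy1] at this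
      linarith [hB k (hker k)]
  obtain ⟨k, hk⟩ := (eventually_conj_pow_le hA hP (show (0 : ℝ) < 1 / 2 by norm_num)).exists
  have hzk : (A ^ k)ᵀ *ᵥ y k = z := by
    simp only [hy]
    rw [Matrix.transpose_pow, Matrix.mulVec_mulVec, Matrix.inv_pow', Matrix.mul_nonsing_inv,
      Matrix.one_mulVec]
    rw [Matrix.det_pow]
    exact hAt.pow k
  have h1 := dotProduct_mulVec_mono hk (y k)
  rw [dotProduct_conj_mulVec, hzk, Matrix.smul_mulVec, dotProduct_smul, smul_eq_mul] at h1
  by_contra hz0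
  have := hP.dotProduct_mulVec_pos hz0
  simp only [star_trivial] at this
  linarith [hV k]

lemma isUnit_of_rank_eq {M : Matrix (Fin p) (Fin p) ℝ} (h : M.rank = p) : IsUnit M := by
  rw [← Matrix.mulVec_surjective_iff_isUnit]
  refine (LinearMap.range_eq_top (f := M.mulVecLin)).1 (Submodule.eq_top_of_finrank_eq ?_)
  simpa [Matrix.rank] using h

/-- The sublevel sets of the objective lie in compact sets of feasible points. A closed condition that
follows from the bound on the objective excludes singular limits: `B Bᵀ ≤ c A X Aᵀ` for invertible
`A`, and a lower bound of the determinant for invertible `B`. -/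
lemma exists_isCompact_sublevel (hA : Tendsto (fun j => A ^ j) atTop (𝓝 0))
    (hAB : A.rank = p ∨ (q = p ∧ B.rank = p)) (hP : P ∈ feasibleSet A B D) (J : ℝ) :
    ∃ K ⊆ feasibleSet A B D, IsCompact K ∧
      ∀ X ∈ feasibleSet A B D, objective A B X ≤ J → X ∈ K := by
  rcases hAB with hA1 | ⟨-, hB1⟩
  · have hAu : IsUnit A.det := by
      rw [← Matrix.isUnit_iff_isUnit_det]
      exact isUnit_of_rank_eq hA1
    set c := Real.exp (2 * J) / A.det ^ 2 with hc
    refine ⟨_, ?_, isCompact_constraint hA B D (F := {X | B * Bᵀ ≤ c • (A * X * Aᵀ)})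
      (isClosed_le continuous_const (by fun_prop)), ?_⟩
    · rintro X ⟨h1, h2, h3, h4⟩
      exact ⟨posDef_of_le_smul_conj hA hAu hP.1 hP.2.1 h1 h2 h4, h2, h3⟩
    · rintro X ⟨h1, h2, h3⟩ hJ
      refine ⟨h1.posSemidef.nonneg, h2, h3, ?_⟩
      set L := predCov A B X with hL
      have hM : (A * X * Aᵀ).PosDef := by
        have := (Matrix.IsUnit.posDef_star_right_conjugate_iff (x := X)
          ((Matrix.isUnit_iff_isUnit_det _).2 hAu)).2 h1
        simpa [Matrix.star_eq_conjTranspose, Matrix.conjTranspose_eq_transpose_of_trivial] using this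
      obtain ⟨C, hC, hC1, hC2⟩ := exists_conj_eq_one hM
      have hML : A * X * Aᵀ ≤ L := le_add_of_nonneg_right (mul_transpose_self_nonneg B)
      -- in coordinates in which `A X Aᵀ` is the identity, `L` is at most its determinant
      have hK := conj_mono hML C
      rw [hC1] at hK
      have hK2 := le_det_smul_one hK
      have hdet : (C * L * Cᵀ).det ≤ c := by
        have e1 := congrArg Matrix.det hC1
        have e2 := det_predCov_le h1 h2 hJ
        simp only [Matrix.det_mul, Matrix.det_transpose, Matrix.det_one] at e1 ⊢
        have hA0 : A.det ≠ 0 := hAu.ne_zero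
        have e3 : C.det ^ 2 * X.det = 1 / A.det ^ 2 := by
          field_simp
          linear_combination e1
        calc C.det * L.det * C.det = C.det ^ 2 * L.det := by ring
          _ ≤ C.det ^ 2 * (Real.exp (2 * J) * X.det) := by gcongr
          _ = c := by rw [hc]; linear_combination Real.exp (2 * J) * e3
      have hK3 : C * L * Cᵀ ≤ C * (c • (A * X * Aᵀ)) * Cᵀ := by
        rw [conj_smul, hC1]
        exact hK2.trans (smul_one_mono hdet)
      exact (le_add_of_nonneg_left (conj_nonneg h1.posSemidef.nonneg A)).trans
        (le_of_conj_le hC hK3)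
  · have hBB : (B * Bᵀ).PosDef := by
      refine (Matrix.nonneg_iff_posSemidef.1 (mul_transpose_self_nonneg B)).posDef_iff_isUnit.2 ?_
      exact isUnit_of_rank_eq (by rw [Matrix.rank_self_mul_transpose, hB1])
    set c := (B * Bᵀ).det / Real.exp (2 * J) with hc
    have hc0 : 0 < c := div_pos hBB.det_pos (Real.exp_pos _)
    refine ⟨_, ?_, isCompact_constraint hA B D (F := {X | c ≤ X.det})
      (isClosed_le continuous_const (by fun_prop)), ?_⟩
    · rintro X ⟨h1, h2, h3, h4⟩
      exact ⟨(Matrix.nonneg_iff_posSemidef.1 h1).posDef_iff_det_ne_zero.2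
        (hc0.trans_le h4).ne', h2, h3⟩
    · rintro X ⟨h1, h2, h3⟩ hJ
      refine ⟨h1.posSemidef.nonneg, h2, h3, ?_⟩
      rw [Set.mem_ofPred_eq, hc, div_le_iff₀ (Real.exp_pos _), mul_comm]
      exact (det_le_det hBB (le_add_of_nonneg_left
        (conj_nonneg h1.posSemidef.nonneg A))).trans (det_predCov_le h1 h2 hJ)

lemma continuousOn_objective : ContinuousOn (objective A B) (feasibleSet A B D) := by
  intro X hX
  have h1 := (predCov_posDef hX.1 hX.2.1).det_pos
  have h2 := hX.1.det_pos
  refine ContinuousAt.continuousWithinAt ?_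
  unfold objective
  refine continuousAt_const.mul (ContinuousAt.log (ContinuousAt.div ?_ ?_ h2.ne')
    (div_pos h1 h2).ne')
  · refine Continuous.continuousAt ?_
    unfold predCov
    fun_prop
  · exact (by fun_prop : Continuous fun X : Matrix (Fin p) (Fin p) ℝ => X.det).continuousAt

/-- The minimum of the asymptotic problem is attained. -/
lemma exists_minimizer (hA : Tendsto (fun j => A ^ j) atTop (𝓝 0))
    (hAB : A.rank = p ∨ (q = p ∧ B.rank = p)) (hP : P ∈ feasibleSet A B D) :
    ∃ X ∈ feasibleSet A B D, ∀ Y ∈ feasibleSet A B D, objective A B X ≤ objective A B Y := by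
  obtain ⟨K, hKF, hK, hJ⟩ := exists_isCompact_sublevel hA hAB hP (objective A B P)
  obtain ⟨X, hXK, hX⟩ := hK.exists_isMinOn ⟨P, hJ P hP le_rfl⟩ (continuousOn_objective.mono hKF)
  refine ⟨X, hKF hXK, fun Y hY => ?_⟩
  by_cases h : objective A B Y ≤ objective A B P
  · exact hX (hJ Y hY h)
  · exact (hX (hJ P hP le_rfl)).trans (not_le.1 h).le

/-- Twice the differential of the objective at `P`. -/
noncomputable def slope (A : Matrix (Fin p) (Fin p) ℝ) (B : Matrix (Fin p) (Fin q) ℝ)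
    (P Y : Matrix (Fin p) (Fin p) ℝ) : ℝ :=
  ((predCov A B P)⁻¹ * (A * Y * Aᵀ)).trace - (P⁻¹ * Y).trace

lemma continuous_slope (P : Matrix (Fin p) (Fin p) ℝ) : Continuous (slope A B P) := by
  unfold slope
  fun_prop

lemma predCov_lineMap (X : Matrix (Fin p) (Fin p) ℝ) (s : ℝ) :
    predCov A B ((1 - s) • P + s • X) = (1 - s) • predCov A B P + s • predCov A B X := by
  simp only [predCov, mul_add, add_mul, mul_smul_comm, smul_mul_assoc, smul_add]
  have : B * Bᵀ = (1 - s) • (B * Bᵀ) + s • (B * Bᵀ) := by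
    rw [← add_smul, sub_add_cancel, one_smul]
  nth_rewrite 1 [this]
  abel

/-- The first order optimality condition for a minimizer, in the direction of any `X` in the closed
constraint set. The objective is differentiated along the segment from `P` to `X`, whose interior is
feasible even for singular `X`. -/
lemma slope_nonneg (hP : P ∈ feasibleSet A B D)
    (hmin : ∀ Y ∈ feasibleSet A B D, objective A B P ≤ objective A B Y)
    {X : Matrix (Fin p) (Fin p) ℝ} (hX : 0 ≤ X) (hXL : X ≤ predCov A B X)
    (hXD : ENNReal.ofReal X.trace ≤ D) : 0 ≤ slope A B P (X - P) := by
  obtain ⟨hP1, hP2, hP3⟩ := hP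
  rw [le_predCov_iff] at hP2
  set Q : ℝ → Matrix (Fin p) (Fin p) ℝ := fun s => (1 - s) • P + s • X with hQ
  have hQP : ∀ s, Q s - P = s • (X - P) := fun s => by
    simp only [hQ, sub_smul, one_smul, smul_sub]; abel
  have key : ∀ s : ℝ, 0 < s → s < 1 →
      0 ≤ ((predCov A B P)⁻¹ * (A * (X - P) * Aᵀ)).trace - ((Q s)⁻¹ * (X - P)).trace := by
    intro s hs0 hs1
    have h1s : 0 < 1 - s := by linarith
    have hQ1 : (Q s).PosDef := (hP1.smul h1s).add_posSemidef
      ((Matrix.nonneg_iff_posSemidef.1 hX).smul hs0.le)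
    have hQ2 : Q s ≤ predCov A B (Q s) := by
      rw [predCov_lineMap]
      exact add_le_add (smul_le_smul_of_le h1s.le hP2) (smul_le_smul_of_le hs0.le hXL)
    have hQ3 : ENNReal.ofReal (Q s).trace ≤ D := by
      have : (Q s).trace ≤ max P.trace X.trace := by
        simp only [hQ, Matrix.trace_add, Matrix.trace_smul, smul_eq_mul]
        nlinarith [le_max_left P.trace X.trace, le_max_right P.trace X.trace]
      refine (ENNReal.ofReal_le_ofReal this).trans ?_
      rcases max_choice P.trace X.trace with h | h <;> rw [h] <;> assumption
    have h1 := hmin _ ⟨hQ1, hQ2, hQ3⟩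
    rw [objective_eq hP1 hP2, objective_eq hQ1 hQ2] at h1
    have h2 := log_det_sub_log_det_le (predCov_posDef hP1 hP2) (predCov_posDef hQ1 hQ2)
    have h3 := log_det_sub_log_det_le hQ1 hP1
    have e2 : predCov A B (Q s) - predCov A B P = s • (A * (X - P) * Aᵀ) := by
      rw [← conj_smul, ← hQP, predCov, predCov, mul_sub, sub_mul]
      abel
    have e3 : P - Q s = -(s • (X - P)) := by rw [← hQP]; abel
    rw [e2, mul_smul_comm, Matrix.trace_smul, smul_eq_mul] at h2
    rw [e3, mul_neg, mul_smul_comm, Matrix.trace_neg, Matrix.trace_smul, smul_eq_mul] at h3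
    refine nonneg_of_mul_nonneg_right (a := s) ?_ hs0
    rw [mul_sub]
    linarith
  have hcont : ContinuousAt (fun s => (Q s)⁻¹) 0 := by
    have hQc : Continuous Q := by fun_prop
    have h0 : (Q 0).det ≠ 0 := by simpa [hQ] using hP1.det_pos.ne'
    simp only [Matrix.inv_def, Ring.inverse_eq_inv']
    exact ((hQc.matrix_det.continuousAt).inv₀ h0).smul hQc.matrix_adjugate.continuousAt
  have hlim : Tendsto (fun s => ((predCov A B P)⁻¹ * (A * (X - P) * Aᵀ)).trace -
      ((Q s)⁻¹ * (X - P)).trace) (𝓝[>] 0) (𝓝 (slope A B P (X - P))) := by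
    have h : Continuous fun M : Matrix (Fin p) (Fin p) ℝ =>
        ((predCov A B P)⁻¹ * (A * (X - P) * Aᵀ)).trace - (M * (X - P)).trace := by fun_prop
    have h0 : (Q 0)⁻¹ = P⁻¹ := by simp [hQ]
    have := (h.tendsto (Q 0)⁻¹).comp hcont.tendsto
    rw [h0] at this
    exact this.mono_left nhdsWithin_le_nhds
  refine ge_of_tendsto hlim ?_
  filter_upwards [Ioo_mem_nhdsGT (zero_lt_one (α := ℝ))] with s hs
  exact key s hs.1 hs.2

/-- The first order condition, for points that satisfy the constraints only approximately. -/
lemma exists_slope_ge (hA : Tendsto (fun j => A ^ j) atTop (𝓝 0)) (hP : P ∈ feasibleSet A B D)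
    (hmin : ∀ Y ∈ feasibleSet A B D, objective A B P ≤ objective A B Y) {ε : ℝ} (hε : 0 < ε) :
    ∃ δ > 0, ∀ X : Matrix (Fin p) (Fin p) ℝ, 0 ≤ X → X ≤ predCov A B X + δ • 1 →
      ENNReal.ofReal X.trace ≤ D + ENNReal.ofReal δ → -ε ≤ slope A B P (X - P) := by
  by_contra! hcon
  have hpos : ∀ k : ℕ, (0 : ℝ) < 1 / ((k : ℝ) + 1) := fun k => by positivity
  choose X hX0 hXL hXD hXs using fun k : ℕ => hcon (1 / ((k : ℝ) + 1)) (hpos k)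
  obtain ⟨C, hC⟩ := exists_bound hA B
  have hXC : ∀ k, X k ∈ Set.Icc 0 C := fun k => by
    refine ⟨hX0 k, hC _ ((hXL k).trans ?_)⟩
    gcongr
    have : 1 / ((k : ℝ) + 1) ≤ 1 := by
      rw [div_le_one (by positivity)]
      have : (0 : ℝ) ≤ k := k.cast_nonneg
      linarith
    simpa using smul_one_mono (n := Fin p) this
  have : FirstCountableTopology (Matrix (Fin p) (Fin p) ℝ) :=
    inferInstanceAs (FirstCountableTopology (Fin p → Fin p → ℝ))
  obtain ⟨Y, hY, φ, hφ, hlim⟩ := (isCompact_Icc_zero C).tendsto_subseq hXC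
  have hδ : Tendsto (fun k => 1 / ((φ k : ℝ) + 1)) atTop (𝓝 0) :=
    tendsto_one_div_add_atTop_nhds_zero_nat.comp hφ.tendsto_atTop
  have hYL : Y ≤ predCov A B Y := by
    have hc : Continuous (predCov A B) := by unfold predCov; fun_prop
    have h1 : Tendsto (fun k => predCov A B (X (φ k)) +
        (1 / ((φ k : ℝ) + 1)) • (1 : Matrix (Fin p) (Fin p) ℝ)) atTop
        (𝓝 (predCov A B Y + (0 : ℝ) • 1)) :=
      ((hc.tendsto Y).comp hlim).add (hδ.smul_const _)
    rw [zero_smul, add_zero] at h1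
    exact le_of_tendsto_of_tendsto' hlim h1 fun k => hXL (φ k)
  have hYD : ENNReal.ofReal Y.trace ≤ D := by
    have hc : Continuous fun X : Matrix (Fin p) (Fin p) ℝ => ENNReal.ofReal X.trace :=
      ENNReal.continuous_ofReal.comp continuous_id.matrix_trace
    have h1 := (tendsto_const_nhds (x := D)).add (ENNReal.tendsto_ofReal hδ)
    rw [ENNReal.ofReal_zero, add_zero] at h1
    exact le_of_tendsto_of_tendsto' ((hc.tendsto Y).comp hlim) h1 fun k => hXD (φ k)
  have h1 := slope_nonneg hP hmin hY.1 hYL hYD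
  have hc : Continuous fun X => slope A B P (X - P) :=
    (continuous_slope P).comp (continuous_id.sub continuous_const)
  have h2 : slope A B P (Y - P) ≤ -ε :=
    le_of_tendsto' ((hc.tendsto Y).comp hlim) fun k => (hXs (φ k)).le
  linarith

/-- Shrinking a feasible point keeps it feasible. -/
lemma smul_mem_feasibleSet (hP : P ∈ feasibleSet A B D) {s : ℝ} (hs0 : 0 < s) (hs1 : s ≤ 1) :
    s • P ∈ feasibleSet A B D := by
  obtain ⟨h1, h2, h3⟩ := hP
  refine ⟨h1.smul hs0, ?_, ?_⟩
  · rw [le_predCov_iff] at h2 ⊢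
    calc s • P ≤ s • predCov A B P := smul_le_smul_of_le hs0.le h2
      _ = A * (s • P) * Aᵀ + s • (B * Bᵀ) := by rw [conj_smul, predCov, smul_add]
      _ ≤ A * (s • P) * Aᵀ + (1 : ℝ) • (B * Bᵀ) := by
        gcongr
        exact mul_transpose_self_nonneg B
      _ = predCov A B (s • P) := by rw [one_smul, predCov]
  · refine (ENNReal.ofReal_le_ofReal ?_).trans h3
    rw [Matrix.trace_smul, smul_eq_mul]
    exact mul_le_of_le_one_left h1.posSemidef.trace_nonneg hs1

end Optimization

/-! ### Gaussian measures -/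

section Gaussian

open scoped MatrixOrder RealInnerProductSpace

variable {k l m n : ℕ}

/-- The quadratic form `xᵀ M x`. -/
noncomputable def quad (M : Matrix (Fin n) (Fin n) ℝ) (x : Vec n) : ℝ := x.ofLp ⬝ᵥ M *ᵥ x.ofLp

lemma continuous_quad (M : Matrix (Fin n) (Fin n) ℝ) : Continuous (quad M) := by
  unfold quad
  fun_prop

lemma ofLp_toEuclideanLin (M : Matrix (Fin m) (Fin n) ℝ) (x : Vec n) :
    (Matrix.toEuclideanLin M x).ofLp = M *ᵥ x.ofLp := rfl

lemma quad_toEuclideanLin (M : Matrix (Fin m) (Fin n) ℝ) (S : Matrix (Fin n) (Fin n) ℝ)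
    (x : Vec m) : quad S (Matrix.toEuclideanLin Mᵀ x) = quad (M * S * Mᵀ) x := by
  rw [quad, quad, dotProduct_conj_mulVec, ofLp_toEuclideanLin]

@[fun_prop]
lemma continuous_toEuclideanLin (M : Matrix (Fin m) (Fin n) ℝ) :
    Continuous (Matrix.toEuclideanLin M) := LinearMap.continuous_of_finiteDimensional _

@[fun_prop]
lemma measurable_toEuclideanLin (M : Matrix (Fin m) (Fin n) ℝ) :
    Measurable (Matrix.toEuclideanLin M) := (continuous_toEuclideanLin M).measurable

lemma inner_toEuclideanLin_left (M : Matrix (Fin m) (Fin n) ℝ) (x : Vec n) (y : Vec m) :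
    ⟪Matrix.toEuclideanLin M x, y⟫ = ⟪x, Matrix.toEuclideanLin Mᵀ y⟫ := by
  simp only [EuclideanSpace.inner_eq_star_dotProduct, ofLp_toEuclideanLin,
    star_trivial]
  rw [Matrix.dotProduct_mulVec, ← Matrix.mulVec_transpose]

lemma charFun_gaussian {S : Matrix (Fin n) (Fin n) ℝ} (hS : 0 ≤ S) (t : Vec n) :
    charFun (multivariateGaussian 0 S) t = Complex.exp (-(quad S t : ℂ) / 2) := by
  rw [charFun_multivariateGaussian (Matrix.nonneg_iff_posSemidef.1 hS)]
  simp [quad, neg_div]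

/-- Two linear images of a pair of independent centred Gaussian vectors are independent if they are
uncorrelated. -/
lemma map_prod_gaussian {S : Matrix (Fin n) (Fin n) ℝ} {T : Matrix (Fin m) (Fin m) ℝ}
    (hS : 0 ≤ S) (hT : 0 ≤ T) {M₁ : Matrix (Fin k) (Fin n) ℝ} {K₁ : Matrix (Fin k) (Fin m) ℝ}
    {M₂ : Matrix (Fin l) (Fin n) ℝ} {K₂ : Matrix (Fin l) (Fin m) ℝ}
    {S' : Matrix (Fin k) (Fin k) ℝ} {T' : Matrix (Fin l) (Fin l) ℝ}
    (h₁ : M₁ * S * M₁ᵀ + K₁ * T * K₁ᵀ = S') (h₂ : M₂ * S * M₂ᵀ + K₂ * T * K₂ᵀ = T')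
    (h₁₂ : M₁ * S * M₂ᵀ + K₁ * T * K₂ᵀ = 0) :
    ((multivariateGaussian (0 : Vec n) S).prod (multivariateGaussian (0 : Vec m) T)).map
      (fun z => (Matrix.toEuclideanLin M₁ z.1 + Matrix.toEuclideanLin K₁ z.2,
        Matrix.toEuclideanLin M₂ z.1 + Matrix.toEuclideanLin K₂ z.2)) =
    (multivariateGaussian (0 : Vec k) S').prod (multivariateGaussian (0 : Vec l) T') := by
  have hS' : 0 ≤ S' := h₁ ▸ add_nonneg (conj_nonneg hS _) (conj_nonneg hT _)
  have hT' : 0 ≤ T' := h₂ ▸ add_nonneg (conj_nonneg hS _) (conj_nonneg hT _)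
  have h₂₁ : M₂ * S * M₁ᵀ + K₂ * T * K₁ᵀ = 0 := by
    have := congrArg Matrix.transpose h₁₂
    simpa [Matrix.transpose_mul, transpose_eq_of_nonneg hS, transpose_eq_of_nonneg hT,
      ← Matrix.mul_assoc] using this
  have : IsProbabilityMeasure
      (((multivariateGaussian (0 : Vec n) S).prod (multivariateGaussian (0 : Vec m) T)).map
      (fun z => (Matrix.toEuclideanLin M₁ z.1 + Matrix.toEuclideanLin K₁ z.2,
        Matrix.toEuclideanLin M₂ z.1 + Matrix.toEuclideanLin K₂ z.2))) :=
    Measure.isProbabilityMeasure_map (by fun_prop)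
  refine charFun_eq_prod_iff.1 fun t => ?_
  set t₁ := t.ofLp.1
  set t₂ := t.ofLp.2
  set u := Matrix.toEuclideanLin M₁ᵀ t₁ + Matrix.toEuclideanLin M₂ᵀ t₂ with hu
  set v := Matrix.toEuclideanLin K₁ᵀ t₁ + Matrix.toEuclideanLin K₂ᵀ t₂ with hv
  have key : quad S u + quad T v = quad S' t₁ + quad T' t₂ := by
    have e : ∀ {r s a b : ℕ} (X : Matrix (Fin r) (Fin s) ℝ) (Y : Matrix (Fin a) (Fin b) ℝ)
        (Q : Matrix (Fin s) (Fin b) ℝ) (x : Fin r → ℝ) (y : Fin a → ℝ),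
        (Xᵀ *ᵥ x) ⬝ᵥ Q *ᵥ (Yᵀ *ᵥ y) = x ⬝ᵥ (X * Q * Yᵀ) *ᵥ y := fun X Y Q x y => by
      rw [← Matrix.mulVec_mulVec, ← Matrix.mulVec_mulVec, Matrix.dotProduct_mulVec x,
        ← Matrix.mulVec_transpose]
    have e₁ := congrArg (fun X => t₁.ofLp ⬝ᵥ X *ᵥ t₂.ofLp) h₁₂
    have e₂ := congrArg (fun X => t₂.ofLp ⬝ᵥ X *ᵥ t₁.ofLp) h₂₁
    simp only [Matrix.add_mulVec, dotProduct_add, Matrix.zero_mulVec, dotProduct_zero] at e₁ e₂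
    simp only [quad, ← h₁, ← h₂, hu, hv, WithLp.ofLp_add, ofLp_toEuclideanLin,
      Matrix.mulVec_add, dotProduct_add, add_dotProduct, e, Matrix.add_mulVec]
    linarith
  calc charFun _ t = charFun (((multivariateGaussian (0 : Vec n) S).prod
        (multivariateGaussian (0 : Vec m) T)).map (WithLp.toLp 2)) (WithLp.toLp 2 (u, v)) := by
        rw [charFun_apply, charFun_apply, integral_map (by fun_prop) (by fun_prop),
          integral_map (by fun_prop) (by fun_prop), integral_map (by fun_prop) (by fun_prop)]
        congr 1
        ext z
        simp only [WithLp.prod_inner_apply, inner_add_left, inner_toEuclideanLin_left, hu, hv,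
          inner_add_right]
        congr 3
        ring
    _ = charFun (multivariateGaussian (0 : Vec n) S) u *
        charFun (multivariateGaussian (0 : Vec m) T) v := charFun_prod _
    _ = _ := by
        rw [charFun_gaussian hS, charFun_gaussian hT, charFun_gaussian hS', charFun_gaussian hT',
          ← Complex.exp_add, ← Complex.exp_add]
        congr 1
        have := congrArg (fun x : ℝ => (x : ℂ)) key
        push_cast at this
        linear_combination (-1 / 2 : ℂ) * this

lemma map_add_gaussian {S : Matrix (Fin n) (Fin n) ℝ} {T : Matrix (Fin m) (Fin m) ℝ}
    (hS : 0 ≤ S) (hT : 0 ≤ T) (M : Matrix (Fin k) (Fin n) ℝ) (K : Matrix (Fin k) (Fin m) ℝ) :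
    ((multivariateGaussian (0 : Vec n) S).prod (multivariateGaussian (0 : Vec m) T)).map
      (fun z => Matrix.toEuclideanLin M z.1 + Matrix.toEuclideanLin K z.2) =
    multivariateGaussian (0 : Vec k) (M * S * Mᵀ + K * T * Kᵀ) := by
  have h := congrArg (Measure.map Prod.fst) (map_prod_gaussian hS hT (M₁ := M) (K₁ := K)
    (M₂ := (0 : Matrix (Fin 0) (Fin n) ℝ)) (K₂ := (0 : Matrix (Fin 0) (Fin m) ℝ)) rfl rfl (by simp))
  rw [Measure.map_map (by fun_prop) (by fun_prop)] at h
  simpa [Function.comp_def] using h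

lemma stdGaussian_eq_withDensity : stdGaussian (Vec n) = volume.withDensity fun x =>
    ENNReal.ofReal ((2 * Real.pi) ^ (-(n : ℝ) / 2) * Real.exp (-‖x‖ ^ 2 / 2)) := by
  have hb : (0 : ℝ) < ((1 / 2 : ℝ) : ℂ).re := by norm_num
  have hint : Integrable (fun x : Vec n => (2 * Real.pi) ^ (-(n : ℝ) / 2) *
      Real.exp (-‖x‖ ^ 2 / 2)) := by
    have h := (GaussianFourier.integrable_cexp_neg_mul_sq_norm_add (V := Vec n) hb 0 0).norm
    refine (h.const_mul ((2 * Real.pi) ^ (-(n : ℝ) / 2))).congr (ae_of_all _ fun x => ?_)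
    simp only [Complex.norm_exp]
    congr 2
    rw [zero_mul, add_zero, ← Complex.ofReal_pow, ← Complex.ofReal_neg, ← Complex.ofReal_mul,
      Complex.ofReal_re]
    ring
  have hfin : IsFiniteMeasure (volume.withDensity fun x : Vec n =>
      ENNReal.ofReal ((2 * Real.pi) ^ (-(n : ℝ) / 2) * Real.exp (-‖x‖ ^ 2 / 2))) :=
    isFiniteMeasure_withDensity_ofReal hint.2
  refine Measure.ext_of_charFun ?_
  ext t
  rw [charFun_stdGaussian, charFun_apply, integral_withDensity_eq_integral_toReal_smul (by fun_prop)
    (by simp)]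
  have h := GaussianFourier.integral_cexp_neg_mul_sq_norm_add (V := Vec n) hb Complex.I t
  have hpi : (0 : ℝ) < 2 * Real.pi := by positivity
  have e1 : ∀ x : Vec n, (ENNReal.ofReal ((2 * Real.pi) ^ (-(n : ℝ) / 2) *
      Real.exp (-‖x‖ ^ 2 / 2))).toReal • Complex.exp (⟪x, t⟫ * Complex.I) =
      ((2 * Real.pi) ^ (-(n : ℝ) / 2) : ℝ) *
      Complex.exp (-((1 / 2 : ℝ) : ℂ) * ‖x‖ ^ 2 + Complex.I * ⟪t, x⟫) := fun x => by
    rw [ENNReal.toReal_ofReal (by positivity), Complex.real_smul, Complex.ofReal_mul,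
      Complex.ofReal_exp, mul_assoc, ← Complex.exp_add, real_inner_comm]
    congr 2
    push_cast
    ring
  simp_rw [e1]
  rw [integral_const_mul, h]
  have e2 : ((Real.pi : ℂ) / ((1 / 2 : ℝ) : ℂ)) ^ ((Module.finrank ℝ (Vec n) : ℂ) / 2) =
      (((2 * Real.pi) ^ ((n : ℝ) / 2) : ℝ) : ℂ) := by
    rw [Complex.ofReal_cpow hpi.le, finrank_euclideanSpace_fin]
    push_cast
    congr 1
    ring
  rw [e2, ← mul_assoc, ← Complex.ofReal_mul, ← Real.rpow_add hpi]
  simp only [neg_div, neg_add_cancel, Real.rpow_zero, Complex.ofReal_one, one_mul, Complex.I_sq]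
  congr 1
  push_cast
  ring

lemma map_withDensity_comp {α β : Type*} [MeasurableSpace α] [MeasurableSpace β] {μ : Measure α}
    {T : α → β} (hT : Measurable T) {g : β → ℝ≥0∞} (hg : Measurable g) :
    (μ.withDensity (g ∘ T)).map T = (μ.map T).withDensity g := by
  ext s hs
  rw [Measure.map_apply hT hs, withDensity_apply _ (hT hs), withDensity_apply _ hs,
    setLIntegral_map hs hg hT]
  rfl

lemma det_toEuclideanLin (M : Matrix (Fin n) (Fin n) ℝ) :
    LinearMap.det (Matrix.toEuclideanLin M) = M.det := by
  change LinearMap.det (Matrix.toLpLin 2 2 M) = M.det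
  rw [Matrix.toLpLin_eq_toLin, LinearMap.det_toLin]

lemma norm_sq_eq_quad (x : Vec n) : ‖x‖ ^ 2 = quad 1 x := by
  rw [EuclideanSpace.real_norm_sq_eq, quad, Matrix.one_mulVec, dotProduct]
  simp only [sq]

/-- The density of a nonsingular Gaussian law. -/
lemma gaussian_eq_withDensity {P : Matrix (Fin n) (Fin n) ℝ} (hP : P.PosDef) (a : Vec n) :
    multivariateGaussian a P = volume.withDensity fun x =>
      ENNReal.ofReal ((2 * Real.pi) ^ (-(n : ℝ) / 2) * (Real.sqrt P.det)⁻¹ *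
        Real.exp (-quad P⁻¹ (x - a) / 2)) := by
  set R := CFC.sqrt P with hR
  have hP0 := hP.posSemidef.nonneg
  have hRt : Rᵀ = R := transpose_eq_of_nonneg (CFC.sqrt_nonneg _)
  have hRR : R * R = P := CFC.sqrt_mul_sqrt_self _ hP0
  have hR0 : 0 ≤ R.det := (Matrix.nonneg_iff_posSemidef.1 (CFC.sqrt_nonneg P)).det_nonneg
  have hdet : R.det = Real.sqrt P.det := by
    rw [← hRR, Matrix.det_mul, Real.sqrt_mul_self hR0]
  have hdet0 : R.det ≠ 0 := by rw [hdet]; exact (Real.sqrt_pos.2 hP.det_pos).ne'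
  have hRu : IsUnit R.det := hdet0.isUnit
  set T : Vec n → Vec n := fun x => a + Matrix.toEuclideanLin R x with hTdef
  have hT : Measurable T := by fun_prop
  have hG : multivariateGaussian a P = (stdGaussian (Vec n)).map T := by
    rw [multivariateGaussian]
    rfl
  have hvol : (volume : Measure (Vec n)).map T = ENNReal.ofReal (Real.sqrt P.det)⁻¹ • volume := by
    have h1 : T = (fun x => a + x) ∘ Matrix.toEuclideanLin R := rfl
    rw [h1, ← Measure.map_map (by fun_prop) (by fun_prop),
      Measure.map_linearMap_addHaar_eq_smul_addHaar _ (by rwa [det_toEuclideanLin]),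
      Measure.map_smul, (measurePreserving_add_left volume a).map_eq, det_toEuclideanLin, hdet,
      abs_of_nonneg (inv_nonneg.2 (Real.sqrt_nonneg _))]
  set g : Vec n → ℝ≥0∞ := fun y => ENNReal.ofReal ((2 * Real.pi) ^ (-(n : ℝ) / 2) *
    Real.exp (-quad P⁻¹ (y - a) / 2)) with hg
  have hgm : Measurable g := by
    have := (continuous_quad P⁻¹).measurable
    fun_prop
  have hgT : (fun x : Vec n => ENNReal.ofReal ((2 * Real.pi) ^ (-(n : ℝ) / 2) *
      Real.exp (-‖x‖ ^ 2 / 2))) = g ∘ T := by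
    ext x
    have : quad P⁻¹ (T x - a) = ‖x‖ ^ 2 := by
      have h1 : R * P⁻¹ * R = 1 := by
        rw [← hRR, Matrix.mul_inv_rev, ← mul_assoc, Matrix.mul_nonsing_inv _ hRu, one_mul,
          Matrix.nonsing_inv_mul _ hRu]
      rw [hTdef, add_sub_cancel_left, norm_sq_eq_quad, ← h1]
      conv_rhs => rw [← hRt]
      conv_rhs => enter [1, 1, 1]; rw [hRt]
      rw [← quad_toEuclideanLin, hRt]
    simp only [Function.comp_apply, hg, this]
  rw [hG, stdGaussian_eq_withDensity, hgT, map_withDensity_comp hT hgm, hvol,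
    withDensity_smul_measure, ← withDensity_smul _ hgm]
  congr 1
  ext x
  simp only [Pi.smul_apply, hg, smul_eq_mul]
  rw [← ENNReal.ofReal_mul (by positivity)]
  congr 1
  ring

/-- The logarithm of the density of `N(a, P)` with respect to `N(b, L)`. -/
noncomputable def logRatio (P L : Matrix (Fin n) (Fin n) ℝ) (a b x : Vec n) : ℝ :=
  1 / 2 * Real.log (L.det / P.det) - quad P⁻¹ (x - a) / 2 + quad L⁻¹ (x - b) / 2

lemma continuous_logRatio (P L : Matrix (Fin n) (Fin n) ℝ) :
    Continuous fun z : Vec n × Vec n × Vec n => logRatio P L z.1 z.2.1 z.2.2 := by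
  unfold logRatio
  have h1 := continuous_quad P⁻¹
  have h2 := continuous_quad L⁻¹
  fun_prop

lemma gaussian_withDensity_logRatio {P L : Matrix (Fin n) (Fin n) ℝ} (hP : P.PosDef)
    (hL : L.PosDef) (a b : Vec n) :
    (multivariateGaussian b L).withDensity
      (fun x => ENNReal.ofReal (Real.exp (logRatio P L a b x))) = multivariateGaussian a P := by
  have h1 := (continuous_quad P⁻¹).measurable
  have h2 := (continuous_quad L⁻¹).measurable
  have h3 : Measurable (logRatio P L a b) := by unfold logRatio; fun_prop
  rw [gaussian_eq_withDensity hL, gaussian_eq_withDensity hP, ← withDensity_mul _ (by fun_prop)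
    (by fun_prop)]
  congr 1
  ext x
  simp only [Pi.mul_apply]
  rw [← ENNReal.ofReal_mul (by positivity)]
  congr 1
  have hP0 := hP.det_pos
  have hL0 := hL.det_pos
  have e : Real.exp (logRatio P L a b x) = Real.sqrt L.det * (Real.sqrt P.det)⁻¹ *
      (Real.exp (-quad P⁻¹ (x - a) / 2) * Real.exp (quad L⁻¹ (x - b) / 2)) := by
    rw [logRatio, sub_add, Real.exp_sub, show 1 / 2 * Real.log (L.det / P.det) =
      Real.log (Real.sqrt (L.det / P.det)) by rw [Real.log_sqrt (by positivity)]; ring,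
      Real.exp_log (by positivity), Real.sqrt_div hL0.le, ← Real.exp_add, div_eq_mul_inv,
      div_eq_mul_inv, ← Real.exp_neg]
    congr 2
    ring
  have hs : Real.sqrt L.det ≠ 0 := (Real.sqrt_pos.2 hL0).ne'
  have e2 : Real.exp (-(quad L⁻¹ (x - b) / 2)) * Real.exp (quad L⁻¹ (x - b) / 2) = 1 := by
    rw [← Real.exp_add, neg_add_cancel, Real.exp_zero]
  rw [e]
  field_simp
  exact e2

-- the proofs below rewrite with the defining equations; unfolding during unification is expensive
attribute [irreducible] logRatio quad

end Gaussian

/-! ### The density of the stationary channel -/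

section ChannelDensity

open scoped MatrixOrder BoundedContinuousFunction

variable {p q : ℕ} {A : Matrix (Fin p) (Fin p) ℝ} {B : Matrix (Fin p) (Fin q) ℝ}
  {P : Matrix (Fin p) (Fin p) ℝ}

/-- With `ξ ∼ N(0, Λ)` and `v ∼ N(0, Σ_v)` independent, the error `(I - H) ξ - v` and the
increment `H ξ + v` are independent, of laws `N(0, Π)` and `N(0, Λ - Π)`. -/
lemma map_error_innovation (hP : P.PosDef) (hL : P ≤ predCov A B P) :
    ((multivariateGaussian (0 : Vec p) (predCov A B P)).prod
      (multivariateGaussian (0 : Vec p) (P * (gainH A B P)ᵀ))).map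
      (fun z => (Matrix.toEuclideanLin (1 - gainH A B P) z.1 - z.2,
        Matrix.toEuclideanLin (gainH A B P) z.1 + z.2)) =
    (multivariateGaussian (0 : Vec p) P).prod
      (multivariateGaussian (0 : Vec p) (predCov A B P - P)) := by
  have h := map_prod_gaussian (predCov_posDef hP hL).posSemidef.nonneg (noise_nonneg hP hL)
    (M₁ := 1 - gainH A B P) (K₁ := -1) (M₂ := gainH A B P) (K₂ := 1) (S' := P)
    (T' := predCov A B P - P) (by simpa using conj_one_sub_gainH hP hL)
    (by simpa using conj_gainH hP hL) (by simp [cross_gainH hP hL])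
  simpa [sub_eq_add_neg] using h

lemma volume_absolutelyContinuous_gaussian {n : ℕ} {L : Matrix (Fin n) (Fin n) ℝ}
    (hL : L.PosDef) : (volume : Measure (Vec n)) ≪ multivariateGaussian 0 L := by
  rw [gaussian_eq_withDensity hL]
  have h1 := (continuous_quad L⁻¹).measurable
  refine withDensity_absolutelyContinuous' (by fun_prop) (ae_of_all _ fun x => ?_)
  have := Real.sqrt_pos.2 hL.det_pos
  simp only [ne_eq, ENNReal.ofReal_eq_zero, not_le]
  positivity

lemma continuous_lintegral_add {n : ℕ} {μ : Measure (Vec n)} [IsFiniteMeasure μ]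
    (M : Matrix (Fin n) (Fin n) ℝ) (h : Vec n →ᵇ NNReal) :
    Continuous fun ξ => ∫⁻ v, (h (Matrix.toEuclideanLin M ξ + v) : ℝ≥0∞) ∂μ := by
  have hh : Continuous fun y : Vec n => (h y : ℝ≥0∞) :=
    ENNReal.continuous_coe.comp h.continuous
  have hhm := hh.measurable
  obtain ⟨b, hb⟩ : ∃ b : NNReal, ∀ y, h y ≤ b := ⟨_, fun y => h.apply_le_nndist_zero y⟩
  refine continuous_iff_continuousAt.2 fun x => ?_
  refine tendsto_lintegral_filter_of_dominated_convergence (fun _ => (b : ℝ≥0∞))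
    (Eventually.of_forall fun y => by fun_prop)
    (Eventually.of_forall fun y => ae_of_all _ fun v => by exact_mod_cast hb _)
    (by simp [ENNReal.mul_eq_top]) (ae_of_all _ fun v => ?_)
  exact (hh.comp (by fun_prop : Continuous fun ξ => Matrix.toEuclideanLin M ξ + v)).tendsto x

lemma continuous_exp_logRatio {n : ℕ} (P L : Matrix (Fin n) (Fin n) ℝ) :
    Continuous fun z : Vec n × Vec n => ENNReal.ofReal (Real.exp (logRatio P L z.2 0 z.1)) := by
  have h1 := continuous_quad P⁻¹
  have h2 := continuous_quad L⁻¹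
  simp only [logRatio]
  refine ENNReal.continuous_ofReal.comp ?_
  fun_prop

lemma continuous_lintegral_logRatio {n : ℕ} {P L : Matrix (Fin n) (Fin n) ℝ} (hP : P.PosDef)
    {μ : Measure (Vec n)} [IsFiniteMeasure μ] (h : Vec n →ᵇ NNReal) :
    Continuous fun ξ =>
      ∫⁻ η, (ENNReal.ofReal (Real.exp (logRatio P L η 0 ξ)) * (h η : ℝ≥0∞)) ∂μ := by
  have hh : Continuous fun y : Vec n => (h y : ℝ≥0∞) :=
    ENNReal.continuous_coe.comp h.continuous
  have hhm := hh.measurable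
  obtain ⟨b, hb⟩ : ∃ b : NNReal, ∀ y, h y ≤ b := ⟨_, fun y => h.apply_le_nndist_zero y⟩
  have hrc := continuous_exp_logRatio P L
  refine continuous_iff_continuousAt.2 fun x => ?_
  refine tendsto_lintegral_filter_of_dominated_convergence
    (fun _ => ENNReal.ofReal
      (Real.exp (1 / 2 * Real.log (L.det / P.det) + (quad L⁻¹ (x - 0) + 1) / 2)) * b)
    (Eventually.of_forall fun y => ?_) ?_ (by simp [ENNReal.mul_eq_top]) (ae_of_all _ fun η => ?_)
  · exact ((hrc.measurable.comp (measurable_const.prodMk measurable_id)).mul hhm)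
  · have hnear : ∀ᶠ y in 𝓝 x, quad L⁻¹ (y - 0) < quad L⁻¹ (x - 0) + 1 :=
      (((continuous_quad L⁻¹).comp (continuous_id.sub continuous_const)).tendsto x).eventually
        (gt_mem_nhds (by simp))
    filter_upwards [hnear] with y hy
    refine ae_of_all _ fun η => ?_
    refine mul_le_mul' (ENNReal.ofReal_le_ofReal (Real.exp_le_exp.2 ?_)) (by exact_mod_cast hb η)
    rw [logRatio]
    have : 0 ≤ quad P⁻¹ (y - η) := by
      simpa [quad] using hP.inv.posSemidef.dotProduct_mulVec_nonneg (y - η).ofLp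
    linarith
  · exact ENNReal.Tendsto.mul_const
      ((hrc.comp (by fun_prop : Continuous fun y : Vec n => (y, η))).tendsto x) (by simp)

lemma map_add_right_gaussian {n : ℕ} (S : Matrix (Fin n) (Fin n) ℝ) (a b : Vec n) :
    (multivariateGaussian b S).map (fun x => x + a) = multivariateGaussian (a + b) S := by
  simp only [multivariateGaussian]
  rw [Measure.map_map (by fun_prop) (by fun_prop)]
  congr 1
  ext x : 1
  simp only [Function.comp_apply]
  abel

/-- Bayes' rule for the pair `(ξ, H ξ + v)`, in integrated form. -/
lemma setLIntegral_gain_add_noise (hP : P.PosDef) (hL : P ≤ predCov A B P) {h : Vec p → ℝ≥0∞}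
    (hh : Measurable h) {s : Set (Vec p)} (hs : MeasurableSet s) :
    ∫⁻ ξ in s, ∫⁻ v, h (Matrix.toEuclideanLin (gainH A B P) ξ + v)
        ∂multivariateGaussian (0 : Vec p) (P * (gainH A B P)ᵀ)
        ∂multivariateGaussian (0 : Vec p) (predCov A B P) =
      ∫⁻ ξ in s, ∫⁻ η, ENNReal.ofReal (Real.exp (logRatio P (predCov A B P) η 0 ξ)) * h η
        ∂multivariateGaussian (0 : Vec p) (predCov A B P - P)
        ∂multivariateGaussian (0 : Vec p) (predCov A B P) := by
  have hLP := predCov_posDef hP hL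
  have hg : Measurable fun z : Vec p × Vec p => s.indicator 1 z.1 * h z.2 :=
    ((measurable_one.indicator hs).comp measurable_fst).mul (hh.comp measurable_snd)
  have hrm := (continuous_exp_logRatio P (predCov A B P)).measurable
  calc _ = ∫⁻ ξ, ∫⁻ v, s.indicator 1 ξ * h (Matrix.toEuclideanLin (gainH A B P) ξ + v)
        ∂multivariateGaussian (0 : Vec p) (P * (gainH A B P)ᵀ)
        ∂multivariateGaussian (0 : Vec p) (predCov A B P) := by
        rw [← lintegral_indicator hs]
        congr 1 with ξ
        rw [lintegral_const_mul _ (by fun_prop)]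
        by_cases hξ : ξ ∈ s <;> simp [hξ]
    _ = ∫⁻ z, s.indicator 1 z.1 * h (Matrix.toEuclideanLin (gainH A B P) z.1 + z.2)
        ∂((multivariateGaussian (0 : Vec p) (predCov A B P)).prod
          (multivariateGaussian (0 : Vec p) (P * (gainH A B P)ᵀ))) := by
        rw [lintegral_prod]
        exact (hg.comp (by fun_prop : Measurable fun z : Vec p × Vec p =>
          (z.1, Matrix.toEuclideanLin (gainH A B P) z.1 + z.2))).aemeasurable
    _ = ∫⁻ z, s.indicator 1 (z.1 + z.2) * h z.2
        ∂((multivariateGaussian (0 : Vec p) P).prod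
          (multivariateGaussian (0 : Vec p) (predCov A B P - P))) := by
        have hg' : Measurable fun z : Vec p × Vec p => s.indicator 1 (z.1 + z.2) * h z.2 :=
          hg.comp (by fun_prop : Measurable fun z : Vec p × Vec p => (z.1 + z.2, z.2))
        rw [← map_error_innovation hP hL, lintegral_map hg' (by fun_prop)]
        congr 1 with z
        simp only [map_sub, LinearMap.sub_apply, Matrix.toLpLin_one, LinearMap.id_apply]
        congr 2
        abel
    _ = ∫⁻ η, ∫⁻ e, s.indicator 1 (e + η) * h η ∂multivariateGaussian (0 : Vec p) P
        ∂multivariateGaussian (0 : Vec p) (predCov A B P - P) := by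
        rw [lintegral_prod_symm]
        exact (hg.comp (by fun_prop : Measurable fun z : Vec p × Vec p =>
          (z.1 + z.2, z.2))).aemeasurable
    _ = ∫⁻ η, ∫⁻ ξ, ENNReal.ofReal (Real.exp (logRatio P (predCov A B P) η 0 ξ)) *
          (s.indicator 1 ξ * h η) ∂multivariateGaussian (0 : Vec p) (predCov A B P)
        ∂multivariateGaussian (0 : Vec p) (predCov A B P - P) := by
        congr 1 with η
        have hgη : Measurable fun ξ : Vec p => s.indicator 1 ξ * h η :=
          hg.comp (by fun_prop : Measurable fun ξ : Vec p => (ξ, η))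
        have hrη : Measurable fun ξ : Vec p =>
            ENNReal.ofReal (Real.exp (logRatio P (predCov A B P) η 0 ξ)) :=
          hrm.comp (by fun_prop : Measurable fun ξ : Vec p => (ξ, η))
        rw [← lintegral_map (f := fun ξ : Vec p => s.indicator 1 ξ * h η) hgη (by fun_prop),
          map_add_right_gaussian, add_zero, ← gaussian_withDensity_logRatio hP hLP η 0,
          lintegral_withDensity_eq_lintegral_mul _ hrη hgη]
        rfl
    _ = ∫⁻ ξ, ∫⁻ η, ENNReal.ofReal (Real.exp (logRatio P (predCov A B P) η 0 ξ)) *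
          (s.indicator 1 ξ * h η) ∂multivariateGaussian (0 : Vec p) (predCov A B P - P)
        ∂multivariateGaussian (0 : Vec p) (predCov A B P) := by
        rw [lintegral_lintegral_swap]
        exact ((hrm.comp measurable_swap).mul (hg.comp measurable_swap)).aemeasurable
    _ = _ := by
        rw [← lintegral_indicator hs]
        congr 1 with ξ
        by_cases hξ : ξ ∈ s <;> simp [hξ]

/-- The stationary channel has a density with respect to the law `N(0, Λ - Π)` of `H ξ + v`, although
both laws may be singular. By Bayes' rule the density is that of the posterior `N(η, Π)` of `ξ` with
respect to its prior `N(0, Λ)`. Bayes' rule gives this for almost every `ξ`, and continuity for every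
`ξ`. -/
lemma map_gain_add_noise (hP : P.PosDef) (hL : P ≤ predCov A B P) (ξ : Vec p) :
    (multivariateGaussian (0 : Vec p) (P * (gainH A B P)ᵀ)).map
      (fun v => Matrix.toEuclideanLin (gainH A B P) ξ + v) =
    (multivariateGaussian (0 : Vec p) (predCov A B P - P)).withDensity
      (fun η => ENNReal.ofReal (Real.exp (logRatio P (predCov A B P) η 0 ξ))) := by
  have hLP := predCov_posDef hP hL
  have hrm := (continuous_exp_logRatio P (predCov A B P)).measurable
  have hrξ : Measurable fun η : Vec p =>
      ENNReal.ofReal (Real.exp (logRatio P (predCov A B P) η 0 ξ)) :=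
    hrm.comp (by fun_prop : Measurable fun η : Vec p => (ξ, η))
  have : IsProbabilityMeasure ((multivariateGaussian (0 : Vec p) (P * (gainH A B P)ᵀ)).map
      (fun v => Matrix.toEuclideanLin (gainH A B P) ξ + v)) :=
    Measure.isProbabilityMeasure_map (by fun_prop)
  refine ext_of_forall_lintegral_eq_of_IsFiniteMeasure fun h => ?_
  have hhm : Measurable fun y : Vec p => (h y : ℝ≥0∞) :=
    (ENNReal.continuous_coe.comp h.continuous).measurable
  rw [lintegral_map hhm (by fun_prop), lintegral_withDensity_eq_lintegral_mul _ hrξ hhm]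
  have hc₁ := continuous_lintegral_add
    (μ := multivariateGaussian (0 : Vec p) (P * (gainH A B P)ᵀ)) (gainH A B P) h
  have hc₂ := continuous_lintegral_logRatio (L := predCov A B P) hP
    (μ := multivariateGaussian (0 : Vec p) (predCov A B P - P)) h
  have hae := ae_eq_of_forall_setLIntegral_eq_of_sigmaFinite hc₁.measurable hc₂.measurable
    fun s hs (_ : multivariateGaussian (0 : Vec p) (predCov A B P) s < ⊤) =>
      setLIntegral_gain_add_noise hP hL hhm hs
  exact congrFun ((Continuous.ae_eq_iff_eq volume hc₁ hc₂).1
    ((volume_absolutelyContinuous_gaussian hLP).ae_le hae)) ξ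

end ChannelDensity

/-! ### Resampling a coordinate of an independent family -/

section Resampling

variable {X : ℕ → Type*} [∀ n, MeasurableSpace (X n)]

lemma measurable_update_prod (n : ℕ) :
    Measurable fun z : (∀ n, X n) × X n => Function.update z.1 n z.2 := by
  refine measurable_pi_iff.2 fun i => ?_
  by_cases h : i = n
  · subst h
    simpa using measurable_snd
  · simp only [ne_eq, h, not_false_eq_true, Function.update_of_ne]
    exact (measurable_pi_apply i).comp measurable_fst

/-- Resampling one coordinate of an independent family does not change its law. -/
lemma map_update_infinitePi (μ : ∀ n, Measure (X n)) [∀ n, IsProbabilityMeasure (μ n)] (n : ℕ) :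
    ((Measure.infinitePi μ).prod (μ n)).map (fun z => Function.update z.1 n z.2) =
      Measure.infinitePi μ := by
  refine Measure.eq_infinitePi μ fun s t ht => ?_
  rw [Measure.map_apply (measurable_update_prod n) (MeasurableSet.pi s.countable_toSet fun i _ => ht i)]
  by_cases hn : n ∈ s
  · have : (fun z : (∀ n, X n) × X n => Function.update z.1 n z.2) ⁻¹' (s : Set ℕ).pi t =
        ((s.erase n : Finset ℕ) : Set ℕ).pi t ×ˢ t n := by
      ext z
      simp only [Set.mem_preimage, Set.mem_pi, Set.mem_prod, Finset.coe_erase, Finset.mem_coe,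
        Set.mem_sdiff, Set.mem_singleton_iff]
      constructor
      · intro h
        refine ⟨fun i hi => by simpa [hi.2] using h i hi.1, by simpa using h n hn⟩
      · rintro ⟨h1, h2⟩ i hi
        by_cases hin : i = n
        · subst hin; simpa using h2
        · simpa [hin] using h1 i ⟨hi, hin⟩
    rw [this, Measure.prod_prod, Measure.infinitePi_pi _ fun i _ => ht i,
      Finset.prod_erase_mul _ _ hn]
  · have : (fun z : (∀ n, X n) × X n => Function.update z.1 n z.2) ⁻¹' (s : Set ℕ).pi t =
        (s : Set ℕ).pi t ×ˢ Set.univ := by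
      ext z
      simp only [Set.mem_preimage, Set.mem_pi, Set.mem_prod, Set.mem_univ, and_true, Finset.mem_coe]
      refine forall₂_congr fun i hi => ?_
      rw [Function.update_of_ne (ne_of_mem_of_not_mem hi hn)]
    rw [this, Measure.prod_prod, Measure.infinitePi_pi _ fun i _ => ht i, measure_univ, mul_one]

end Resampling

/-! ### Stability of the source from a unique invariant law -/

section InvariantLaw

open scoped MatrixOrder RealInnerProductSpace

variable {p q : ℕ} {A : Matrix (Fin p) (Fin p) ℝ} {B : Matrix (Fin p) (Fin q) ℝ}
  {P : Matrix (Fin p) (Fin p) ℝ}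

/-- The reproduction of the stationary channel is a Markov chain `y ↦ A y + η` with
`η ∼ N(0, Λ - Π)`. -/
lemma outputKernel_apply (hP : P.PosDef) (hL : P ≤ predCov A B P) (y : Vec p) :
    outputKernel A B P y = (multivariateGaussian (0 : Vec p) (predCov A B P - P)).map
      (fun η => Matrix.toEuclideanLin A y + η) := by
  have hk : ∀ z : Vec p × Vec p, (stationaryChannel A B P).kernel 0 z =
      (multivariateGaussian (0 : Vec p) (P * (gainH A B P)ᵀ)).map (fun v =>
        Matrix.toEuclideanLin (gainH A B P) z.2 +
          Matrix.toEuclideanLin ((1 - gainH A B P) * A) z.1 + v) := fun z => by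
    rw [TestChannel.kernel, Kernel.map_apply _ (by fun_prop), Kernel.prod_apply, Kernel.id_apply,
      Kernel.const_apply, Measure.dirac_prod, Measure.map_map (by fun_prop) (by fun_prop)]
    rfl
  have hq : (Kernel.id ×ₖ predictionKernel A B P) y =
      (multivariateGaussian (0 : Vec p) (predCov A B P)).map
        (fun ξ => (y, Matrix.toEuclideanLin A y + ξ)) := by
    have : IsMarkovKernel (predictionKernel A B P) :=
      Kernel.IsMarkovKernel.map _ (by fun_prop)
    rw [Kernel.prod_apply, Kernel.id_apply, Measure.dirac_prod, predictionKernel,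
      Kernel.map_apply _ (by fun_prop), Kernel.prod_apply, Kernel.id_apply,
      Kernel.const_apply, Measure.dirac_prod, Measure.map_map (by fun_prop) (by fun_prop),
      Measure.map_map (by fun_prop) (by fun_prop)]
    rfl
  have hinn := congrArg (Measure.map Prod.snd) (map_error_innovation hP hL)
  rw [Measure.map_map (by fun_prop) (by fun_prop), Measure.map_snd_prod, measure_univ, one_smul]
    at hinn
  refine Measure.ext_of_lintegral _ fun f hf => ?_
  rw [outputKernel, Kernel.lintegral_comp _ _ _ hf, hq, lintegral_map (by fun_prop) (by fun_prop),
    lintegral_map hf (by fun_prop), ← hinn, lintegral_map (by fun_prop) (by fun_prop),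
    lintegral_prod _ (by fun_prop)]
  refine lintegral_congr fun ξ => ?_
  rw [hk, lintegral_map hf (by fun_prop)]
  refine lintegral_congr fun v => ?_
  simp only [Function.comp_apply]
  congr 1
  have h1 : Matrix.toEuclideanLin ((1 - gainH A B P) * A) y =
      Matrix.toEuclideanLin A y - Matrix.toEuclideanLin (gainH A B P) (Matrix.toEuclideanLin A y) := by
    ext i
    simp [Matrix.sub_mul]
  rw [h1, map_add]
  abel

/-- Invariance under the output kernel, in terms of characteristic functions. -/
lemma invariant_iff (hP : P.PosDef) (hL : P ≤ predCov A B P) (ν : Measure (Vec p))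
    [IsProbabilityMeasure ν] :
    (outputKernel A B P).Invariant ν ↔ ∀ ξ, charFun ν ξ = charFun ν (Matrix.toEuclideanLin Aᵀ ξ) *
      Complex.exp (-(quad (predCov A B P - P) ξ : ℂ) / 2) := by
  have hbind : ν.bind (outputKernel A B P) = (ν.map (Matrix.toEuclideanLin A)) ∗
      multivariateGaussian (0 : Vec p) (predCov A B P - P) := by
    refine Measure.ext_of_lintegral _ fun f hf => ?_
    rw [Measure.lintegral_bind (Kernel.aemeasurable _) hf.aemeasurable,
      Measure.lintegral_conv hf, lintegral_map (by fun_prop) (by fun_prop)]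
    refine lintegral_congr fun y => ?_
    rw [outputKernel_apply hP hL, lintegral_map hf (by fun_prop)]
  have : IsProbabilityMeasure (ν.map (Matrix.toEuclideanLin A)) :=
    Measure.isProbabilityMeasure_map (by fun_prop)
  have hc : ∀ ξ, charFun (ν.map (Matrix.toEuclideanLin A)) ξ =
      charFun ν (Matrix.toEuclideanLin Aᵀ ξ) := fun ξ => by
    rw [charFun_apply, charFun_apply, integral_map (by fun_prop) (by fun_prop)]
    simp only [inner_toEuclideanLin_left]
  rw [Kernel.Invariant, hbind]
  constructor
  · intro h ξ
    conv_lhs => rw [← h]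
    rw [charFun_conv, hc, charFun_gaussian (sub_nonneg.2 hL)]
  · intro h
    refine Measure.ext_of_charFun (funext fun ξ => ?_)
    rw [charFun_conv, hc, charFun_gaussian (sub_nonneg.2 hL), ← h]

lemma quad_add (S T : Matrix (Fin p) (Fin p) ℝ) (x : Vec p) :
    quad (S + T) x = quad S x + quad T x := by
  simp [quad, Matrix.add_mulVec]

lemma quad_const_smul (S : Matrix (Fin p) (Fin p) ℝ) (c : ℝ) (x : Vec p) :
    quad S (c • x) = c ^ 2 * quad S x := by
  simp [quad, Matrix.mulVec_smul]
  ring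

lemma quad_smul_one (c : ℝ) (x : Vec p) : quad (c • 1) x = c * ‖x‖ ^ 2 := by
  rw [norm_sq_eq_quad]
  simp [quad, Matrix.smul_mulVec]

lemma le_of_forall_quad_le {S T : Matrix (Fin p) (Fin p) ℝ} (hS : Sᵀ = S) (hT : Tᵀ = T)
    (h : ∀ x, quad S x ≤ quad T x) : S ≤ T :=
  le_of_forall_dotProduct_mulVec_le hS hT fun x => by simpa [quad] using h (WithLp.toLp 2 x)

/-- The iterated invariance relation; the exponent is the quadratic form of the covariance of
`∑_{k < n} Aᵏ η_k`. -/
lemma charFun_invariant_iterate {W : Matrix (Fin p) (Fin p) ℝ} {φ : Vec p → ℂ}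
    (h : ∀ ξ, φ ξ = φ (Matrix.toEuclideanLin Aᵀ ξ) * Complex.exp (-(quad W ξ : ℂ) / 2))
    (n : ℕ) (ξ : Vec p) : φ ξ = φ (Matrix.toEuclideanLin (A ^ n)ᵀ ξ) *
      Complex.exp (-(quad (∑ k ∈ Finset.range n, A ^ k * W * (A ^ k)ᵀ) ξ : ℂ) / 2) := by
  induction n with
  | zero => simp [quad, Matrix.toLpLin_one]
  | succ n ih =>
    have e : Matrix.toEuclideanLin Aᵀ (Matrix.toEuclideanLin (A ^ n)ᵀ ξ) =
        Matrix.toEuclideanLin (A ^ (n + 1))ᵀ ξ := by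
      ext i
      simp [pow_succ, Matrix.transpose_mul]
    rw [ih, h, e, Finset.sum_range_succ, quad_add, mul_assoc, ← Complex.exp_add,
      ← quad_toEuclideanLin]
    push_cast
    congr 2
    ring

/-- The characteristic function of an invariant law is near `1` close to the origin. Therefore the
covariances `∑_{k < n} Aᵏ (Λ - Π) Aᵏᵀ` stay bounded, and with them `Aⁿ Π Aⁿᵀ`. -/
lemma exists_pow_conj_le (hP : P.PosDef) (hL : P ≤ predCov A B P) {ν : Measure (Vec p)}
    [IsProbabilityMeasure ν] (hν : (outputKernel A B P).Invariant ν) :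
    ∃ C : ℝ, ∀ n, A ^ n * P * (A ^ n)ᵀ ≤ C • P := by
  have hφ := charFun_invariant_iterate ((invariant_iff hP hL ν).1 hν)
  have hcont : Continuous (charFun ν) := continuous_charFun
  obtain ⟨r, hr, hball⟩ : ∃ r > 0, ∀ ξ : Vec p, ‖ξ‖ ≤ r → 1 / 2 < ‖charFun ν ξ‖ := by
    have : ∀ᶠ ξ in 𝓝 (0 : Vec p), 1 / 2 < ‖charFun ν ξ‖ :=
      (hcont.norm.tendsto 0).eventually (lt_mem_nhds (by simp; norm_num))
    obtain ⟨r, hr, h⟩ := Metric.eventually_nhds_iff.1 this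
    exact ⟨r / 2, by positivity, fun ξ hξ => h (by rw [dist_zero_right]; linarith)⟩
  have hW : 0 ≤ predCov A B P - P := sub_nonneg.2 hL
  set S : ℕ → Matrix (Fin p) (Fin p) ℝ :=
    fun n => ∑ k ∈ Finset.range n, A ^ k * (predCov A B P - P) * (A ^ k)ᵀ with hS
  have hS0 : ∀ n, 0 ≤ S n := fun n => Finset.sum_nonneg fun k _ => conj_nonneg hW _
  have hsmall : ∀ n ξ, ‖ξ‖ ≤ r → quad (S n) ξ ≤ 2 := fun n ξ hξ => by
    have h1 := hball ξ hξ
    rw [hφ n ξ, norm_mul, Complex.norm_exp] at h1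
    have h2 : ‖charFun ν (Matrix.toEuclideanLin (A ^ n)ᵀ ξ)‖ ≤ 1 := norm_charFun_le_one _
    have h3 : (-(quad (S n) ξ : ℂ) / 2).re = -quad (S n) ξ / 2 := by
      rw [← Complex.ofReal_neg, Complex.div_ofNat_re, Complex.ofReal_re]
    rw [h3] at h1
    have h4 : 1 / 2 < Real.exp (-quad (S n) ξ / 2) :=
      h1.trans_le (mul_le_of_le_one_left (Real.exp_pos _).le h2)
    by_contra! h5
    have h6 : Real.exp (-quad (S n) ξ / 2) ≤ Real.exp (-1) := Real.exp_le_exp.2 (by linarith)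
    have h7 : Real.exp (-1) < 1 / 2 := by
      have := Real.exp_one_gt_d9
      rw [Real.exp_neg, one_div]
      exact inv_strictAnti₀ (by norm_num) (by linarith)
    linarith
  have hSc : ∀ n, S n ≤ (2 / r ^ 2) • 1 := fun n => by
    refine le_of_forall_quad_le (transpose_eq_of_nonneg (hS0 n)) (by simp) fun x => ?_
    rw [quad_smul_one]
    by_cases hx : x = 0
    · simp [hx, quad]
    have hx' : 0 < ‖x‖ := norm_pos_iff.2 hx
    have := hsmall n ((r / ‖x‖) • x) (by
      rw [norm_smul, Real.norm_eq_abs, abs_of_pos (by positivity), div_mul_cancel₀ _ hx'.ne'])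
    rw [quad_const_smul] at this
    rw [div_mul_eq_mul_div, le_div_iff₀ (by positivity)]
    calc quad (S n) x * r ^ 2 = ((r / ‖x‖) ^ 2 * quad (S n) x) * ‖x‖ ^ 2 := by
          field_simp
      _ ≤ 2 * ‖x‖ ^ 2 := by gcongr
  have hpow : ∀ n, A ^ n * P * (A ^ n)ᵀ ≤ P + S n := fun n => by
    induction n with
    | zero => simp [hS]
    | succ n ih =>
      have h1 : A * P * Aᵀ ≤ P + (predCov A B P - P) := by
        rw [add_sub_cancel, predCov]
        exact le_add_of_nonneg_right (mul_transpose_self_nonneg B)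
      have h2 := conj_mono h1 (A ^ n)
      rw [conj_conj, ← pow_succ, Matrix.mul_add, Matrix.add_mul] at h2
      refine h2.trans ?_
      rw [hS]
      simp only [Finset.sum_range_succ]
      rw [← add_assoc]
      exact add_le_add_left ih _
  obtain ⟨c, hc, hcP⟩ := exists_smul_one_le hP
  refine ⟨1 + 2 / r ^ 2 / c, fun n => (hpow n).trans ?_⟩
  rw [add_smul, one_smul]
  refine add_le_add_right ((hSc n).trans ?_) _
  have := smul_le_smul_of_le (c := 2 / r ^ 2 / c) (by positivity) hcP
  rwa [smul_smul, div_mul_cancel₀ _ hc.ne'] at this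

/-- If `M` is a fixed point of `M ↦ A M Aᵀ`, then convolution with `N(0, M)` preserves invariant
laws; uniqueness forces `M = 0`. -/
lemma eq_zero_of_conj_eq (hP : P.PosDef) (hL : P ≤ predCov A B P)
    (hinv : ∃! ν : Measure (Vec p), IsProbabilityMeasure ν ∧ (outputKernel A B P).Invariant ν)
    {M : Matrix (Fin p) (Fin p) ℝ} (hM : 0 ≤ M) (hAM : A * M * Aᵀ = M) : M = 0 := by
  obtain ⟨ν, ⟨hνp, hν⟩, huniq⟩ := hinv
  have hinv' := (invariant_iff hP hL ν).1 hν
  have hν' : (outputKernel A B P).Invariant (ν ∗ multivariateGaussian (0 : Vec p) M) := by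
    rw [invariant_iff hP hL]
    intro ξ
    rw [charFun_conv, charFun_conv, hinv' ξ, charFun_gaussian hM, charFun_gaussian hM,
      quad_toEuclideanLin, hAM]
    ring
  have heq := huniq _ ⟨inferInstance, hν'⟩
  have hcont : Continuous (charFun ν) := continuous_charFun
  have hnear : ∀ᶠ ξ in 𝓝 (0 : Vec p), charFun ν ξ ≠ 0 :=
    (hcont.tendsto 0).eventually (isOpen_ne.mem_nhds (by simp))
  obtain ⟨r, hr, hball⟩ := Metric.eventually_nhds_iff.1 hnear
  have hzero : ∀ ξ : Vec p, dist ξ 0 < r → quad M ξ = 0 := fun ξ hξ => by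
    have h1 := congrFun (congrArg charFun heq) ξ
    rw [charFun_conv, charFun_gaussian hM] at h1
    have h2 := mul_eq_left₀ (hball hξ) |>.1 h1
    have h3 := congrArg norm h2
    rw [Complex.norm_exp, norm_one, Real.exp_eq_one_iff, ← Complex.ofReal_neg,
      Complex.div_ofNat_re, Complex.ofReal_re] at h3
    linarith
  refine le_antisymm (le_of_forall_quad_le (transpose_eq_of_nonneg hM) (by simp) fun x => ?_) hM
  by_cases hx : x = 0
  · simp [hx, quad]
  have hx' : 0 < ‖x‖ := norm_pos_iff.2 hx
  have := hzero ((r / 2 / ‖x‖) • x) (by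
    rw [dist_zero_right, norm_smul, Real.norm_eq_abs, abs_of_pos (by positivity),
      div_mul_cancel₀ _ hx'.ne']
    linarith)
  rw [quad_const_smul, mul_eq_zero] at this
  rw [this.resolve_left (by positivity)]
  simp [quad]

/-- A unique invariant law of the reproduction makes the source stable. If it exists, the powers of
`A` are bounded, and a limit `M` of the averages of `Aᵏ Π Aᵏᵀ` satisfies `A M Aᵀ = M`, so `M = 0`. -/
lemma tendsto_pow_zero_of_existsUnique_invariant (hP : P.PosDef) (hL : P ≤ predCov A B P)
    (hinv : ∃! ν : Measure (Vec p), IsProbabilityMeasure ν ∧ (outputKernel A B P).Invariant ν) :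
    Tendsto (fun j => A ^ j) atTop (𝓝 0) := by
  have : FirstCountableTopology (Matrix (Fin p) (Fin p) ℝ) :=
    inferInstanceAs (FirstCountableTopology (Fin p → Fin p → ℝ))
  obtain ⟨C, hC⟩ : ∃ C : ℝ, ∀ n, A ^ n * P * (A ^ n)ᵀ ≤ C • P := by
    obtain ⟨ν, ⟨hνp, hν⟩, -⟩ := hinv
    exact exists_pow_conj_le hP hL hν
  set T : ℕ → Matrix (Fin p) (Fin p) ℝ := fun k => A ^ (k + 1) * P * (A ^ (k + 1))ᵀ with hT
  have hT0 : ∀ k, 0 ≤ T k := fun k => conj_nonneg hP.posSemidef.nonneg _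
  have hTC : ∀ k, T k ≤ C • P := fun k => hC (k + 1)
  have hTA : ∀ k, A * T k * Aᵀ = T (k + 1) := fun k => by
    rw [hT]
    simp only
    rw [conj_conj, ← pow_succ']
  set M : ℕ → Matrix (Fin p) (Fin p) ℝ :=
    fun N => ((N : ℝ) + 1)⁻¹ • ∑ k ∈ Finset.range (N + 1), T k with hM
  have hM0 : ∀ N, M N ∈ Set.Icc 0 (C • P) := fun N => by
    have hN : (0 : ℝ) ≤ ((N : ℝ) + 1)⁻¹ := by positivity
    constructor
    · have := smul_le_smul_of_le hN (Finset.sum_nonneg fun k (_ : k ∈ Finset.range (N + 1)) => hT0 k)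
      rwa [smul_zero] at this
    · have := smul_le_smul_of_le hN (Finset.sum_le_card_nsmul (Finset.range (N + 1)) T _
        fun k _ => hTC k)
      rw [Finset.card_range, ← Nat.cast_smul_eq_nsmul ℝ (N + 1), smul_smul] at this
      push_cast at this
      rwa [inv_mul_cancel₀ (by positivity), one_smul] at this
  obtain ⟨X, hX, φ, hφ, hlim⟩ := (isCompact_Icc_zero (C • P)).tendsto_subseq hM0
  have hXA : A * X * Aᵀ = X := by
    have h1 : Tendsto (fun N => A * M (φ N) * Aᵀ - M (φ N)) atTop (𝓝 (A * X * Aᵀ - X)) := by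
      have hc : Continuous fun Y : Matrix (Fin p) (Fin p) ℝ => A * Y * Aᵀ - Y := by fun_prop
      exact (hc.tendsto X).comp hlim
    have h2 : ∀ N, A * M N * Aᵀ - M N = ((N : ℝ) + 1)⁻¹ • (T (N + 1) - T 0) := fun N => by
      rw [hM]
      simp only
      rw [conj_smul, ← smul_sub, Finset.mul_sum, Finset.sum_mul, ← Finset.sum_sub_distrib]
      simp only [hTA]
      rw [Finset.sum_range_sub]
    have h3 : Tendsto (fun N => A * M N * Aᵀ - M N) atTop (𝓝 0) := by
      refine tendsto_pi_nhds.2 fun i => tendsto_pi_nhds.2 fun j => ?_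
      have hb : ∀ k, |T k i j| ≤ (C • P).trace := fun k =>
        (abs_apply_le_trace (hT0 k) i j).trans (trace_mono (hTC k))
      refine squeeze_zero_norm (a := fun N : ℕ => (2 * (C • P).trace) * (1 / ((N : ℝ) + 1)))
        (fun N => ?_) (by
          have := (tendsto_one_div_add_atTop_nhds_zero_nat (𝕜 := ℝ)).const_mul
            (2 * (C • P).trace)
          rwa [mul_zero] at this)
      rw [h2, Matrix.smul_apply, Matrix.sub_apply, smul_eq_mul, norm_mul, Real.norm_eq_abs,
        abs_of_nonneg (show (0 : ℝ) ≤ ((N : ℝ) + 1)⁻¹ by positivity), mul_comm, one_div]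
      gcongr
      rw [Real.norm_eq_abs]
      have := abs_sub (T (N + 1) i j) (T 0 i j)
      linarith [hb (N + 1), hb 0]
    exact sub_eq_zero.1 (tendsto_nhds_unique h1 (h3.comp hφ.tendsto_atTop))
  have hX0 := eq_zero_of_conj_eq hP hL hinv hX.1 hXA
  subst hX0
  obtain ⟨c, hc, hcP⟩ := exists_smul_one_le hP
  have htr : Tendsto (fun N => (p : ℝ) * (p : ℝ) * (M (φ N)).trace) atTop (𝓝 0) := by
    have hcont : Continuous fun Y : Matrix (Fin p) (Fin p) ℝ => (p : ℝ) * (p : ℝ) * Y.trace := by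
      fun_prop
    have := (hcont.tendsto 0).comp hlim
    rwa [Matrix.trace_zero, mul_zero] at this
  obtain ⟨N, hN⟩ := (htr.eventually (gt_mem_nhds (show (0 : ℝ) < c / 2 by positivity))).exists
  obtain ⟨k, hk⟩ : ∃ k, (p : ℝ) * (p : ℝ) * (T k).trace ≤ c / 2 := by
    by_contra! hcon
    refine hN.not_ge ?_
    rw [hM]
    simp only
    rw [Matrix.trace_smul, Matrix.trace_sum, smul_eq_mul, mul_left_comm, Finset.mul_sum,
      le_inv_mul_iff₀ (by positivity)]
    have := Finset.card_nsmul_le_sum (Finset.range (φ N + 1))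
      (fun k => (p : ℝ) * (p : ℝ) * (T k).trace) (c / 2) fun k _ => (hcon k).le
    rw [Finset.card_range, nsmul_eq_mul] at this
    exact_mod_cast this
  refine tendsto_pow_zero_of_conj_le hP (k := k + 1) (Nat.succ_pos k) (ρ := 1 / 2) (by norm_num) ?_
  have h1 : ∑ i, ∑ j, |T k i j| ≤ c / 2 := by
    refine le_trans (Finset.sum_le_sum fun i _ => Finset.sum_le_sum fun j _ =>
      abs_apply_le_trace (hT0 k) i j) ?_
    simpa [mul_assoc] using hk
  refine (le_sum_abs_smul_one (transpose_eq_of_nonneg (hT0 k))).trans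
    ((smul_one_mono h1).trans ?_)
  have := smul_le_smul_of_le (c := 1 / 2) (by norm_num) hcP
  rwa [smul_smul, one_div_mul_eq_div] at this

end InvariantLaw

/-! ### Second moments -/

section SecondMoment

open scoped MatrixOrder RealInnerProductSpace

variable {Ω Ω' : Type*} [MeasurableSpace Ω] [MeasurableSpace Ω'] {μ : Measure Ω} {n m : ℕ}

/-- The matrix `E[Z Zᵀ]`. -/
noncomputable def secondMoment (μ : Measure Ω) (Z : Ω → Vec n) : Matrix (Fin n) (Fin n) ℝ :=
  Matrix.of fun i j => ∫ ω, Z ω i * Z ω j ∂μ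

lemma memLp_apply {Z : Ω → Vec n} (hZ : MemLp Z 2 μ) (i : Fin n) :
    MemLp (fun ω => Z ω i) 2 μ :=
  (EuclideanSpace.proj i : Vec n →L[ℝ] ℝ).comp_memLp' hZ

lemma integrable_apply_mul_apply {Z : Ω → Vec n} (hZ : MemLp Z 2 μ) (i j : Fin n) :
    Integrable (fun ω => Z ω i * Z ω j) μ :=
  (memLp_apply hZ i).integrable_mul (memLp_apply hZ j)

lemma memLp_toEuclideanLin {Z : Ω → Vec n} (hZ : MemLp Z 2 μ) (M : Matrix (Fin m) (Fin n) ℝ) :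
    MemLp (fun ω => Matrix.toEuclideanLin M (Z ω)) 2 μ :=
  (LinearMap.toContinuousLinearMap (Matrix.toEuclideanLin M)).comp_memLp' hZ

lemma quad_eq_sum (M : Matrix (Fin n) (Fin n) ℝ) (x : Vec n) :
    quad M x = ∑ i, ∑ j, M i j * (x i * x j) := by
  simp only [quad, dotProduct, Matrix.mulVec, Finset.mul_sum]
  exact Finset.sum_congr rfl fun i _ => Finset.sum_congr rfl fun j _ => by ring

lemma integrable_quad {Z : Ω → Vec n} (hZ : MemLp Z 2 μ) (M : Matrix (Fin n) (Fin n) ℝ) :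
    Integrable (fun ω => quad M (Z ω)) μ := by
  simp only [quad_eq_sum]
  exact integrable_finsetSum _ fun i _ => integrable_finsetSum _ fun j _ =>
    (integrable_apply_mul_apply hZ i j).const_mul _

lemma integral_quad {Z : Ω → Vec n} (hZ : MemLp Z 2 μ) (M : Matrix (Fin n) (Fin n) ℝ) :
    ∫ ω, quad M (Z ω) ∂μ = (M * secondMoment μ Z).trace := by
  have hint : ∀ i, Integrable (fun ω => ∑ j, M i j * (Z ω i * Z ω j)) μ := fun i =>
    integrable_finsetSum _ fun j _ => (integrable_apply_mul_apply hZ i j).const_mul _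
  simp only [quad_eq_sum]
  rw [integral_finsetSum _ fun i _ => hint i]
  refine Finset.sum_congr rfl fun i _ => ?_
  rw [integral_finsetSum _ fun j _ => (integrable_apply_mul_apply hZ i j).const_mul _,
    Matrix.diag_apply, Matrix.mul_apply]
  refine Finset.sum_congr rfl fun j _ => ?_
  rw [integral_const_mul, secondMoment, Matrix.of_apply]
  simp only [mul_comm]

lemma quad_vecMulVec (u x : Vec n) :
    quad (Matrix.vecMulVec u.ofLp u.ofLp) x = ⟪u, x⟫ ^ 2 := by
  rw [quad, Matrix.vecMulVec_mulVec, EuclideanSpace.inner_eq_star_dotProduct, star_trivial,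
    dotProduct_comm x.ofLp]
  simp [dotProduct_comm, sq]

lemma quad_secondMoment {Z : Ω → Vec n} (hZ : MemLp Z 2 μ) (u : Vec n) :
    quad (secondMoment μ Z) u = ∫ ω, ⟪u, Z ω⟫ ^ 2 ∂μ := by
  simp only [← quad_vecMulVec]
  rw [integral_quad hZ, quad, Matrix.vecMulVec_eq (Fin 1), Matrix.mul_assoc, Matrix.trace_mul_comm]
  simp [Matrix.trace, Matrix.mul_apply, dotProduct, Matrix.mulVec, Finset.sum_mul, Finset.mul_sum]
  rw [Finset.sum_comm]
  exact Finset.sum_congr rfl fun i _ => Finset.sum_congr rfl fun j _ => by ring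

lemma transpose_secondMoment (Z : Ω → Vec n) : (secondMoment μ Z)ᵀ = secondMoment μ Z := by
  ext i j
  simp [secondMoment, mul_comm]

lemma secondMoment_nonneg {Z : Ω → Vec n} (hZ : MemLp Z 2 μ) : 0 ≤ secondMoment μ Z := by
  refine le_of_forall_quad_le (by simp) (transpose_secondMoment Z) fun u => ?_
  rw [quad_secondMoment hZ]
  simpa [quad] using integral_nonneg fun ω => sq_nonneg _

lemma lintegral_enorm_sq {Z : Ω → Vec n} (hZ : MemLp Z 2 μ) :
    ∫⁻ ω, ‖Z ω‖ₑ ^ 2 ∂μ = ENNReal.ofReal (secondMoment μ Z).trace := by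
  have h := integral_quad hZ 1
  rw [one_mul] at h
  rw [← h, ofReal_integral_eq_lintegral_ofReal (integrable_quad hZ 1)
    (ae_of_all _ fun ω => (sq_nonneg ‖Z ω‖).trans_eq (norm_sq_eq_quad _))]
  refine lintegral_congr fun ω => ?_
  rw [← norm_sq_eq_quad, ENNReal.ofReal_pow (norm_nonneg _), ofReal_norm]

lemma secondMoment_map {T : Ω → Ω'} (hT : Measurable T) {Z : Ω' → Vec n} (hZ : Measurable Z) :
    secondMoment (μ.map T) Z = secondMoment μ (Z ∘ T) := by
  ext i j
  simp only [secondMoment, Matrix.of_apply]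
  rw [integral_map hT.aemeasurable]
  · rfl
  · exact Measurable.aestronglyMeasurable (by fun_prop)

lemma memLp_id_gaussian (S : Matrix (Fin n) (Fin n) ℝ) :
    MemLp (fun x : Vec n => x) 2 (multivariateGaussian 0 S) := IsGaussian.memLp_two_id

lemma secondMoment_gaussian {S : Matrix (Fin n) (Fin n) ℝ} (hS : 0 ≤ S) :
    secondMoment (multivariateGaussian 0 S) (fun x : Vec n => x) = S := by
  ext i j
  have h := covariance_eval_multivariateGaussian (μ := (0 : Vec n))
    (Matrix.nonneg_iff_posSemidef.1 hS) i j
  have hi : ∀ i : Fin n, ∫ x : Vec n, x i ∂multivariateGaussian (0 : Vec n) S = 0 := fun i => by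
    have h1 := (EuclideanSpace.proj i : Vec n →L[ℝ] ℝ).integral_comp_comm
      ((memLp_id_gaussian S).integrable one_le_two)
    simpa [integral_id_multivariateGaussian] using h1
  rw [covariance_eq_sub (memLp_apply (memLp_id_gaussian S) i)
    (memLp_apply (memLp_id_gaussian S) j), hi, zero_mul, sub_zero] at h
  exact h

/-- The second moment of `M x + K y` for independent `x` and `y`, where `y` is centred Gaussian. -/
lemma secondMoment_add {ν : Measure (Vec n)} [IsProbabilityMeasure ν]
    (hν : MemLp (fun x : Vec n => x) 2 ν) {T : Matrix (Fin m) (Fin m) ℝ} (hT : 0 ≤ T)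
    {k : ℕ} (M : Matrix (Fin k) (Fin n) ℝ) (K : Matrix (Fin k) (Fin m) ℝ) :
    secondMoment (ν.prod (multivariateGaussian (0 : Vec m) T))
      (fun z => Matrix.toEuclideanLin M z.1 + Matrix.toEuclideanLin K z.2) =
    M * secondMoment ν (fun x => x) * Mᵀ + K * T * Kᵀ := by
  have h1 : MemLp (fun z : Vec n × Vec m => z.1) 2
      (ν.prod (multivariateGaussian (0 : Vec m) T)) :=
    hν.comp_measurePreserving measurePreserving_fst
  have h2 : MemLp (fun z : Vec n × Vec m => z.2) 2
      (ν.prod (multivariateGaussian (0 : Vec m) T)) :=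
    (memLp_id_gaussian T).comp_measurePreserving measurePreserving_snd
  have hsymm : (M * secondMoment ν (fun x => x) * Mᵀ + K * T * Kᵀ)ᵀ =
      M * secondMoment ν (fun x => x) * Mᵀ + K * T * Kᵀ := by
    simp [Matrix.transpose_mul, transpose_secondMoment, transpose_eq_of_nonneg hT,
      Matrix.mul_assoc]
  have key : ∀ u : Vec k, quad (secondMoment (ν.prod (multivariateGaussian (0 : Vec m) T))
      (fun z => Matrix.toEuclideanLin M z.1 + Matrix.toEuclideanLin K z.2)) u =
      quad (M * secondMoment ν (fun x => x) * Mᵀ + K * T * Kᵀ) u := fun u => by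
    have h12 : MemLp (fun z : Vec n × Vec m =>
        Matrix.toEuclideanLin M z.1 + Matrix.toEuclideanLin K z.2) 2
        (ν.prod (multivariateGaussian (0 : Vec m) T)) :=
      (memLp_toEuclideanLin h1 M).add (memLp_toEuclideanLin h2 K)
    rw [quad_secondMoment h12, quad_add,
      ← quad_toEuclideanLin, ← quad_toEuclideanLin, quad_secondMoment hν]
    set a := Matrix.toEuclideanLin Mᵀ u with ha
    set b := Matrix.toEuclideanLin Kᵀ u with hb
    have e : ∀ z : Vec n × Vec m, ⟪u, Matrix.toEuclideanLin M z.1 + Matrix.toEuclideanLin K z.2⟫ ^ 2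
        = ⟪a, z.1⟫ ^ 2 + 2 * (⟪a, z.1⟫ * ⟪b, z.2⟫) + ⟪b, z.2⟫ ^ 2 := fun z => by
      rw [ha, hb, inner_toEuclideanLin_left, inner_toEuclideanLin_left, Matrix.transpose_transpose,
        Matrix.transpose_transpose, inner_add_right]
      ring
    simp only [e]
    have i1 : MemLp (fun z : Vec n × Vec m => ⟪a, z.1⟫) 2
        (ν.prod (multivariateGaussian (0 : Vec m) T)) := (innerSL ℝ a).comp_memLp' h1
    have i2 : MemLp (fun z : Vec n × Vec m => ⟪b, z.2⟫) 2
        (ν.prod (multivariateGaussian (0 : Vec m) T)) := (innerSL ℝ b).comp_memLp' h2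
    have i12 : Integrable (fun z : Vec n × Vec m => 2 * (⟪a, z.1⟫ * ⟪b, z.2⟫))
        (ν.prod (multivariateGaussian (0 : Vec m) T)) := (i1.integrable_mul i2).const_mul 2
    have i112 : Integrable (fun z : Vec n × Vec m => ⟪a, z.1⟫ ^ 2 + 2 * (⟪a, z.1⟫ * ⟪b, z.2⟫))
        (ν.prod (multivariateGaussian (0 : Vec m) T)) := i1.integrable_sq.add i12
    rw [integral_add i112 i2.integrable_sq, integral_add i1.integrable_sq i12, integral_const_mul,
      integral_prod_mul (fun x => ⟪a, x⟫) (fun y => ⟪b, y⟫)]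
    have hb0 : ∫ y : Vec m, ⟪b, y⟫ ∂multivariateGaussian (0 : Vec m) T = 0 := by
      have h1 := (innerSL ℝ b).integral_comp_comm
        ((memLp_id_gaussian T).integrable one_le_two)
      simpa [integral_id_multivariateGaussian] using h1
    have e1 : ∫ z : Vec n × Vec m, ⟪a, z.1⟫ ^ 2 ∂(ν.prod (multivariateGaussian (0 : Vec m) T)) =
        ∫ x, ⟪a, x⟫ ^ 2 ∂ν := by
      simpa using integral_fun_fst (μ := ν) (ν := multivariateGaussian (0 : Vec m) T)
        (fun x => ⟪a, x⟫ ^ 2)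
    have e2 : ∫ z : Vec n × Vec m, ⟪b, z.2⟫ ^ 2 ∂(ν.prod (multivariateGaussian (0 : Vec m) T)) =
        quad T b := by
      rw [← secondMoment_gaussian hT, quad_secondMoment (memLp_id_gaussian T),
        secondMoment_gaussian hT]
      simpa using integral_fun_snd (μ := ν) (ν := multivariateGaussian (0 : Vec m) T)
        (fun x => ⟪b, x⟫ ^ 2)
    rw [hb0, e1, e2]
    ring
  exact le_antisymm
    (le_of_forall_quad_le (transpose_secondMoment _) hsymm fun u => (key u).le)
    (le_of_forall_quad_le hsymm (transpose_secondMoment _) fun u => (key u).ge)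

end SecondMoment

/-! ### The source and the stationary channel as Gaussian processes -/

section Trajectories

open scoped MatrixOrder

variable {p q : ℕ} {A : Matrix (Fin p) (Fin p) ℝ} {B : Matrix (Fin p) (Fin q) ℝ}
  {S₀ P : Matrix (Fin p) (Fin p) ℝ} {Q : TestChannel p}

instance (S₀ : Matrix (Fin p) (Fin p) ℝ) (Q : TestChannel p) :
    IsProbabilityMeasure (law q S₀ Q) := by
  unfold law
  infer_instance

@[fun_prop]
lemma measurable_source (t : ℕ) : Measurable (source A B t) := by
  induction t with
  | zero => exact measurable_fst
  | succ t ih =>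
    change Measurable fun ω : Sample p q =>
      Matrix.toEuclideanLin A (source A B t ω) + Matrix.toEuclideanLin B (ω.2.1 t)
    fun_prop

@[fun_prop]
lemma measurable_prevOutput (t : ℕ) : Measurable (prevOutput A B Q t) := by
  induction t with
  | zero => exact measurable_const
  | succ t ih =>
    change Measurable fun ω : Sample p q => Matrix.toEuclideanLin (Q.gain t) (source A B t ω)
      + Matrix.toEuclideanLin (Q.feedback t) (prevOutput A B Q t ω) + ω.2.2 t
    fun_prop

@[fun_prop]
lemma measurable_output (t : ℕ) : Measurable (output A B Q t) := measurable_prevOutput (t + 1)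

/-- Replace the source noise `w_t`. With a fresh copy of `w_t`, this preserves the law; what does not
change under the replacement is independent of `w_t`. -/
def resampleSource (t : ℕ) (z : Sample p q × Vec q) : Sample p q :=
  (z.1.1, Function.update z.1.2.1 t z.2, z.1.2.2)

/-- Replace the channel noise `v_t`. -/
def resampleChannel (t : ℕ) (z : Sample p q × Vec p) : Sample p q :=
  (z.1.1, z.1.2.1, Function.update z.1.2.2 t z.2)

lemma measurePreserving_resampleSource (S₀ : Matrix (Fin p) (Fin p) ℝ) (Q : TestChannel p)
    (t : ℕ) : MeasurePreserving (resampleSource t)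
      ((law q S₀ Q).prod (multivariateGaussian (0 : Vec q) 1)) (law q S₀ Q) := by
  have hu := measurable_update_prod (X := fun _ => Vec q) t
  have hm : Measurable (resampleSource (p := p) (q := q) t) :=
    (measurable_fst.comp measurable_fst).prodMk
      ((hu.comp (by fun_prop : Measurable fun z : Sample p q × Vec q => (z.1.2.1, z.2))).prodMk
        (by fun_prop))
  refine ⟨hm, Measure.ext_of_lintegral _ fun f hf => ?_⟩
  rw [lintegral_map hf hm, law, lintegral_prod _ (by fun_prop), lintegral_prod _ (by fun_prop),
    lintegral_prod _ (by fun_prop)]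
  refine lintegral_congr fun x => ?_
  rw [lintegral_prod_symm _ (by fun_prop), lintegral_prod_symm _ (by fun_prop)]
  refine lintegral_congr fun v => ?_
  conv_rhs => rw [← map_update_infinitePi (fun _ : ℕ => multivariateGaussian (0 : Vec q) 1) t]
  rw [lintegral_map (by fun_prop) hu, lintegral_prod _ (by fun_prop)]
  rfl

lemma measurePreserving_resampleChannel (S₀ : Matrix (Fin p) (Fin p) ℝ) (Q : TestChannel p)
    (t : ℕ) : MeasurePreserving (resampleChannel t)
      ((law q S₀ Q).prod (multivariateGaussian (0 : Vec p) (Q.noiseCov t))) (law q S₀ Q) := by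
  have hu := measurable_update_prod (X := fun _ => Vec p) t
  have hm : Measurable (resampleChannel (p := p) (q := q) t) :=
    (measurable_fst.comp measurable_fst).prodMk ((by fun_prop : Measurable _).prodMk
      (hu.comp (by fun_prop : Measurable fun z : Sample p q × Vec p => (z.1.2.2, z.2))))
  refine ⟨hm, Measure.ext_of_lintegral _ fun f hf => ?_⟩
  rw [lintegral_map hf hm, law, lintegral_prod _ (by fun_prop), lintegral_prod _ (by fun_prop),
    lintegral_prod _ (by fun_prop)]
  refine lintegral_congr fun x => ?_
  rw [lintegral_prod _ (by fun_prop), lintegral_prod _ (by fun_prop)]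
  refine lintegral_congr fun w => ?_
  conv_rhs => rw [← map_update_infinitePi
    (fun t : ℕ => multivariateGaussian (0 : Vec p) (Q.noiseCov t)) t]
  rw [lintegral_map (by fun_prop) hu, lintegral_prod _ (by fun_prop)]
  rfl

lemma source_resampleSource {s t : ℕ} (h : s ≤ t) (z : Sample p q × Vec q) :
    source A B s (resampleSource t z) = source A B s z.1 := by
  induction s with
  | zero => rfl
  | succ s ih =>
    have hst : s ≠ t := by omega
    have e : (resampleSource t z).2.1 s = z.1.2.1 s := by simp [resampleSource, hst]
    simp only [source, ih (by omega), e]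

lemma prevOutput_resampleSource {s t : ℕ} (h : s ≤ t + 1) (z : Sample p q × Vec q) :
    prevOutput A B Q s (resampleSource t z) = prevOutput A B Q s z.1 := by
  induction s with
  | zero => rfl
  | succ s ih =>
    simp [prevOutput, ih (by omega), source_resampleSource (show s ≤ t by omega)]
    rfl

lemma source_resampleChannel (s t : ℕ) (z : Sample p q × Vec p) :
    source A B s (resampleChannel t z) = source A B s z.1 := by
  induction s with
  | zero => rfl
  | succ s ih => simp [source, ih]; rfl

lemma prevOutput_resampleChannel {s t : ℕ} (h : s ≤ t) (z : Sample p q × Vec p) :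
    prevOutput A B Q s (resampleChannel t z) = prevOutput A B Q s z.1 := by
  induction s with
  | zero => rfl
  | succ s ih =>
    have hst : s ≠ t := by omega
    have e : (resampleChannel t z).2.2 s = z.1.2.2 s := by simp [resampleChannel, hst]
    simp only [prevOutput, ih (by omega), source_resampleChannel, e]

lemma map_prodMk_sourceNoise {α : Type*} [MeasurableSpace α] {F : Sample p q → α}
    (hF : Measurable F) (t : ℕ) (h : ∀ z, F (resampleSource t z) = F z.1) :
    (law q S₀ Q).map (fun ω => (F ω, ω.2.1 t)) =
      ((law q S₀ Q).map F).prod (multivariateGaussian (0 : Vec q) 1) := by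
  have hr := measurePreserving_resampleSource (q := q) S₀ Q t
  conv_lhs => rw [← hr.map_eq]
  rw [Measure.map_map (by fun_prop) hr.measurable]
  have e : (fun ω : Sample p q => (F ω, ω.2.1 t)) ∘ resampleSource t = Prod.map F id := by
    funext z
    exact Prod.ext (h z) (by simp [resampleSource])
  rw [e, ← Measure.map_prod_map _ _ hF measurable_id, Measure.map_id]

lemma map_prodMk_channelNoise {α : Type*} [MeasurableSpace α] {F : Sample p q → α}
    (hF : Measurable F) (t : ℕ) (h : ∀ z, F (resampleChannel t z) = F z.1) :
    (law q S₀ Q).map (fun ω => (F ω, ω.2.2 t)) =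
      ((law q S₀ Q).map F).prod (multivariateGaussian (0 : Vec p) (Q.noiseCov t)) := by
  have hr := measurePreserving_resampleChannel (q := q) S₀ Q t
  conv_lhs => rw [← hr.map_eq]
  rw [Measure.map_map (by fun_prop) hr.measurable]
  have e : (fun ω : Sample p q => (F ω, ω.2.2 t)) ∘ resampleChannel t = Prod.map F id := by
    funext z
    exact Prod.ext (h z) (by simp [resampleChannel])
  rw [e, ← Measure.map_prod_map _ _ hF measurable_id, Measure.map_id]

lemma predCov_iterate_nonneg (hS₀ : 0 ≤ S₀) (t : ℕ) : 0 ≤ (fun X => predCov A B X)^[t] S₀ := by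
  induction t with
  | zero => exact hS₀
  | succ t ih =>
    rw [Function.iterate_succ_apply']
    exact add_nonneg (conj_nonneg ih A) (mul_transpose_self_nonneg B)

lemma map_source (hS₀ : 0 ≤ S₀) (t : ℕ) : (law q S₀ Q).map (source A B t) =
    multivariateGaussian (0 : Vec p) ((fun X => predCov A B X)^[t] S₀) := by
  induction t with
  | zero =>
    change (law q S₀ Q).map Prod.fst = _
    rw [law, Measure.map_fst_prod, measure_univ, one_smul, Function.iterate_zero_apply]
  | succ t ih =>
    have h := map_prodMk_sourceNoise (S₀ := S₀) (Q := Q) (measurable_source (A := A) (B := B) t) t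
      (fun z => source_resampleSource le_rfl z)
    have e : source A B (t + 1) =
        (fun z : Vec p × Vec q => Matrix.toEuclideanLin A z.1 + Matrix.toEuclideanLin B z.2) ∘
          fun ω : Sample p q => (source A B t ω, ω.2.1 t) := rfl
    rw [e, ← Measure.map_map (by fun_prop) (by fun_prop), h, ih,
      map_add_gaussian (predCov_iterate_nonneg hS₀ t) Matrix.PosSemidef.one.nonneg,
      Function.iterate_succ_apply', Matrix.mul_one]
    rfl

/-- The covariance of `x_t - y_t` under the stationary channel, as a recursion. -/
noncomputable def errorCov (A : Matrix (Fin p) (Fin p) ℝ) (B : Matrix (Fin p) (Fin q) ℝ)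
    (P S₀ : Matrix (Fin p) (Fin p) ℝ) : ℕ → Matrix (Fin p) (Fin p) ℝ
  | 0 => (1 - gainH A B P) * S₀ * (1 - gainH A B P)ᵀ + P * (gainH A B P)ᵀ
  | t + 1 => (1 - gainH A B P) * predCov A B (errorCov A B P S₀ t) * (1 - gainH A B P)ᵀ +
      P * (gainH A B P)ᵀ

lemma errorCov_nonneg (hP : P.PosDef) (hL : P ≤ predCov A B P) (hS₀ : 0 ≤ S₀) (t : ℕ) :
    0 ≤ errorCov A B P S₀ t := by
  cases t with
  | zero => exact add_nonneg (conj_nonneg hS₀ _) (noise_nonneg hP hL)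
  | succ t =>
    exact add_nonneg (conj_nonneg (add_nonneg
      (conj_nonneg (errorCov_nonneg hP hL hS₀ t) _) (mul_transpose_self_nonneg B)) _)
      (noise_nonneg hP hL)

lemma errorCov_sub (hP : P.PosDef) (hL : P ≤ predCov A B P) (t : ℕ) :
    errorCov A B P S₀ t - P =
      ((1 - gainH A B P) * A) ^ t * (errorCov A B P S₀ 0 - P) * (((1 - gainH A B P) * A) ^ t)ᵀ := by
  induction t with
  | zero => simp
  | succ t ih =>
    have h : errorCov A B P S₀ (t + 1) - P = errorCov A B P S₀ (t + 1) -
        ((1 - gainH A B P) * predCov A B P * (1 - gainH A B P)ᵀ + P * (gainH A B P)ᵀ) := by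
      rw [conj_one_sub_gainH hP hL]
    rw [pow_succ', ← conj_conj, ← ih, h, errorCov]
    generalize errorCov A B P S₀ t = E
    generalize 1 - gainH A B P = K
    simp only [predCov, Matrix.transpose_mul, Matrix.mul_sub, Matrix.sub_mul, Matrix.mul_add,
      Matrix.add_mul, Matrix.mul_assoc]
    abel

lemma tendsto_errorCov (hA : Tendsto (fun j => A ^ j) atTop (𝓝 0)) (hP : P.PosDef)
    (hL : P ≤ predCov A B P) : Tendsto (errorCov A B P S₀) atTop (𝓝 P) := by
  have h := tendsto_conj_pow (tendsto_closedLoop_pow hA hP hL) (errorCov A B P S₀ 0 - P)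
  simp only [← errorCov_sub hP hL] at h
  simpa using h.add_const P

lemma errorCov_predCov (hP : P.PosDef) (hL : P ≤ predCov A B P) (t : ℕ) :
    errorCov A B P (predCov A B P) t = P := by
  have h := errorCov_sub (S₀ := predCov A B P) hP hL t
  rw [errorCov, conj_one_sub_gainH hP hL] at h
  simpa [sub_eq_zero] using h

/-- The prediction error `x_t - A y_{t-1}`. -/
noncomputable def innovation (A : Matrix (Fin p) (Fin p) ℝ) (B : Matrix (Fin p) (Fin q) ℝ)
    (Q : TestChannel p) (t : ℕ) (ω : Sample p q) : Vec p :=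
  source A B t ω - Matrix.toEuclideanLin A (prevOutput A B Q t ω)

@[fun_prop]
lemma measurable_innovation (t : ℕ) : Measurable (innovation A B Q t) := by
  unfold innovation
  fun_prop

lemma innovation_succ (t : ℕ) (ω : Sample p q) : innovation A B Q (t + 1) ω =
    Matrix.toEuclideanLin A (source A B t ω - output A B Q t ω) +
      Matrix.toEuclideanLin B (ω.2.1 t) := by
  simp only [innovation, source, output, map_sub]
  abel

lemma output_stationary (t : ℕ) (ω : Sample p q) :
    output A B (stationaryChannel A B P) t ω =
      Matrix.toEuclideanLin A (prevOutput A B (stationaryChannel A B P) t ω) +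
        (Matrix.toEuclideanLin (gainH A B P) (innovation A B (stationaryChannel A B P) t ω) +
          ω.2.2 t) := by
  have h1 : ∀ y : Vec p, Matrix.toEuclideanLin ((1 - gainH A B P) * A) y =
      Matrix.toEuclideanLin A y - Matrix.toEuclideanLin (gainH A B P) (Matrix.toEuclideanLin A y) :=
    fun y => by
      ext i
      simp [Matrix.sub_mul]
  simp only [output, prevOutput, stationaryChannel, innovation, h1, map_sub]
  abel

lemma error_stationary (t : ℕ) (ω : Sample p q) :
    source A B t ω - output A B (stationaryChannel A B P) t ω =
      Matrix.toEuclideanLin (1 - gainH A B P) (innovation A B (stationaryChannel A B P) t ω) -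
        ω.2.2 t := by
  rw [output_stationary]
  simp only [map_sub, LinearMap.sub_apply, Matrix.toLpLin_one, LinearMap.id_apply]
  rw [innovation]
  abel

lemma innovation_resampleChannel (t : ℕ) (z : Sample p q × Vec p) :
    innovation A B Q t (resampleChannel t z) = innovation A B Q t z.1 := by
  rw [innovation, source_resampleChannel, prevOutput_resampleChannel le_rfl, innovation]

/-- The covariance of `x_t - A y_{t-1}` under the stationary channel. -/
noncomputable def innovationCov (A : Matrix (Fin p) (Fin p) ℝ) (B : Matrix (Fin p) (Fin q) ℝ)
    (P S₀ : Matrix (Fin p) (Fin p) ℝ) : ℕ → Matrix (Fin p) (Fin p) ℝ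
  | 0 => S₀
  | t + 1 => predCov A B (errorCov A B P S₀ t)

lemma errorCov_eq (t : ℕ) : errorCov A B P S₀ t =
    (1 - gainH A B P) * innovationCov A B P S₀ t * (1 - gainH A B P)ᵀ + P * (gainH A B P)ᵀ := by
  cases t <;> rfl

lemma innovationCov_nonneg (hP : P.PosDef) (hL : P ≤ predCov A B P) (hS₀ : 0 ≤ S₀) (t : ℕ) :
    0 ≤ innovationCov A B P S₀ t := by
  cases t with
  | zero => exact hS₀
  | succ t =>
    exact add_nonneg (conj_nonneg (errorCov_nonneg hP hL hS₀ t) _) (mul_transpose_self_nonneg B)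

lemma stationaryChannel_noiseCov (t : ℕ) :
    (stationaryChannel A B P).noiseCov t = P * (gainH A B P)ᵀ := rfl

lemma map_error_of_map_innovation (hP : P.PosDef) (hL : P ≤ predCov A B P) (hS₀ : 0 ≤ S₀) {t : ℕ}
    (h : (law q S₀ (stationaryChannel A B P)).map (innovation A B (stationaryChannel A B P) t) =
      multivariateGaussian (0 : Vec p) (innovationCov A B P S₀ t)) :
    (law q S₀ (stationaryChannel A B P)).map
      (fun ω => source A B t ω - output A B (stationaryChannel A B P) t ω) =
      multivariateGaussian (0 : Vec p) (errorCov A B P S₀ t) := by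
  have h1 := map_prodMk_channelNoise (S₀ := S₀) (Q := stationaryChannel A B P)
    (measurable_innovation (A := A) (B := B) (Q := stationaryChannel A B P) t) t
    (fun z => innovation_resampleChannel t z)
  have e : (fun ω => source A B t ω - output A B (stationaryChannel A B P) t ω) =
      (fun z : Vec p × Vec p => Matrix.toEuclideanLin (1 - gainH A B P) z.1 +
        Matrix.toEuclideanLin (-1) z.2) ∘
          fun ω : Sample p q => (innovation A B (stationaryChannel A B P) t ω, ω.2.2 t) := by
    funext ω
    rw [error_stationary]
    simp [sub_eq_add_neg]
  rw [e, ← Measure.map_map (by fun_prop) (by fun_prop), h1, h,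
    stationaryChannel_noiseCov,
    map_add_gaussian (innovationCov_nonneg hP hL hS₀ t) (noise_nonneg hP hL), errorCov_eq]
  simp

lemma map_innovation (hP : P.PosDef) (hL : P ≤ predCov A B P) (hS₀ : 0 ≤ S₀) (t : ℕ) :
    (law q S₀ (stationaryChannel A B P)).map (innovation A B (stationaryChannel A B P) t) =
      multivariateGaussian (0 : Vec p) (innovationCov A B P S₀ t) := by
  induction t with
  | zero =>
    have e : innovation A B (stationaryChannel A B P) 0 = source A B 0 := by
      funext ω
      simp [innovation, prevOutput]
    rw [e, map_source hS₀]
    rfl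
  | succ t ih =>
    have h0 := map_error_of_map_innovation hP hL hS₀ ih
    have h1 := map_prodMk_sourceNoise (S₀ := S₀) (Q := stationaryChannel A B P)
      (F := fun ω : Sample p q => source A B t ω - output A B (stationaryChannel A B P) t ω)
      (by fun_prop) t (fun z => by
        rw [output, prevOutput_resampleSource le_rfl, source_resampleSource le_rfl])
    have e : innovation A B (stationaryChannel A B P) (t + 1) =
        (fun z : Vec p × Vec q => Matrix.toEuclideanLin A z.1 + Matrix.toEuclideanLin B z.2) ∘
          fun ω : Sample p q =>
            (source A B t ω - output A B (stationaryChannel A B P) t ω, ω.2.1 t) := by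
      funext ω
      exact innovation_succ t ω
    rw [e, ← Measure.map_map (by fun_prop) (by fun_prop), h1, h0,
      map_add_gaussian (errorCov_nonneg hP hL hS₀ t) Matrix.PosSemidef.one.nonneg, Matrix.mul_one]
    rfl

lemma map_error (hP : P.PosDef) (hL : P ≤ predCov A B P) (hS₀ : 0 ≤ S₀) (t : ℕ) :
    (law q S₀ (stationaryChannel A B P)).map
      (fun ω => source A B t ω - output A B (stationaryChannel A B P) t ω) =
      multivariateGaussian (0 : Vec p) (errorCov A B P S₀ t) :=
  map_error_of_map_innovation hP hL hS₀ (map_innovation hP hL hS₀ t)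

end Trajectories

/-! ### A lower bound of the mutual information -/

section LowerBound

open scoped MatrixOrder RealInnerProductSpace

/-- The easy half of the Donsker–Varadhan variational formula. -/
lemma ofReal_integral_le_klDiv {α : Type*} [MeasurableSpace α] {μ ν : Measure α}
    [IsProbabilityMeasure μ] [IsProbabilityMeasure ν] {f : α → ℝ} (hf : Measurable f)
    (hfμ : Integrable f μ) (hfν : ∫⁻ x, ENNReal.ofReal (Real.exp (f x)) ∂ν ≤ 1) :
    ENNReal.ofReal (∫ x, f x ∂μ) ≤ InformationTheory.klDiv μ ν := by
  by_cases htop : InformationTheory.klDiv μ ν = ⊤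
  · rw [htop]
    exact le_top
  obtain ⟨hac, hint⟩ := InformationTheory.klDiv_ne_top_iff.1 htop
  have hexp : Integrable (fun x => Real.exp (f x)) ν := by
    refine ⟨by fun_prop, ?_⟩
    rw [hasFiniteIntegral_iff_ofReal (ae_of_all _ fun x => (Real.exp_pos _).le)]
    exact hfν.trans_lt ENNReal.one_lt_top
  have hexp1 : ∫ x, Real.exp (f x) ∂ν ≤ 1 := by
    rw [integral_eq_lintegral_of_nonneg_ae (ae_of_all _ fun x => (Real.exp_pos _).le) (by fun_prop)]
    exact ENNReal.toReal_le_of_le_ofReal zero_le_one (by simpa using hfν)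
  have := isProbabilityMeasure_tilted hexp
  have h1 := InformationTheory.integral_llr_add_sub_measure_univ_nonneg
    (hac.trans (absolutelyContinuous_tilted hexp))
    (integrable_llr_tilted_right hac hfμ hint hexp)
  rw [integral_llr_tilted_right hac hfμ hexp hint] at h1
  have h2 := Real.log_nonpos (integral_nonneg fun x => (Real.exp_pos (f x)).le) hexp1
  rw [InformationTheory.klDiv_of_ac_of_integrable hac hint]
  refine ENNReal.ofReal_le_ofReal ?_
  simp only [probReal_univ, add_sub_cancel_right] at h1 ⊢
  linarith

variable {p q : ℕ} {A : Matrix (Fin p) (Fin p) ℝ} {B : Matrix (Fin p) (Fin q) ℝ}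
  {S₀ P : Matrix (Fin p) (Fin p) ℝ} {Q : TestChannel p}

/-- The logarithm of the density of a reference posterior law of the source path `x_m, …, x_n` given
reproductions `z_m, …, z_n` with respect to the law of the source: `x_m` has reference posterior
`N(z_m, P)` and prior `N(0, S)`, and `x_{t+1}` has `N(z_{t+1}, P)` and `N(A z_t, L)`. The path starts
at a time `m` because the law of `x_0` may be singular. -/
noncomputable def logPosterior (A P L S : Matrix (Fin p) (Fin p) ℝ) (m n : ℕ) (z x : ℕ → Vec p) :
    ℝ :=
  logRatio P S (z m) 0 (x m) + ∑ t ∈ Finset.Ico m n,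
    logRatio P L (z (t + 1)) (Matrix.toEuclideanLin A (z t)) (x (t + 1))

lemma lintegral_resampleSource {G : Sample p q → ℝ≥0∞} (hG : Measurable G) (t : ℕ) :
    ∫⁻ ω, G ω ∂law q S₀ Q = ∫⁻ ω, ∫⁻ a, G (resampleSource t (ω, a))
      ∂multivariateGaussian (0 : Vec q) 1 ∂law q S₀ Q := by
  have h := measurePreserving_resampleSource (q := q) S₀ Q t
  conv_lhs => rw [← h.map_eq]
  rw [lintegral_map hG h.measurable]
  exact lintegral_prod _ (hG.comp h.measurable).aemeasurable

lemma lintegral_gaussian_shift {n : ℕ} {S : Matrix (Fin n) (Fin n) ℝ} {g : Vec n → ℝ≥0∞}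
    (hg : Measurable g) (a : Vec n) :
    ∫⁻ x, g x ∂multivariateGaussian a S = ∫⁻ x, g (x + a) ∂multivariateGaussian 0 S := by
  have h := map_add_right_gaussian S a 0
  rw [add_zero] at h
  rw [← h, lintegral_map hg (by fun_prop)]

lemma lintegral_logRatio_mul {n : ℕ} {P L : Matrix (Fin n) (Fin n) ℝ} (hP : P.PosDef)
    (hL : L.PosDef) (a b : Vec n) {g : Vec n → ℝ≥0∞} (hg : Measurable g) :
    ∫⁻ x, g x * ENNReal.ofReal (Real.exp (logRatio P L a b x)) ∂multivariateGaussian b L =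
      ∫⁻ x, g x ∂multivariateGaussian a P := by
  have hc := (continuous_logRatio P L).measurable
  have hm : Measurable fun x => ENNReal.ofReal (Real.exp (logRatio P L a b x)) :=
    (Real.measurable_exp.comp (hc.comp (by fun_prop : Measurable fun x : Vec n =>
      (a, b, x)))).ennreal_ofReal
  rw [← gaussian_withDensity_logRatio hP hL a b, lintegral_withDensity_eq_lintegral_mul _ hm hg]
  simp only [Pi.mul_apply, mul_comm]

lemma measurable_logRatio {α : Type*} [MeasurableSpace α] {n : ℕ} (P L : Matrix (Fin n) (Fin n) ℝ)
    {a b x : α → Vec n} (ha : Measurable a) (hb : Measurable b) (hx : Measurable x) :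
    Measurable fun ω => logRatio P L (a ω) (b ω) (x ω) :=
  (continuous_logRatio P L).measurable.comp (ha.prodMk (hb.prodMk hx))

lemma measurable_logPosterior {α : Type*} [MeasurableSpace α] (L S : Matrix (Fin p) (Fin p) ℝ)
    (m n : ℕ) {z x : ℕ → α → Vec p} (hz : ∀ t, Measurable (z t)) (hx : ∀ t, Measurable (x t)) :
    Measurable fun ω => logPosterior A P L S m n (fun t => z t ω) (fun t => x t ω) := by
  unfold logPosterior
  refine (measurable_logRatio _ _ (hz m) measurable_const (hx m)).add ?_
  refine Finset.measurable_sum _ fun t _ => measurable_logRatio _ _ (hz _) ?_ (hx _)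
  exact (measurable_toEuclideanLin A).comp (hz t)

/-- For fixed reproductions, `exp logPosterior` is a probability density with respect to the law of
the source, under which `x_n` has the law `N(z_n, P)`. -/
lemma lintegral_mul_exp_logPosterior (hP : P.PosDef) (hL : P ≤ predCov A B P) (hS₀ : 0 ≤ S₀)
    (z : ℕ → Vec p) {m : ℕ} (hm : ((fun X => predCov A B X)^[m] S₀).PosDef) {n : ℕ} (hmn : m ≤ n) :
    ∀ {φ : Vec p → ℝ≥0∞}, Measurable φ →
    ∫⁻ ω, φ (source A B n ω) * ENNReal.ofReal (Real.exp (logPosterior A P (predCov A B P)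
        ((fun X => predCov A B X)^[m] S₀) m n z fun t => source A B t ω)) ∂law q S₀ Q =
      ∫⁻ x, φ x ∂multivariateGaussian (z n) P := by
  have hLP := predCov_posDef hP hL
  induction n, hmn using Nat.le_induction with
  | base =>
    intro φ hφ
    have hg : Measurable fun x : Vec p => φ x * ENNReal.ofReal (Real.exp
        (logRatio P ((fun X => predCov A B X)^[m] S₀) (z m) 0 x)) :=
      hφ.mul (Real.measurable_exp.comp
        (measurable_logRatio _ _ measurable_const measurable_const measurable_id)).ennreal_ofReal
    simp only [logPosterior, Finset.Ico_self, Finset.sum_empty, add_zero]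
    rw [← lintegral_map hg (measurable_source m), map_source hS₀,
      lintegral_logRatio_mul hP hm (z m) 0 hφ]
  | succ n hmn ih =>
    intro φ hφ
    set g : Vec p → ℝ≥0∞ := fun x => φ x * ENNReal.ofReal (Real.exp
      (logRatio P (predCov A B P) (z (n + 1)) (Matrix.toEuclideanLin A (z n)) x)) with hg
    have hgm : Measurable g := hφ.mul (Real.measurable_exp.comp
        (measurable_logRatio _ _ measurable_const measurable_const measurable_id)).ennreal_ofReal
    have hpm : Measurable fun ω : Sample p q => ENNReal.ofReal (Real.exp (logPosterior A P
        (predCov A B P) ((fun X => predCov A B X)^[m] S₀) m n z fun t => source A B t ω)) :=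
      (Real.measurable_exp.comp (measurable_logPosterior _ _ m n (fun t => measurable_const)
        fun t => measurable_source t)).ennreal_ofReal
    set ψ : Vec p → ℝ≥0∞ := fun x => ∫⁻ a, g (Matrix.toEuclideanLin A x +
      Matrix.toEuclideanLin B a) ∂multivariateGaussian (0 : Vec q) 1 with hψ
    have hψm : Measurable ψ := by
      refine Measurable.lintegral_prod_right' (f := fun z : Vec p × Vec q =>
        g (Matrix.toEuclideanLin A z.1 + Matrix.toEuclideanLin B z.2)) ?_
      fun_prop
    calc _ = ∫⁻ ω, g (source A B (n + 1) ω) * ENNReal.ofReal (Real.exp (logPosterior A P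
          (predCov A B P) ((fun X => predCov A B X)^[m] S₀) m n z fun t => source A B t ω))
          ∂law q S₀ Q := by
          refine lintegral_congr fun ω => ?_
          rw [hg]
          simp only
          rw [mul_assoc, ← ENNReal.ofReal_mul (Real.exp_pos _).le, ← Real.exp_add]
          congr 3
          rw [logPosterior, Finset.sum_Ico_succ_top hmn, logPosterior]
          ring
      _ = ∫⁻ ω, ψ (source A B n ω) * ENNReal.ofReal (Real.exp (logPosterior A P
          (predCov A B P) ((fun X => predCov A B X)^[m] S₀) m n z fun t => source A B t ω))
          ∂law q S₀ Q := by
          have hGm : Measurable fun ω : Sample p q => g (source A B (n + 1) ω) *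
              ENNReal.ofReal (Real.exp (logPosterior A P (predCov A B P)
                ((fun X => predCov A B X)^[m] S₀) m n z fun t => source A B t ω)) :=
            (hgm.comp (measurable_source (n + 1))).mul hpm
          rw [lintegral_resampleSource hGm n]
          refine lintegral_congr fun ω => ?_
          have e1 : ∀ a : Vec q, source A B (n + 1) (resampleSource n (ω, a)) =
              Matrix.toEuclideanLin A (source A B n ω) + Matrix.toEuclideanLin B a := fun a => by
            have := source_resampleSource (A := A) (B := B) (le_refl n) (ω, a)
            rw [source, this]
            simp [resampleSource]
          have e2 : ∀ a : Vec q, logPosterior A P (predCov A B P)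
              ((fun X => predCov A B X)^[m] S₀) m n z
                (fun t => source A B t (resampleSource n (ω, a))) =
              logPosterior A P (predCov A B P) ((fun X => predCov A B X)^[m] S₀) m n z
                (fun t => source A B t ω) := fun a => by
            simp only [logPosterior]
            rw [source_resampleSource hmn]
            congr 1
            refine Finset.sum_congr rfl fun t ht => ?_
            rw [source_resampleSource (Finset.mem_Ico.1 ht).2]
          simp only [e1, e2]
          rw [lintegral_mul_const _ (by fun_prop)]
      _ = ∫⁻ x, ψ x ∂multivariateGaussian (z n) P := ih hψm
      _ = ∫⁻ x, ∫⁻ a, g ((Matrix.toEuclideanLin A x + Matrix.toEuclideanLin B a) +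
            Matrix.toEuclideanLin A (z n)) ∂multivariateGaussian (0 : Vec q) 1
            ∂multivariateGaussian (0 : Vec p) P := by
          rw [lintegral_gaussian_shift hψm]
          refine lintegral_congr fun x => lintegral_congr fun a => ?_
          rw [map_add]
          congr 1
          abel
      _ = ∫⁻ u, g (u + Matrix.toEuclideanLin A (z n))
            ∂multivariateGaussian (0 : Vec p) (predCov A B P) := by
          have h := map_add_gaussian hP.posSemidef.nonneg
            (Matrix.PosSemidef.one (n := Fin q) (R := ℝ)).nonneg A B
          rw [Matrix.mul_one] at h
          rw [predCov, ← h, lintegral_map (by fun_prop) (by fun_prop),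
            lintegral_prod _ (by fun_prop)]
      _ = ∫⁻ x, φ x ∂multivariateGaussian (z (n + 1)) P := by
          rw [← lintegral_gaussian_shift hgm]
          exact lintegral_logRatio_mul hP hLP _ _ hφ

lemma integrable_logRatio {Ω : Type*} [MeasurableSpace Ω] {μ : Measure Ω} [IsFiniteMeasure μ]
    {n : ℕ} (P L : Matrix (Fin n) (Fin n) ℝ) {a b x : Ω → Vec n}
    (ha : MemLp (fun ω => x ω - a ω) 2 μ) (hb : MemLp (fun ω => x ω - b ω) 2 μ) :
    Integrable (fun ω => logRatio P L (a ω) (b ω) (x ω)) μ := by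
  simp only [logRatio]
  exact ((integrable_const _).sub ((integrable_quad ha _).div_const 2)).add
    ((integrable_quad hb _).div_const 2)

lemma integral_logRatio {Ω : Type*} [MeasurableSpace Ω] {μ : Measure Ω} [IsProbabilityMeasure μ]
    {n : ℕ} (P L : Matrix (Fin n) (Fin n) ℝ) {a b x : Ω → Vec n}
    (ha : MemLp (fun ω => x ω - a ω) 2 μ) (hb : MemLp (fun ω => x ω - b ω) 2 μ) :
    ∫ ω, logRatio P L (a ω) (b ω) (x ω) ∂μ = 1 / 2 * Real.log (L.det / P.det) -
      (P⁻¹ * secondMoment μ fun ω => x ω - a ω).trace / 2 +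
      (L⁻¹ * secondMoment μ fun ω => x ω - b ω).trace / 2 := by
  have h1 := (integrable_quad ha P⁻¹).div_const 2
  have h2 := (integrable_quad hb L⁻¹).div_const 2
  have h3 : Integrable (fun ω => 1 / 2 * Real.log (L.det / P.det) - quad P⁻¹ (x ω - a ω) / 2) μ :=
    (integrable_const _).sub h1
  simp only [logRatio]
  rw [integral_add h3 h2, integral_sub (integrable_const _) h1, integral_const, integral_div,
    integral_div, integral_quad ha, integral_quad hb]
  simp

lemma memLp_of_map_eq_gaussian {Ω : Type*} [MeasurableSpace Ω] {μ : Measure Ω} {n : ℕ}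
    {Z : Ω → Vec n} (hZ : Measurable Z) {S : Matrix (Fin n) (Fin n) ℝ}
    (h : μ.map Z = multivariateGaussian (0 : Vec n) S) : MemLp Z 2 μ :=
  (memLp_id_gaussian S).comp_measurePreserving ⟨hZ, h⟩

lemma secondMoment_of_map_eq_gaussian {Ω : Type*} [MeasurableSpace Ω] {μ : Measure Ω} {n : ℕ}
    {Z : Ω → Vec n} (hZ : Measurable Z) {S : Matrix (Fin n) (Fin n) ℝ} (hS : 0 ≤ S)
    (h : μ.map Z = multivariateGaussian (0 : Vec n) S) : secondMoment μ Z = S := by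
  have h1 := secondMoment_map (μ := μ) hZ (Z := fun x => x) measurable_id
  rw [h, secondMoment_gaussian hS] at h1
  exact h1.symm

lemma memLp_source (hS₀ : 0 ≤ S₀) (t : ℕ) : MemLp (source A B t) 2 (law q S₀ Q) :=
  memLp_of_map_eq_gaussian (measurable_source t) (map_source hS₀ t)

lemma secondMoment_source (hS₀ : 0 ≤ S₀) (t : ℕ) :
    secondMoment (law q S₀ Q) (source A B t) = (fun X => predCov A B X)^[t] S₀ :=
  secondMoment_of_map_eq_gaussian (measurable_source t) (predCov_iterate_nonneg hS₀ t)
    (map_source hS₀ t)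

/-- An estimate of the source from the reproductions `y_0, …, y_t`. -/
noncomputable def estimate (A : Matrix (Fin p) (Fin p) ℝ) (B : Matrix (Fin p) (Fin q) ℝ)
    (Q : TestChannel p) (est : ∀ t : ℕ, (Fin (t + 1) → Vec p) → Vec p) (t : ℕ) (ω : Sample p q) : Vec p :=
  est t fun s => output A B Q s ω

lemma measurable_estimate {est : ∀ t : ℕ, (Fin (t + 1) → Vec p) → Vec p}
    (hest : ∀ t, Measurable (est t)) (t : ℕ) : Measurable (estimate A B Q est t) :=
  (hest t).comp (measurable_pi_iff.2 fun _ => measurable_output _)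

lemma map_sourceNoise (t : ℕ) :
    (law q S₀ Q).map (fun ω => ω.2.1 t) = multivariateGaussian (0 : Vec q) 1 := by
  have h := congrArg (Measure.map Prod.snd) (map_prodMk_sourceNoise (S₀ := S₀) (Q := Q)
    (F := fun _ : Sample p q => ()) measurable_const t fun _ => rfl)
  rw [Measure.map_map (by fun_prop) (by fun_prop), Measure.map_snd_prod] at h
  simpa [Function.comp_def] using h

lemma map_channelNoise (t : ℕ) :
    (law q S₀ Q).map (fun ω => ω.2.2 t) = multivariateGaussian (0 : Vec p) (Q.noiseCov t) := by
  have h := congrArg (Measure.map Prod.snd) (map_prodMk_channelNoise (S₀ := S₀) (Q := Q)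
    (F := fun _ : Sample p q => ()) measurable_const t fun _ => rfl)
  rw [Measure.map_map (by fun_prop) (by fun_prop), Measure.map_snd_prod] at h
  simpa [Function.comp_def] using h

lemma memLp_prediction {est : ∀ t : ℕ, (Fin (t + 1) → Vec p) → Vec p} {t : ℕ}
    (hmem : MemLp (fun ω => source A B t ω - estimate A B Q est t ω) 2 (law q S₀ Q)) :
    MemLp (fun ω => source A B (t + 1) ω - Matrix.toEuclideanLin A (estimate A B Q est t ω)) 2
      (law q S₀ Q) := by
  have hw : MemLp (fun ω : Sample p q => ω.2.1 t) 2 (law q S₀ Q) :=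
    memLp_of_map_eq_gaussian (by fun_prop) (map_sourceNoise t)
  have h := (memLp_toEuclideanLin hmem A).add (memLp_toEuclideanLin hw B)
  convert h using 1
  funext ω
  simp only [Pi.add_apply, source, map_sub]
  abel

lemma secondMoment_prediction {est : ∀ t : ℕ, (Fin (t + 1) → Vec p) → Vec p}
    (hest : ∀ t, Measurable (est t)) {t : ℕ}
    (hmem : MemLp (fun ω => source A B t ω - estimate A B Q est t ω) 2 (law q S₀ Q)) :
    secondMoment (law q S₀ Q)
      (fun ω => source A B (t + 1) ω - Matrix.toEuclideanLin A (estimate A B Q est t ω)) =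
    predCov A B (secondMoment (law q S₀ Q)
      fun ω => source A B t ω - estimate A B Q est t ω) := by
  have hm : Measurable fun ω : Sample p q => source A B t ω - estimate A B Q est t ω :=
    (measurable_source t).sub (measurable_estimate hest t)
  have h := map_prodMk_sourceNoise (S₀ := S₀) (Q := Q) hm t fun z => by
    rw [source_resampleSource le_rfl, estimate, estimate]
    simp only [output]
    congr 2
    funext s
    exact prevOutput_resampleSource (by omega) z
  have e : (fun ω => source A B (t + 1) ω - Matrix.toEuclideanLin A (estimate A B Q est t ω)) =
      (fun z : Vec p × Vec q => Matrix.toEuclideanLin A z.1 + Matrix.toEuclideanLin B z.2) ∘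
        fun ω : Sample p q => (source A B t ω - estimate A B Q est t ω, ω.2.1 t) := by
    funext ω
    simp only [Function.comp_apply, source, map_sub]
    abel
  have : IsProbabilityMeasure ((law q S₀ Q).map
      fun ω => source A B t ω - estimate A B Q est t ω) :=
    Measure.isProbabilityMeasure_map hm.aemeasurable
  rw [e, ← secondMoment_map (by fun_prop) (by fun_prop), h,
    secondMoment_add ((memLp_map_measure_iff (by fun_prop) hm.aemeasurable).2 hmem)
      Matrix.PosSemidef.one.nonneg, secondMoment_map hm (by fun_prop), Matrix.mul_one]
  rfl

lemma logPosterior_congr {L S : Matrix (Fin p) (Fin p) ℝ} {m n : ℕ} (hmn : m ≤ n)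
    {z z' x x' : ℕ → Vec p} (hz : ∀ t ≤ n, z t = z' t) (hx : ∀ t ≤ n, x t = x' t) :
    logPosterior A P L S m n z x = logPosterior A P L S m n z' x' := by
  rw [logPosterior, logPosterior, hz m hmn, hx m hmn]
  congr 1
  refine Finset.sum_congr rfl fun t ht => ?_
  have := (Finset.mem_Ico.1 ht).2
  rw [hz t (by omega), hz (t + 1) (by omega), hx (t + 1) (by omega)]

/-- Every estimate of the source from the reproductions gives a lower bound of the information, in
terms of the covariances of the estimation errors. -/
lemma ofReal_le_mutualInformation (hP : P.PosDef) (hL : P ≤ predCov A B P) (hS₀ : 0 ≤ S₀)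
    {m n : ℕ} (hmn : m ≤ n) (hm : ((fun X => predCov A B X)^[m] S₀).PosDef)
    {est : ∀ t : ℕ, (Fin (t + 1) → Vec p) → Vec p} (hest : ∀ t, Measurable (est t))
    (hmem : ∀ t, MemLp (fun ω => source A B t ω - estimate A B Q est t ω) 2 (law q S₀ Q))
    {S : ℕ → Matrix (Fin p) (Fin p) ℝ} (hS : ∀ t, secondMoment (law q S₀ Q)
      (fun ω => source A B t ω - estimate A B Q est t ω) = S t) :
    ENNReal.ofReal (1 / 2 * Real.log (((fun X => predCov A B X)^[m] S₀).det / P.det) -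
      (P⁻¹ * S m).trace / 2 + p / 2 + ∑ t ∈ Finset.Ico m n, (objective A B P -
        (P⁻¹ * S (t + 1)).trace / 2 + ((predCov A B P)⁻¹ * predCov A B (S t)).trace / 2)) ≤
    mutualInformation (law q S₀ Q) (fun ω (t : Fin (n + 1)) => source A B t ω)
      (fun ω (t : Fin (n + 1)) => output A B Q t ω) := by
  set Sm := (fun X => predCov A B X)^[m] S₀ with hSm
  set X : Sample p q → Fin (n + 1) → Vec p := fun ω t => source A B t ω with hX
  set Y : Sample p q → Fin (n + 1) → Vec p := fun ω t => output A B Q t ω with hY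
  have hXm : Measurable X := measurable_pi_iff.2 fun _ => measurable_source _
  have hYm : Measurable Y := measurable_pi_iff.2 fun _ => measurable_output _
  -- `Fin.ofNat` extends finite paths to `ℕ`; only the indices up to `n` matter
  set f : (Fin (n + 1) → Vec p) × (Fin (n + 1) → Vec p) → ℝ := fun u =>
    logPosterior A P (predCov A B P) Sm m n
      (fun t => est t fun s => u.2 (Fin.ofNat (n + 1) s)) (fun t => u.1 (Fin.ofNat (n + 1) t))
    with hf
  have hfm : Measurable f := measurable_logPosterior _ _ m n
    (z := fun t (u : (Fin (n + 1) → Vec p) × (Fin (n + 1) → Vec p)) =>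
      est t fun s => u.2 (Fin.ofNat (n + 1) s))
    (x := fun t (u : (Fin (n + 1) → Vec p) × (Fin (n + 1) → Vec p)) => u.1 (Fin.ofNat (n + 1) t))
    (fun t => (hest t).comp (by fun_prop)) (fun t => by fun_prop)
  have hmod : ∀ t, t ≤ n → ((Fin.ofNat (n + 1) t : Fin (n + 1)) : ℕ) = t := fun t ht => by
    rw [Fin.val_ofNat, Nat.mod_eq_of_lt (by omega)]
  have hfX : ∀ ω y, f (X ω, y) = logPosterior A P (predCov A B P) Sm m n
      (fun t => est t fun s => y (Fin.ofNat (n + 1) s)) (fun t => source A B t ω) := fun ω y =>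
    logPosterior_congr hmn (fun _ _ => rfl) fun t ht => by rw [hX]; simp only [hmod t ht]
  have hfXY : ∀ ω, f (X ω, Y ω) = logPosterior A P (predCov A B P) Sm m n
      (fun t => estimate A B Q est t ω) (fun t => source A B t ω) := fun ω => by
    rw [hfX]
    refine logPosterior_congr hmn (fun t ht => ?_) fun _ _ => rfl
    rw [estimate, hY]
    congr 1
    funext s
    simp only [hmod s (by omega)]
  have : IsProbabilityMeasure ((law q S₀ Q).map X) :=
    Measure.isProbabilityMeasure_map hXm.aemeasurable
  have : IsProbabilityMeasure ((law q S₀ Q).map Y) :=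
    Measure.isProbabilityMeasure_map hYm.aemeasurable
  have : IsProbabilityMeasure ((law q S₀ Q).map fun ω => (X ω, Y ω)) :=
    Measure.isProbabilityMeasure_map (hXm.prodMk hYm).aemeasurable
  have hexp : ∫⁻ u, ENNReal.ofReal (Real.exp (f u))
      ∂(((law q S₀ Q).map X).prod ((law q S₀ Q).map Y)) ≤ 1 := by
    have hem : Measurable fun u => ENNReal.ofReal (Real.exp (f u)) := by fun_prop
    rw [lintegral_prod_symm _ hem.aemeasurable]
    refine (lintegral_congr fun y => ?_).trans_le (lintegral_const (1 : ℝ≥0∞)).le |>.trans (by simp)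
    have hemy : Measurable fun x => ENNReal.ofReal (Real.exp (f (x, y))) :=
      hem.comp (by fun_prop : Measurable fun x => (x, y))
    rw [lintegral_map hemy hXm]
    simp only [hfX]
    simpa using lintegral_mul_exp_logPosterior (Q := Q) hP hL hS₀
      (fun t => est t fun s => y (Fin.ofNat (n + 1) s)) hm hmn (φ := fun _ => 1) measurable_const
  have hint0 := integrable_logRatio P Sm (hmem m) (b := fun _ => 0)
    (by simpa using memLp_source (Q := Q) hS₀ m)
  have hint : ∀ t, Integrable (fun ω => logRatio P (predCov A B P)
      (estimate A B Q est (t + 1) ω) (Matrix.toEuclideanLin A (estimate A B Q est t ω))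
      (source A B (t + 1) ω)) (law q S₀ Q) := fun t =>
    integrable_logRatio P _ (hmem (t + 1)) (memLp_prediction (hmem t))
  have hintf : Integrable (fun ω => f (X ω, Y ω)) (law q S₀ Q) := by
    simp only [hfXY, logPosterior]
    exact hint0.add (integrable_finsetSum _ fun t _ => hint t)
  refine le_trans (ENNReal.ofReal_le_ofReal (le_of_eq ?_)) (ofReal_integral_le_klDiv hfm
    ((integrable_map_measure (by fun_prop) (by fun_prop)).2 hintf) hexp)
  rw [integral_map (by fun_prop) (by fun_prop)]
  simp only [hfXY, logPosterior]
  rw [integral_add hint0 (integrable_finsetSum _ fun t _ => hint t),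
    integral_finsetSum _ fun t _ => hint t, integral_logRatio P Sm (hmem m)
      (by simpa using memLp_source (Q := Q) hS₀ m)]
  congr 1
  · rw [hS]
    simp only [sub_zero]
    rw [secondMoment_source hS₀, Matrix.nonsing_inv_mul _ (det_ne_zero_of_posDef hm)]
    simp
  · refine Finset.sum_congr rfl fun t _ => ?_
    rw [integral_logRatio P _ (hmem (t + 1)) (memLp_prediction (hmem t)),
      secondMoment_prediction hest (hmem t), hS, hS, objective]

end LowerBound

/-! ### Optimality of the conditional mean -/

section ConditionalMean

open scoped MatrixOrder RealInnerProductSpace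

variable {Ω : Type*} {m m₀ : MeasurableSpace Ω} {μ : Measure[m₀] Ω} [IsProbabilityMeasure μ]

lemma integral_sub_condExp_sq_le (hm : m ≤ m₀) {X Z : Ω → ℝ} (hX : MemLp X 2 μ)
    (hZ : MemLp Z 2 μ) (hZm : StronglyMeasurable[m] Z) :
    ∫ ω, (X ω - (μ[X | m]) ω) ^ 2 ∂μ ≤ ∫ ω, (X ω - Z ω) ^ 2 ∂μ := by
  have hXZ := hX.sub hZ
  have h1 : ∫ ω, (Var[X - Z; μ | m]) ω ∂μ ≤ ∫ ω, (μ[(X - Z) ^ 2 | m]) ω ∂μ :=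
    integral_mono_ae integrable_condVar integrable_condExp (condVar_ae_le_condExp_sq hm hXZ)
  rw [condVar, integral_condExp hm, integral_condExp hm] at h1
  refine le_trans (le_of_eq (integral_congr_ae ?_)) h1
  filter_upwards [condExp_sub (m := m) (hX.integrable one_le_two) (hZ.integrable one_le_two)]
    with ω hω
  simp only [Pi.pow_apply, Pi.sub_apply, hω,
    condExp_of_stronglyMeasurable hm hZm (hZ.integrable one_le_two)]
  ring

lemma secondMoment_sub_condExp_le (hm : m ≤ m₀) {n : ℕ} {X Z : Ω → Vec n} (hX : MemLp X 2 μ)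
    (hZ : MemLp Z 2 μ) (hZm : StronglyMeasurable[m] Z) :
    secondMoment μ (fun ω => X ω - (μ[X | m]) ω) ≤ secondMoment μ (fun ω => X ω - Z ω) := by
  refine le_of_forall_quad_le (transpose_secondMoment _) (transpose_secondMoment _) fun u => ?_
  have hd : MemLp (fun ω => X ω - (μ[X | m]) ω) 2 μ := hX.sub (hX.condExp one_le_two)
  have hd' : MemLp (fun ω => X ω - Z ω) 2 μ := hX.sub hZ
  rw [quad_secondMoment hd, quad_secondMoment hd']
  have h1 := (innerSL ℝ u).comp_condExp_comm (m := m) (hX.integrable one_le_two)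
  have h2 := integral_sub_condExp_sq_le hm ((innerSL ℝ u).comp_memLp' hX)
    ((innerSL ℝ u).comp_memLp' hZ) ((innerSL ℝ u).continuous.comp_stronglyMeasurable hZm)
  refine le_trans (le_of_eq (integral_congr_ae ?_)) (h2.trans (le_of_eq ?_))
  · filter_upwards [h1] with ω hω
    rw [← hω]
    simp [inner_sub_right]
  · simp [inner_sub_right]

end ConditionalMean

/-! ### The converse -/

section Converse

open scoped MatrixOrder

variable {p q : ℕ} {A : Matrix (Fin p) (Fin p) ℝ} {B : Matrix (Fin p) (Fin q) ℝ}
  {S₀ P : Matrix (Fin p) (Fin p) ℝ} {Q : TestChannel p} {D : ℝ≥0∞}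

lemma memLp_prevOutput (hS₀ : 0 ≤ S₀) (t : ℕ) : MemLp (prevOutput A B Q t) 2 (law q S₀ Q) := by
  induction t with
  | zero => exact MemLp.zero
  | succ t ih =>
    exact ((memLp_toEuclideanLin (memLp_source hS₀ t) _).add (memLp_toEuclideanLin ih _)).add
      (memLp_of_map_eq_gaussian (by fun_prop) (map_channelNoise t))

lemma pastOutputs_le (k : ℕ) :
    pastOutputs A B Q k ≤ (inferInstance : MeasurableSpace (Sample p q)) :=
  Measurable.comap_le (measurable_pi_iff.2 fun _ => measurable_output _)

lemma measurable_output_pastOutputs {s k : ℕ} (h : s < k) :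
    Measurable[pastOutputs A B Q k] (output A B Q s) := by
  have h0 : Measurable[pastOutputs A B Q k] fun ω (s : Fin k) => output A B Q s ω :=
    comap_measurable _
  exact (measurable_pi_apply (⟨s, h⟩ : Fin k)).comp h0

lemma measurable_estimate_pastOutputs {est : ∀ t : ℕ, (Fin (t + 1) → Vec p) → Vec p}
    (hest : ∀ t, Measurable (est t)) {t k : ℕ} (h : t < k) :
    Measurable[pastOutputs A B Q k] (estimate A B Q est t) := by
  have h0 : Measurable[pastOutputs A B Q k] fun ω (s : Fin k) => output A B Q s ω :=
    comap_measurable _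
  have h1 : Measurable fun (y : Fin k → Vec p) (s : Fin (t + 1)) => y ⟨s, by omega⟩ := by fun_prop
  exact ((hest t).comp h1).comp h0

/-- The conditional means of the source are estimates whose error covariances grow at most by the
prediction step, and are at most those of the reproduction. -/
lemma exists_estimate (hS₀ : 0 ≤ S₀) :
    ∃ (est : ∀ t : ℕ, (Fin (t + 1) → Vec p) → Vec p) (S : ℕ → Matrix (Fin p) (Fin p) ℝ),
      (∀ t, Measurable (est t)) ∧
      (∀ t, MemLp (fun ω => source A B t ω - estimate A B Q est t ω) 2 (law q S₀ Q)) ∧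
      (∀ t, secondMoment (law q S₀ Q)
        (fun ω => source A B t ω - estimate A B Q est t ω) = S t) ∧
      S 0 ≤ S₀ ∧ (∀ t, 0 ≤ S t) ∧ (∀ t, S (t + 1) ≤ predCov A B (S t)) ∧
      ∀ t, ENNReal.ofReal (S t).trace ≤
        ∫⁻ ω, ‖source A B t ω - output A B Q t ω‖ₑ ^ 2 ∂law q S₀ Q := by
  have hex : ∀ t, ∃ e : (Fin (t + 1) → Vec p) → Vec p, Measurable e ∧
      (law q S₀ Q)[source A B t | pastOutputs A B Q (t + 1)] =
        fun ω => e fun s => output A B Q s ω := fun t => by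
    obtain ⟨e, he, h⟩ := (stronglyMeasurable_condExp (μ := law q S₀ Q) (f := source A B t)
      (m := pastOutputs A B Q (t + 1))).exists_eq_measurable_comp
    exact ⟨e, he.measurable, h⟩
  choose est hest hcond using hex
  have hcond' : ∀ t, (law q S₀ Q)[source A B t | pastOutputs A B Q (t + 1)] =
      estimate A B Q est t := hcond
  have hmemE : ∀ t, MemLp (estimate A B Q est t) 2 (law q S₀ Q) := fun t => by
    rw [← hcond']
    exact (memLp_source hS₀ t).condExp one_le_two
  have hmem : ∀ t, MemLp (fun ω => source A B t ω - estimate A B Q est t ω) 2 (law q S₀ Q) :=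
    fun t => (memLp_source hS₀ t).sub (hmemE t)
  have hopt : ∀ t (Z : Sample p q → Vec p), MemLp Z 2 (law q S₀ Q) →
      Measurable[pastOutputs A B Q (t + 1)] Z →
      secondMoment (law q S₀ Q) (fun ω => source A B t ω - estimate A B Q est t ω) ≤
        secondMoment (law q S₀ Q) (fun ω => source A B t ω - Z ω) := fun t Z hZ hZm => by
    rw [← hcond']
    exact secondMoment_sub_condExp_le (pastOutputs_le _) (memLp_source hS₀ t) hZ
      hZm.stronglyMeasurable
  refine ⟨est, _, hest, hmem, fun t => rfl, ?_, fun t => secondMoment_nonneg (hmem t), fun t => ?_,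
    fun t => ?_⟩
  · refine (hopt 0 (fun _ => 0) MemLp.zero measurable_const).trans (le_of_eq ?_)
    simp only [sub_zero]
    exact secondMoment_source hS₀ 0
  · rw [← secondMoment_prediction hest (hmem t)]
    exact hopt (t + 1) _ (memLp_toEuclideanLin (hmemE t) A)
      ((measurable_toEuclideanLin A).comp (measurable_estimate_pastOutputs hest (by omega)))
  · have hout : MemLp (output A B Q t) 2 (law q S₀ Q) := memLp_prevOutput hS₀ (t + 1)
    have hd : MemLp (fun ω => source A B t ω - output A B Q t ω) 2 (law q S₀ Q) :=
      (memLp_source hS₀ t).sub hout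
    rw [lintegral_enorm_sq hd]
    exact ENNReal.ofReal_le_ofReal (trace_mono (hopt t _ hout
      (measurable_output_pastOutputs (by omega))))

/-- The error covariances are bounded uniformly over all channels, like those of the source. -/
lemma exists_forall_le (hA : Tendsto (fun j => A ^ j) atTop (𝓝 0)) (B : Matrix (Fin p) (Fin q) ℝ)
    (hS₀ : 0 ≤ S₀) : ∃ C : Matrix (Fin p) (Fin p) ℝ, ∀ S : ℕ → Matrix (Fin p) (Fin p) ℝ,
      S 0 ≤ S₀ → (∀ t, S (t + 1) ≤ predCov A B (S t)) → ∀ t, S t ≤ C := by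
  obtain ⟨Z, hZ0, hZ⟩ := exists_lyapunov hA
  obtain ⟨b, hb, hbB⟩ := exists_le_smul_one
    (transpose_eq_of_nonneg (add_nonneg (mul_transpose_self_nonneg B) hS₀))
  refine ⟨b • Z, fun S h0 hS t => ?_⟩
  induction t with
  | zero =>
    have h1 : (1 : Matrix (Fin p) (Fin p) ℝ) ≤ Z :=
      (le_add_of_nonneg_left (conj_nonneg hZ0 A)).trans hZ
    exact h0.trans (((le_add_of_nonneg_left (mul_transpose_self_nonneg B)).trans hbB).trans
      (smul_le_smul_of_le hb.le h1))
  | succ t ih =>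
    refine (hS t).trans ((predCov_mono ih).trans ?_)
    have h1 := smul_le_smul_of_le hb.le hZ
    rw [smul_add, ← conj_smul] at h1
    exact (add_le_add_right ((le_add_of_nonneg_right hS₀).trans hbB) _).trans h1

lemma slope_add (P X Y : Matrix (Fin p) (Fin p) ℝ) :
    slope A B P (X + Y) = slope A B P X + slope A B P Y := by
  simp only [slope, Matrix.mul_add, Matrix.add_mul, Matrix.trace_add]
  ring

lemma slope_smul (P X : Matrix (Fin p) (Fin p) ℝ) (c : ℝ) :
    slope A B P (c • X) = c * slope A B P X := by
  simp only [slope, Matrix.mul_smul, Matrix.smul_mul, Matrix.trace_smul, smul_eq_mul]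
  ring

lemma slope_self (hP : P.PosDef) (hL : P ≤ predCov A B P) :
    slope A B P P = -((predCov A B P)⁻¹ * (B * Bᵀ)).trace := by
  have h : A * P * Aᵀ = predCov A B P - B * Bᵀ := by rw [predCov, add_sub_cancel_right]
  rw [slope, h, Matrix.mul_sub, Matrix.trace_sub,
    Matrix.nonsing_inv_mul _ (det_ne_zero_of_posDef (predCov_posDef hP hL)),
    Matrix.nonsing_inv_mul _ (det_ne_zero_of_posDef hP)]
  ring

/-- The summed lower bound is, up to boundary terms, affine in the sum of the covariances. -/
lemma sum_rate_eq (P : Matrix (Fin p) (Fin p) ℝ) (S : ℕ → Matrix (Fin p) (Fin p) ℝ) (R : ℝ)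
    {m n : ℕ} (hmn : m ≤ n) :
    -(P⁻¹ * S m).trace / 2 + ∑ t ∈ Finset.Ico m n, (R -
      (P⁻¹ * S (t + 1)).trace / 2 + ((predCov A B P)⁻¹ * predCov A B (S t)).trace / 2) =
    ((n : ℝ) - m) * (R + ((predCov A B P)⁻¹ * (B * Bᵀ)).trace / 2) +
      slope A B P (∑ t ∈ Finset.Ico m (n + 1), S t) / 2 -
      ((predCov A B P)⁻¹ * (A * S n * Aᵀ)).trace / 2 := by
  induction n, hmn using Nat.le_induction with
  | base =>
    simp [slope]
    ring
  | succ n hmn ih =>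
    rw [Finset.sum_Ico_succ_top hmn, ← add_assoc, ih,
      Finset.sum_Ico_succ_top (show m ≤ n + 1 by omega), slope_add, predCov.eq_1 A B (S n),
      Matrix.mul_add, Matrix.trace_add, slope.eq_1 A B P (S (n + 1))]
    push_cast
    ring

/-- The sum of the error covariances satisfies the constraint up to boundary terms. -/
lemma sum_Ico_le {S : ℕ → Matrix (Fin p) (Fin p) ℝ} (hS : ∀ t, S (t + 1) ≤ predCov A B (S t))
    {m n : ℕ} (hmn : m ≤ n) :
    ∑ t ∈ Finset.Ico m (n + 1), S t + A * S n * Aᵀ ≤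
      S m + A * (∑ t ∈ Finset.Ico m (n + 1), S t) * Aᵀ + ((n : ℝ) - m) • (B * Bᵀ) := by
  induction n, hmn using Nat.le_induction with
  | base => simp
  | succ n hmn ih =>
    rw [Finset.sum_Ico_succ_top (show m ≤ n + 1 by omega)]
    have h1 := add_le_add ih (hS n)
    rw [predCov] at h1
    have e : ((n + 1 : ℕ) : ℝ) - m = ((n : ℝ) - m) + 1 := by push_cast; ring
    rw [e, add_smul, one_smul, Matrix.mul_add, Matrix.add_mul]
    rw [← sub_nonneg] at h1 ⊢
    convert h1 using 1
    abel

/-- The asymptotic form of the lower bound. The averaged error covariance nearly satisfies the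
constraints of the asymptotic problem, so the first order condition at the minimizer `P` applies to
it. -/
lemma exists_le_sum_rate (hA : Tendsto (fun j => A ^ j) atTop (𝓝 0)) (hP : P ∈ feasibleSet A B D)
    (hmin : ∀ Y ∈ feasibleSet A B D, objective A B P ≤ objective A B Y) (hS₀ : 0 ≤ S₀)
    {ε : ℝ} (hε : 0 < ε) (m : ℕ) (c : ℝ) :
    ∃ δ > 0, ∃ N : ℕ, ∀ n ≥ N, m ≤ n ∧ ∀ S : ℕ → Matrix (Fin p) (Fin p) ℝ, S 0 ≤ S₀ →
      (∀ t, 0 ≤ S t) → (∀ t, S (t + 1) ≤ predCov A B (S t)) →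
      ENNReal.ofReal ((∑ t ∈ Finset.range (n + 1), (S t).trace) / (n + 1)) ≤
        D + ENNReal.ofReal δ →
      objective A B P - ε ≤ (c - (P⁻¹ * S m).trace / 2 + p / 2 + ∑ t ∈ Finset.Ico m n,
        (objective A B P - (P⁻¹ * S (t + 1)).trace / 2 +
          ((predCov A B P)⁻¹ * predCov A B (S t)).trace / 2)) / (n + 1) := by
  obtain ⟨hPd, hPL, hPD⟩ := hP
  have hL : P ≤ predCov A B P := hPL
  have hLinv : 0 ≤ (predCov A B P)⁻¹ := (predCov_posDef hPd hL).inv.posSemidef.nonneg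
  obtain ⟨C, hC⟩ := exists_forall_le hA B hS₀
  obtain ⟨δ, hδ, hslope⟩ := exists_slope_ge hA ⟨hPd, hPL, hPD⟩ hmin hε
  set β := ((predCov A B P)⁻¹ * (B * Bᵀ)).trace with hβ
  set k := ((predCov A B P)⁻¹ * (A * C * Aᵀ)).trace with hk
  set R := objective A B P with hR
  -- `K` collects the boundary terms; it does not depend on the channel
  set K := c + p / 2 - k / 2 - (m + 1) * (R + β / 2) with hK
  obtain ⟨b, hb, hCb⟩ : ∃ b : ℝ, 0 < b ∧ ∀ S : ℕ → Matrix (Fin p) (Fin p) ℝ, S 0 ≤ S₀ →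
      (∀ t, 0 ≤ S t) → (∀ t, S (t + 1) ≤ predCov A B (S t)) → ∀ t, S t ≤ b • 1 := by
    by_cases hC0 : 0 ≤ C
    · obtain ⟨b, hb, h⟩ := exists_le_smul_one (transpose_eq_of_nonneg hC0)
      exact ⟨b, hb, fun S h0 _ h1 t => (hC S h0 h1 t).trans h⟩
    · exact ⟨1, one_pos, fun S h0 h2 h1 t => absurd ((h2 t).trans (hC S h0 h1 t)) hC0⟩
  obtain ⟨N₁, hN₁⟩ := exists_nat_ge (b / δ)
  obtain ⟨N₂, hN₂⟩ := exists_nat_ge (2 * |K| / ε)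
  refine ⟨δ, hδ, max m (max N₁ N₂), fun n hn => ?_⟩
  have hmn : m ≤ n := (le_max_left _ _).trans hn
  refine ⟨hmn, fun S h0 hS hrec hD => ?_⟩
  have hn₁ : b / δ ≤ n := hN₁.trans (by exact_mod_cast (by omega : N₁ ≤ n))
  have hn₂ : 2 * |K| / ε ≤ n := hN₂.trans (by exact_mod_cast (by omega : N₂ ≤ n))
  have hn0 : (0 : ℝ) < (n : ℝ) + 1 := by positivity
  set T := ∑ t ∈ Finset.Ico m (n + 1), S t with hT
  set X := ((n : ℝ) + 1)⁻¹ • T with hX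
  have hX0 : 0 ≤ X := by
    have := smul_le_smul_of_le (inv_nonneg.2 hn0.le)
      (Finset.sum_nonneg fun t (_ : t ∈ Finset.Ico m (n + 1)) => hS t)
    rwa [smul_zero] at this
  have hXL : X ≤ predCov A B X + δ • 1 := by
    have h1 : T ≤ b • 1 + A * T * Aᵀ + ((n : ℝ) + 1) • (B * Bᵀ) := by
      have h2 := sum_Ico_le hrec hmn
      have h3 : ((n : ℝ) - m) • (B * Bᵀ) ≤ ((n : ℝ) + 1) • (B * Bᵀ) :=
        smul_le_smul_of_nonneg (mul_transpose_self_nonneg B) (by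
          have : (0 : ℝ) ≤ m := Nat.cast_nonneg m
          linarith)
      refine (le_add_of_nonneg_right (conj_nonneg (hS n) A)).trans (h2.trans ?_)
      exact add_le_add (add_le_add_left (hCb S h0 hS hrec m) _) h3
    have h4 := smul_le_smul_of_le (inv_nonneg.2 hn0.le) h1
    rw [smul_add, smul_add, smul_smul, smul_smul, inv_mul_cancel₀ hn0.ne', one_smul,
      ← conj_smul, ← hX] at h4
    refine h4.trans ?_
    rw [add_assoc, add_comm]
    refine add_le_add_right (smul_one_mono ?_) _
    rw [inv_mul_le_iff₀ hn0]
    rw [div_le_iff₀ hδ] at hn₁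
    nlinarith
  have hXD : ENNReal.ofReal X.trace ≤ D + ENNReal.ofReal δ := by
    refine le_trans (ENNReal.ofReal_le_ofReal ?_) hD
    rw [hX, Matrix.trace_smul, smul_eq_mul, inv_mul_eq_div, hT, Matrix.trace_sum]
    gcongr
    · intro t _ _
      simpa using trace_mono (hS t)
    · intro t ht
      simp only [Finset.mem_Ico, Finset.mem_range] at ht ⊢
      exact ht.2
  have hs := hslope X hX0 hXL hXD
  have hsX : slope A B P (X - P) = slope A B P X + β := by
    rw [sub_eq_add_neg, slope_add, ← neg_one_smul ℝ P, slope_smul P P, slope_self hPd hL]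
    ring
  have hTX : slope A B P T = (n + 1) * slope A B P X := by
    rw [hX, slope_smul, mul_inv_cancel_left₀ hn0.ne']
  have hkn : ((predCov A B P)⁻¹ * (A * S n * Aᵀ)).trace ≤ k :=
    trace_mul_mono hLinv (conj_mono (hC S h0 hrec n) A)
  have hsum := sum_rate_eq (A := A) (B := B) P S R hmn
  rw [← hβ, ← hT, hTX] at hsum
  rw [le_div_iff₀ hn0]
  have hKn : 2 * |K| ≤ n * ε := by rwa [div_le_iff₀ hε] at hn₂
  have hKa := neg_abs_le K
  rw [hsX] at hs
  have h5 : ((n : ℝ) + 1) * (-ε) ≤ (n + 1) * (slope A B P X + β) :=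
    mul_le_mul_of_nonneg_left hs hn0.le
  have : ∀ a b c' d : ℝ, c - a / 2 + b + d = c + b + (-a / 2 + d) := fun a b c' d => by ring
  rw [this _ _ 0, hsum]
  nlinarith

lemma natCast_add_one_eq_ofReal (n : ℕ) : ((n : ℝ≥0∞) + 1) = ENNReal.ofReal ((n : ℝ) + 1) := by
  rw [ENNReal.ofReal_add (by positivity) one_pos.le, ENNReal.ofReal_natCast, ENNReal.ofReal_one]

/-- Channels whose distortion is nearly admissible have a rate of nearly the minimum. -/
lemma exists_le_informationRate (hA : Tendsto (fun j => A ^ j) atTop (𝓝 0))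
    (hP : P ∈ feasibleSet A B D)
    (hmin : ∀ Y ∈ feasibleSet A B D, objective A B P ≤ objective A B Y) (hS₀ : 0 ≤ S₀)
    {ε : ℝ} (hε : 0 < ε) :
    ∃ δ > 0, ∃ N : ℕ, ∀ n ≥ N, ∀ Q : TestChannel p,
      distortion A B S₀ Q n ≤ D + ENNReal.ofReal δ →
      ENNReal.ofReal (objective A B P - ε) ≤ informationRate A B S₀ Q n := by
  have hPd := hP.1
  have hL : P ≤ predCov A B P := hP.2.1
  obtain ⟨m, hm⟩ := exists_gram_posDef hA hPd hL
  -- after `m` steps the law of the source is nonsingular, whatever `S₀`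
  have hm' : ((fun X => predCov A B X)^[m] S₀).PosDef := by
    refine posDef_of_le hm ?_
    rw [← sub_nonneg, gram, predCov_iterate_sub, sub_zero]
    exact conj_nonneg hS₀ _
  obtain ⟨δ, hδ, N, hN⟩ := exists_le_sum_rate hA hP hmin hS₀ hε m
    (1 / 2 * Real.log (((fun X => predCov A B X)^[m] S₀).det / P.det))
  refine ⟨δ, hδ, N, fun n hn Q hQ => ?_⟩
  obtain ⟨hmn, hN⟩ := hN n hn
  obtain ⟨est, S, hest, hmem, hS, h0, hpos, hrec, htr⟩ := exists_estimate (A := A) (B := B)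
    (Q := Q) hS₀
  have hn0 : (0 : ℝ) < (n : ℝ) + 1 := by positivity
  have hdist : ENNReal.ofReal ((∑ t ∈ Finset.range (n + 1), (S t).trace) / (n + 1)) ≤
      D + ENNReal.ofReal δ := by
    refine le_trans ?_ hQ
    rw [ENNReal.ofReal_div_of_pos hn0, distortion, natCast_add_one_eq_ofReal,
      ENNReal.ofReal_sum_of_nonneg fun t _ => by simpa using trace_mono (hpos t)]
    gcongr with t _
    exact htr t
  refine (ENNReal.ofReal_le_ofReal (hN S h0 hpos hrec hdist)).trans ?_
  rw [ENNReal.ofReal_div_of_pos hn0, informationRate, natCast_add_one_eq_ofReal]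
  gcongr
  exact ofReal_le_mutualInformation hPd hL hS₀ hmn hm' hest hmem hS

end Converse

/-! ### An upper bound of the mutual information -/

section InformationUpperBound

/-- The mutual information is at most the divergence from the product of the law of `X` with any
reference law of `Y`, by the chain rule for the divergence with `Y` as the first component. -/
lemma mutualInformation_le {Ω α β : Type*} [MeasurableSpace Ω] [MeasurableSpace α]
    [MeasurableSpace β] [StandardBorelSpace α] [Nonempty α]
    {μ : Measure Ω} [IsProbabilityMeasure μ] {X : Ω → α} {Y : Ω → β} (hX : Measurable X)
    (hY : Measurable Y) (ν : Measure β) [IsProbabilityMeasure ν] {f : α × β → ℝ}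
    (hf : Measurable f)
    (h : μ.map (fun ω => (X ω, Y ω)) =
      ((μ.map X).prod ν).withDensity fun u => ENNReal.ofReal (Real.exp (f u)))
    (hint : Integrable (fun ω => f (X ω, Y ω)) μ) :
    mutualInformation μ X Y ≤ ENNReal.ofReal (∫ ω, f (X ω, Y ω) ∂μ) := by
  have hXp : IsProbabilityMeasure (μ.map X) := Measure.isProbabilityMeasure_map hX.aemeasurable
  have hYp : IsProbabilityMeasure (μ.map Y) := Measure.isProbabilityMeasure_map hY.aemeasurable
  have hXYp : IsProbabilityMeasure (μ.map fun ω => (X ω, Y ω)) :=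
    Measure.isProbabilityMeasure_map (hX.prodMk hY).aemeasurable
  have hYXp : IsProbabilityMeasure (μ.map fun ω => (Y ω, X ω)) :=
    Measure.isProbabilityMeasure_map (hY.prodMk hX).aemeasurable
  have hac : μ.map (fun ω => (X ω, Y ω)) ≪ (μ.map X).prod ν := by
    rw [h]
    exact withDensity_absolutelyContinuous _ _
  have hllr : llr (μ.map fun ω => (X ω, Y ω)) ((μ.map X).prod ν)
      =ᵐ[μ.map fun ω => (X ω, Y ω)] f := by
    refine hac.ae_le ?_
    have h1 := Measure.rnDeriv_withDensity ((μ.map X).prod ν)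
      (f := fun u => ENNReal.ofReal (Real.exp (f u))) (by fun_prop)
    rw [← h] at h1
    filter_upwards [h1] with u hu
    rw [llr, hu, ENNReal.toReal_ofReal (Real.exp_pos _).le, Real.log_exp]
  have hintf : Integrable f (μ.map fun ω => (X ω, Y ω)) :=
    (integrable_map_measure (by fun_prop) (by fun_prop)).2 hint
  have h1 : InformationTheory.klDiv (μ.map fun ω => (X ω, Y ω)) ((μ.map X).prod ν) =
      ENNReal.ofReal (∫ ω, f (X ω, Y ω) ∂μ) := by
    rw [InformationTheory.klDiv_of_ac_of_integrable hac (hintf.congr hllr.symm),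
      integral_congr_ae hllr, integral_map (by fun_prop) (by fun_prop)]
    simp
  have hswap : (μ.map fun ω => (Y ω, X ω)) = (μ.map fun ω => (X ω, Y ω)).map Prod.swap := by
    rw [Measure.map_map measurable_swap (by fun_prop)]
    rfl
  have hswap' : (μ.map fun ω => (X ω, Y ω)) = (μ.map fun ω => (Y ω, X ω)).map Prod.swap := by
    rw [Measure.map_map measurable_swap (by fun_prop)]
    rfl
  have hcond : (μ.map fun ω => (Y ω, X ω)) = μ.map Y ⊗ₘ condDistrib X Y μ :=
    (compProd_map_condDistrib hX.aemeasurable).symm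
  calc mutualInformation μ X Y
      ≤ InformationTheory.klDiv (μ.map fun ω => (Y ω, X ω)) ((μ.map Y).prod (μ.map X)) := by
        rw [mutualInformation, hswap', ← Measure.prod_swap]
        exact InformationTheory.klDiv_map_le _ _ measurable_swap
    _ ≤ InformationTheory.klDiv (μ.map fun ω => (Y ω, X ω)) (ν.prod (μ.map X)) := by
        rw [hcond, ← Measure.compProd_const, ← Measure.compProd_const,
          InformationTheory.klDiv_compProd_eq_add (μ.map Y) ν]
        exact le_add_self
    _ ≤ InformationTheory.klDiv (μ.map fun ω => (X ω, Y ω)) ((μ.map X).prod ν) := by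
        rw [hswap, ← Measure.prod_swap]
        exact InformationTheory.klDiv_map_le _ _ measurable_swap
    _ = _ := h1

end InformationUpperBound

/-! ### Change of measure for the reproduction -/

section ChangeOfMeasure

open scoped MatrixOrder

variable {p q : ℕ} {A : Matrix (Fin p) (Fin p) ℝ} {B : Matrix (Fin p) (Fin q) ℝ}
  {S₀ P : Matrix (Fin p) (Fin p) ℝ}

/-- The state, before time `t`, of the recursion `y_t = f_t(y_{t-1}) + v_t`, started with
`y_{-1} = 0`. -/
noncomputable def run (f : ℕ → Vec p → Vec p) : ℕ → (ℕ → Vec p) → Vec p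
  | 0, _ => 0
  | t + 1, v => f t (run f t v) + v t

/-- The path `y_0, …, y_{n-1}`, continued by `0`. -/
noncomputable def runPath (f : ℕ → Vec p → Vec p) (n : ℕ) (v : ℕ → Vec p) (s : ℕ) : Vec p :=
  if s < n then run f (s + 1) v else 0

/-- The value `y_{t-1}` of a path, with `y_{-1} = 0`. -/
def prevValue : ℕ → (ℕ → Vec p) → Vec p
  | 0, _ => 0
  | t + 1, y => y t

@[fun_prop]
lemma measurable_prevValue (t : ℕ) : Measurable (prevValue (p := p) t) := by
  cases t with
  | zero => exact measurable_const
  | succ t => exact measurable_pi_apply t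

@[fun_prop]
lemma measurable_run {f : ℕ → Vec p → Vec p} (hf : ∀ t, Measurable (f t)) (t : ℕ) :
    Measurable (run f t) := by
  induction t with
  | zero => exact measurable_const
  | succ t ih => exact ((hf t).comp ih).add (measurable_pi_apply t)

@[fun_prop]
lemma measurable_runPath {f : ℕ → Vec p → Vec p} (hf : ∀ t, Measurable (f t)) (n : ℕ) :
    Measurable (runPath f n) := by
  refine measurable_pi_iff.2 fun s => ?_
  unfold runPath
  split_ifs
  · exact measurable_run hf _
  · exact measurable_const

lemma run_update {f : ℕ → Vec p → Vec p} {s n : ℕ} (h : s ≤ n) (v : ℕ → Vec p) (a : Vec p) :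
    run f s (Function.update v n a) = run f s v := by
  induction s with
  | zero => rfl
  | succ s ih =>
    rw [run, ih (by omega), Function.update_of_ne (by omega), run]

lemma prevValue_runPath {f : ℕ → Vec p → Vec p} {t n : ℕ} (h : t ≤ n) (v : ℕ → Vec p) :
    prevValue t (runPath f n v) = run f t v := by
  cases t with
  | zero => rfl
  | succ t => simp [prevValue, runPath, show t < n by omega]

lemma runPath_succ_update (f : ℕ → Vec p → Vec p) (n : ℕ) (v : ℕ → Vec p) (a : Vec p) :
    runPath f (n + 1) (Function.update v n a) =
      Function.update (runPath f n v) n (f n (prevValue n (runPath f n v)) + a) := by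
  funext s
  rcases lt_trichotomy s n with h | h | h
  · rw [Function.update_of_ne h.ne, runPath, runPath, if_pos h, if_pos (by omega),
      run_update (by omega)]
  · subst h
    rw [Function.update_self, runPath, if_pos (by omega), run, run_update le_rfl,
      Function.update_self, prevValue_runPath le_rfl]
  · rw [Function.update_of_ne (by omega), runPath, runPath, if_neg (by omega), if_neg (by omega)]

lemma lintegral_runPath_succ {f : ℕ → Vec p → Vec p} (hf : ∀ t, Measurable (f t))
    (μ : ℕ → Measure (Vec p)) [∀ t, IsProbabilityMeasure (μ t)] (n : ℕ)
    {F : (ℕ → Vec p) → ℝ≥0∞} (hF : Measurable F) :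
    ∫⁻ v, F (runPath f (n + 1) v) ∂Measure.infinitePi μ =
      ∫⁻ v, ∫⁻ a, F (Function.update (runPath f n v) n (f n (prevValue n (runPath f n v)) + a))
        ∂μ n ∂Measure.infinitePi μ := by
  conv_lhs => rw [← map_update_infinitePi μ n]
  have hm := measurable_update_prod (X := fun _ => Vec p) n
  have hFm : Measurable fun v => F (runPath f (n + 1) v) := hF.comp (measurable_runPath hf _)
  rw [lintegral_map hFm hm]
  refine (lintegral_prod _ (hFm.comp hm).aemeasurable).trans ?_
  exact lintegral_congr fun v => lintegral_congr fun a =>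
    congrArg F (runPath_succ_update f n v a)

/-- The logarithm of the density, at a path `y_0, …, y_{n-1}`, of the reproduction given the source
path with respect to the unconditional reproduction. -/
noncomputable def logGain (A P L : Matrix (Fin p) (Fin p) ℝ) (n : ℕ) (x y : ℕ → Vec p) : ℝ :=
  ∑ t ∈ Finset.range n, logRatio P L (y t) (Matrix.toEuclideanLin A (prevValue t y)) (x t)

lemma measurable_logGain {α : Type*} [MeasurableSpace α] (L : Matrix (Fin p) (Fin p) ℝ) (n : ℕ)
    {x y : ℕ → α → Vec p} (hx : ∀ t, Measurable (x t)) (hy : ∀ t, Measurable (y t)) :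
    Measurable fun ω => logGain A P L n (fun t => x t ω) (fun t => y t ω) := by
  unfold logGain
  refine Finset.measurable_sum _ fun t _ => measurable_logRatio _ _ (hy t) ?_ (hx t)
  exact (measurable_toEuclideanLin A).comp ((measurable_prevValue t).comp (measurable_pi_iff.2 hy))

lemma logGain_congr {L : Matrix (Fin p) (Fin p) ℝ} {n : ℕ} {x x' y y' : ℕ → Vec p}
    (hx : ∀ t < n, x t = x' t) (hy : ∀ t < n, y t = y' t) :
    logGain A P L n x y = logGain A P L n x' y' := by
  refine Finset.sum_congr rfl fun t ht => ?_
  have ht := Finset.mem_range.1 ht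
  have : prevValue t y = prevValue t y' := by
    cases t with
    | zero => rfl
    | succ t => exact hy t (by omega)
  rw [hx t ht, hy t ht, this]

lemma logRatio_add_right {n : ℕ} (P L : Matrix (Fin n) (Fin n) ℝ) (a b x : Vec n) :
    logRatio P L (b + a) b x = logRatio P L a 0 (x - b) := by
  rw [logRatio, logRatio, sub_zero, sub_add_eq_sub_sub]

lemma logGain_update (L : Matrix (Fin p) (Fin p) ℝ) (n : ℕ) (x y : ℕ → Vec p) (a : Vec p) :
    logGain A P L (n + 1) x
      (Function.update y n (Matrix.toEuclideanLin A (prevValue n y) + a)) =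
    logGain A P L n x y +
      logRatio P L a 0 (x n - Matrix.toEuclideanLin A (prevValue n y)) := by
  have hprev : prevValue n (Function.update y n
      (Matrix.toEuclideanLin A (prevValue n y) + a)) = prevValue n y := by
    cases n with
    | zero => rfl
    | succ n => exact Function.update_of_ne (by omega) _ _
  rw [logGain, Finset.sum_range_succ, hprev, Function.update_self, logRatio_add_right]
  congr 1
  exact logGain_congr (fun _ _ => rfl) fun t ht => Function.update_of_ne ht.ne _ _

/-- The reproduction given the source path `x` is the recursion `y ↦ A y + H (x_t - A y) + v_t`. It
has a density with respect to the recursion `y ↦ A y + η_t` with `η_t ∼ N(0, Λ - Π)`. -/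
lemma lintegral_runPath_eq (hP : P.PosDef) (hL : P ≤ predCov A B P) (x : ℕ → Vec p) (n : ℕ) :
    ∀ {F : (ℕ → Vec p) → ℝ≥0∞}, Measurable F →
    ∫⁻ v, F (runPath (fun t y => Matrix.toEuclideanLin A y +
        Matrix.toEuclideanLin (gainH A B P) (x t - Matrix.toEuclideanLin A y)) n v)
      ∂Measure.infinitePi (fun _ : ℕ => multivariateGaussian (0 : Vec p) (P * (gainH A B P)ᵀ)) =
    ∫⁻ v, F (runPath (fun _ y => Matrix.toEuclideanLin A y) n v) *
        ENNReal.ofReal (Real.exp (logGain A P (predCov A B P) n x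
          (runPath (fun _ y => Matrix.toEuclideanLin A y) n v)))
      ∂Measure.infinitePi
        (fun _ : ℕ => multivariateGaussian (0 : Vec p) (predCov A B P - P)) := by
  have hf : ∀ t, Measurable fun y : Vec p => Matrix.toEuclideanLin A y +
      Matrix.toEuclideanLin (gainH A B P) (x t - Matrix.toEuclideanLin A y) := fun t => by fun_prop
  have hg : ℕ → Measurable fun y : Vec p => Matrix.toEuclideanLin A y := fun _ => by fun_prop
  induction n with
  | zero =>
    intro F hF
    simp only [logGain, Finset.range_zero, Finset.sum_empty, Real.exp_zero, ENNReal.ofReal_one,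
      mul_one]
    have h0 : ∀ (f : ℕ → Vec p → Vec p) v, runPath f 0 v = fun _ => 0 := fun f v => by
      funext s
      simp [runPath]
    simp only [h0, lintegral_const, measure_univ]
  | succ n ih =>
    intro F hF
    have hgain : Measurable fun y : ℕ → Vec p =>
        ENNReal.ofReal (Real.exp (logGain A P (predCov A B P) (n + 1) x y)) :=
      (Real.measurable_exp.comp (measurable_logGain (x := fun t _ => x t)
        (y := fun t (y : ℕ → Vec p) => y t) _ _ (fun t => measurable_const)
        fun t => measurable_pi_apply t)).ennreal_ofReal
    have hΨ : Measurable fun y : ℕ → Vec p => ∫⁻ a, F (Function.update y n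
        (Matrix.toEuclideanLin A (prevValue n y) + a)) * ENNReal.ofReal (Real.exp
          (logRatio P (predCov A B P) a 0 (x n - Matrix.toEuclideanLin A (prevValue n y))))
        ∂multivariateGaussian (0 : Vec p) (predCov A B P - P) := by
      have hu := measurable_update_prod (X := fun _ => Vec p) n
      refine Measurable.lintegral_prod_right' (f := fun z : (ℕ → Vec p) × Vec p =>
        F (Function.update z.1 n (Matrix.toEuclideanLin A (prevValue n z.1) + z.2)) *
          ENNReal.ofReal (Real.exp (logRatio P (predCov A B P) z.2 0
            (x n - Matrix.toEuclideanLin A (prevValue n z.1))))) ?_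
      refine Measurable.mul ?_ (Real.measurable_exp.comp
        (measurable_logRatio _ _ measurable_snd measurable_const (by fun_prop))).ennreal_ofReal
      exact hF.comp (hu.comp (by fun_prop : Measurable fun z : (ℕ → Vec p) × Vec p =>
        (z.1, Matrix.toEuclideanLin A (prevValue n z.1) + z.2)))
    rw [lintegral_runPath_succ hf _ n hF, lintegral_runPath_succ (F := fun y => F y *
      ENNReal.ofReal (Real.exp (logGain A P (predCov A B P) (n + 1) x y))) hg _ n (hF.mul hgain)]
    refine Eq.trans (lintegral_congr fun v => ?_) ((ih hΨ).trans (lintegral_congr fun v => ?_))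
    · set y := runPath (fun t y => Matrix.toEuclideanLin A y +
        Matrix.toEuclideanLin (gainH A B P) (x t - Matrix.toEuclideanLin A y)) n v with hy
      have hFy : Measurable fun a => F (Function.update y n
          (Matrix.toEuclideanLin A (prevValue n y) + a)) :=
        hF.comp ((measurable_update y).comp (by fun_prop))
      have hr : Measurable fun a => ENNReal.ofReal (Real.exp (logRatio P (predCov A B P) a 0
          (x n - Matrix.toEuclideanLin A (prevValue n y)))) :=
        (Real.measurable_exp.comp (measurable_logRatio _ _ measurable_id measurable_const
          measurable_const)).ennreal_ofReal
      have h1 := lintegral_map (μ := multivariateGaussian (0 : Vec p) (P * (gainH A B P)ᵀ)) hFy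
        (g := fun v => Matrix.toEuclideanLin (gainH A B P)
          (x n - Matrix.toEuclideanLin A (prevValue n y)) + v) (by fun_prop)
      rw [map_gain_add_noise hP hL, lintegral_withDensity_eq_lintegral_mul _ hr hFy] at h1
      simp only [add_assoc]
      rw [← h1]
      exact lintegral_congr fun a => mul_comm _ _
    · rw [← lintegral_mul_const' _ _ ENNReal.ofReal_ne_top]
      refine lintegral_congr fun a => ?_
      rw [logGain_update, Real.exp_add, ENNReal.ofReal_mul (Real.exp_pos _).le]
      ring

end ChangeOfMeasure

/-! ### Performance of the stationary channel and achievability -/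

section Achievability

open scoped MatrixOrder

variable {p q : ℕ} {A : Matrix (Fin p) (Fin p) ℝ} {B : Matrix (Fin p) (Fin q) ℝ}
  {S₀ P : Matrix (Fin p) (Fin p) ℝ} {D : ℝ≥0∞}

lemma source_eq_of_fst {t : ℕ} (x₀ : Vec p) (w : ℕ → Vec q) (v v' : ℕ → Vec p) :
    source A B t (x₀, w, v) = source A B t (x₀, w, v') := by
  induction t with
  | zero => rfl
  | succ t ih => simp only [source, ih]

lemma prevOutput_stationary_eq_run (t : ℕ) (ω : Sample p q) :
    prevOutput A B (stationaryChannel A B P) t ω =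
      run (fun t y => Matrix.toEuclideanLin A y + Matrix.toEuclideanLin (gainH A B P)
        (source A B t ω - Matrix.toEuclideanLin A y)) t ω.2.2 := by
  induction t with
  | zero => rfl
  | succ t ih =>
    have h := output_stationary (A := A) (B := B) (P := P) t ω
    rw [output, innovation, ih, ← add_assoc] at h
    rw [h, run]

lemma stationaryChannel_isValid (hP : P.PosDef) (hL : P ≤ predCov A B P) :
    (stationaryChannel A B P).IsValid := fun _ =>
  Matrix.nonneg_iff_posSemidef.1 (noise_nonneg hP hL)

/-- The law of the source and the reproduction has the density `exp logGain` with respect to the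
product of the law of the source and the law of the recursion `y ↦ A y + η`. -/
lemma map_source_output_eq_withDensity (hP : P.PosDef) (hL : P ≤ predCov A B P) (n : ℕ) :
    (law q S₀ (stationaryChannel A B P)).map (fun ω =>
      ((fun t : Fin (n + 1) => source A B t ω),
        (fun t : Fin (n + 1) => output A B (stationaryChannel A B P) t ω))) =
    (((law q S₀ (stationaryChannel A B P)).map fun ω (t : Fin (n + 1)) => source A B t ω).prod
      ((Measure.infinitePi fun _ : ℕ => multivariateGaussian (0 : Vec p) (predCov A B P - P)).map
        fun v (t : Fin (n + 1)) =>
          runPath (fun _ y => Matrix.toEuclideanLin A y) (n + 1) v t)).withDensity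
      fun u => ENNReal.ofReal (Real.exp (logGain A P (predCov A B P) (n + 1)
        (fun t => u.1 (Fin.ofNat (n + 1) t)) (fun t => u.2 (Fin.ofNat (n + 1) t)))) := by
  have hXm : Measurable fun (ω : Sample p q) (t : Fin (n + 1)) => source A B t ω :=
    measurable_pi_iff.2 fun _ => measurable_source _
  have hYm : Measurable fun (ω : Sample p q) (t : Fin (n + 1)) =>
      output A B (stationaryChannel A B P) t ω := measurable_pi_iff.2 fun _ => measurable_output _
  have hg : ℕ → Measurable fun y : Vec p => Matrix.toEuclideanLin A y := fun _ => by fun_prop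
  have hZm : Measurable fun (v : ℕ → Vec p) (t : Fin (n + 1)) =>
      runPath (fun _ y => Matrix.toEuclideanLin A y) (n + 1) v t :=
    measurable_pi_iff.2 fun t => (measurable_pi_apply (t : ℕ)).comp (measurable_runPath hg _)
  have hlog : Measurable fun u : (Fin (n + 1) → Vec p) × (Fin (n + 1) → Vec p) =>
      ENNReal.ofReal (Real.exp (logGain A P (predCov A B P) (n + 1)
        (fun t => u.1 (Fin.ofNat (n + 1) t)) (fun t => u.2 (Fin.ofNat (n + 1) t)))) :=
    (Real.measurable_exp.comp (measurable_logGain _ _ (fun t => by fun_prop)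
      (fun t => by fun_prop))).ennreal_ofReal
  have hmod : ∀ t, t < n + 1 → ((Fin.ofNat (n + 1) t : Fin (n + 1)) : ℕ) = t := fun t ht => by
    rw [Fin.val_ofNat, Nat.mod_eq_of_lt ht]
  refine Measure.ext_of_lintegral _ fun G hG => ?_
  rw [lintegral_map hG (hXm.prodMk hYm), lintegral_withDensity_eq_lintegral_mul _ hlog hG,
    lintegral_prod _ (hlog.mul hG).aemeasurable,
    lintegral_map (Measurable.lintegral_prod_right' (hlog.mul hG)) hXm]
  have hinner : ∀ ω : Sample p q, ∫⁻ y, ((fun u : (Fin (n + 1) → Vec p) × (Fin (n + 1) → Vec p) =>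
      ENNReal.ofReal (Real.exp (logGain A P (predCov A B P) (n + 1)
        (fun t => u.1 (Fin.ofNat (n + 1) t)) (fun t => u.2 (Fin.ofNat (n + 1) t))))) * G)
        ((fun t : Fin (n + 1) => source A B t ω), y)
      ∂((Measure.infinitePi fun _ : ℕ => multivariateGaussian (0 : Vec p) (predCov A B P - P)).map
        fun v (t : Fin (n + 1)) => runPath (fun _ y => Matrix.toEuclideanLin A y) (n + 1) v t) =
      ∫⁻ v, G ((fun t : Fin (n + 1) => source A B t ω), fun t : Fin (n + 1) =>
        output A B (stationaryChannel A B P) t (ω.1, ω.2.1, v)) ∂(Measure.infinitePi fun t : ℕ =>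
          multivariateGaussian (0 : Vec p) ((stationaryChannel A B P).noiseCov t)) := fun ω => by
    have hF : Measurable fun y : ℕ → Vec p =>
        G ((fun t : Fin (n + 1) => source A B t ω), fun t : Fin (n + 1) => y t) := by fun_prop
    have h := lintegral_runPath_eq hP hL (fun t => source A B t ω) (n + 1) hF
    have hmeas := (hlog.mul hG).comp (by fun_prop : Measurable fun y : Fin (n + 1) → Vec p =>
      ((fun t : Fin (n + 1) => source A B t ω), y))
    refine (lintegral_map hmeas hZm).trans (Eq.trans (lintegral_congr fun v => ?_)
      (h.symm.trans (lintegral_congr fun v => ?_)))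
    · simp only [Function.comp_apply, Pi.mul_apply]
      rw [mul_comm]
      congr 3
      exact logGain_congr (fun t ht => by rw [hmod t ht]) fun t ht => by rw [hmod t ht]
    · congr 2
      funext t
      rw [runPath, if_pos t.2, output, prevOutput_stationary_eq_run]
      congr 1
      funext s y
      rw [source_eq_of_fst ω.1 ω.2.1 v ω.2.2]
  rw [lintegral_congr hinner]
  have hGo : Measurable fun ω : Sample p q => G ((fun t : Fin (n + 1) => source A B t ω),
      fun t : Fin (n + 1) => output A B (stationaryChannel A B P) t ω) := hG.comp (hXm.prodMk hYm)
  have hGi : Measurable fun ω : Sample p q => ∫⁻ v, G ((fun t : Fin (n + 1) => source A B t ω),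
      fun t : Fin (n + 1) => output A B (stationaryChannel A B P) t (ω.1, ω.2.1, v))
      ∂(Measure.infinitePi fun t : ℕ =>
        multivariateGaussian (0 : Vec p) ((stationaryChannel A B P).noiseCov t)) := by
    refine Measurable.lintegral_prod_right' (f := fun z : Sample p q × (ℕ → Vec p) =>
      G ((fun t : Fin (n + 1) => source A B t z.1), fun t : Fin (n + 1) =>
        output A B (stationaryChannel A B P) t (z.1.1, z.1.2.1, z.2))) ?_
    exact hG.comp ((hXm.comp measurable_fst).prodMk (hYm.comp (by fun_prop :
      Measurable fun z : Sample p q × (ℕ → Vec p) => ((z.1.1, z.1.2.1, z.2) : Sample p q))))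
  rw [law, lintegral_prod _ hGo.aemeasurable, lintegral_prod _ hGi.aemeasurable]
  refine lintegral_congr fun x₀ => ?_
  refine (lintegral_prod _ (hGo.comp measurable_prodMk_left).aemeasurable).trans
    (Eq.trans ?_ (lintegral_prod _ (hGi.comp measurable_prodMk_left).aemeasurable).symm)
  refine lintegral_congr fun w => ?_
  -- the source does not depend on the channel noise, so the outer integral over it is trivial
  have hconst : ∀ c : ℝ≥0∞, ∫⁻ _ : ℕ → Vec p, c ∂(Measure.infinitePi fun t : ℕ =>
      multivariateGaussian (0 : Vec p) ((stationaryChannel A B P).noiseCov t)) = c := fun c => by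
    rw [lintegral_const, measure_univ, mul_one]
  refine (hconst _).symm.trans (lintegral_congr fun v' => lintegral_congr fun v => ?_)
  simp only [Function.comp_apply]
  congr 2
  exact funext fun t => source_eq_of_fst _ _ _ _

lemma memLp_error (hP : P.PosDef) (hL : P ≤ predCov A B P) (hS₀ : 0 ≤ S₀) (t : ℕ) :
    MemLp (fun ω => source A B t ω - output A B (stationaryChannel A B P) t ω) 2
      (law q S₀ (stationaryChannel A B P)) :=
  memLp_of_map_eq_gaussian (by fun_prop) (map_error hP hL hS₀ t)

lemma secondMoment_error (hP : P.PosDef) (hL : P ≤ predCov A B P) (hS₀ : 0 ≤ S₀) (t : ℕ) :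
    secondMoment (law q S₀ (stationaryChannel A B P))
      (fun ω => source A B t ω - output A B (stationaryChannel A B P) t ω) =
      errorCov A B P S₀ t :=
  secondMoment_of_map_eq_gaussian (by fun_prop) (errorCov_nonneg hP hL hS₀ t)
    (map_error hP hL hS₀ t)

/-- The expectation of `logGain` bounds the information; it is affine in the error covariances. -/
lemma mutualInformation_stationary_le (hP : P.PosDef) (hL : P ≤ predCov A B P) (hS₀ : 0 ≤ S₀)
    (n : ℕ) :
    mutualInformation (law q S₀ (stationaryChannel A B P))
      (fun ω (t : Fin (n + 1)) => source A B t ω)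
      (fun ω (t : Fin (n + 1)) => output A B (stationaryChannel A B P) t ω) ≤
    ENNReal.ofReal (∑ t ∈ Finset.range (n + 1), (objective A B P -
      (P⁻¹ * errorCov A B P S₀ t).trace / 2 +
        ((predCov A B P)⁻¹ * innovationCov A B P S₀ t).trace / 2)) := by
  have hXm : Measurable fun (ω : Sample p q) (t : Fin (n + 1)) => source A B t ω :=
    measurable_pi_iff.2 fun _ => measurable_source _
  have hYm : Measurable fun (ω : Sample p q) (t : Fin (n + 1)) =>
      output A B (stationaryChannel A B P) t ω := measurable_pi_iff.2 fun _ => measurable_output _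
  have hg : ℕ → Measurable fun y : Vec p => Matrix.toEuclideanLin A y := fun _ => by fun_prop
  have hZm : Measurable fun (v : ℕ → Vec p) (t : Fin (n + 1)) =>
      runPath (fun _ y => Matrix.toEuclideanLin A y) (n + 1) v t :=
    measurable_pi_iff.2 fun t => (measurable_pi_apply (t : ℕ)).comp (measurable_runPath hg _)
  have := Measure.isProbabilityMeasure_map (μ := Measure.infinitePi fun _ : ℕ =>
    multivariateGaussian (0 : Vec p) (predCov A B P - P)) hZm.aemeasurable
  have hlog : Measurable fun u : (Fin (n + 1) → Vec p) × (Fin (n + 1) → Vec p) =>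
      logGain A P (predCov A B P) (n + 1)
        (fun t => u.1 (Fin.ofNat (n + 1) t)) (fun t => u.2 (Fin.ofNat (n + 1) t)) :=
    measurable_logGain _ _ (fun t => by fun_prop) (fun t => by fun_prop)
  have hmod : ∀ t, t < n + 1 → ((Fin.ofNat (n + 1) t : Fin (n + 1)) : ℕ) = t := fun t ht => by
    rw [Fin.val_ofNat, Nat.mod_eq_of_lt ht]
  have hval : ∀ ω : Sample p q, logGain A P (predCov A B P) (n + 1)
      (fun t => source A B (Fin.ofNat (n + 1) t : Fin (n + 1)) ω)
      (fun t => output A B (stationaryChannel A B P) (Fin.ofNat (n + 1) t : Fin (n + 1)) ω) =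
      ∑ t ∈ Finset.range (n + 1), logRatio P (predCov A B P)
        (output A B (stationaryChannel A B P) t ω) (Matrix.toEuclideanLin A
          (prevOutput A B (stationaryChannel A B P) t ω)) (source A B t ω) := fun ω => by
    rw [logGain_congr (x' := fun t => source A B t ω)
      (y' := fun t => output A B (stationaryChannel A B P) t ω)
      (fun t ht => by rw [hmod t ht]) fun t ht => by rw [hmod t ht], logGain]
    refine Finset.sum_congr rfl fun t _ => ?_
    cases t <;> rfl
  have hinn : ∀ t, MemLp (fun ω => source A B t ω - Matrix.toEuclideanLin A
      (prevOutput A B (stationaryChannel A B P) t ω)) 2 (law q S₀ (stationaryChannel A B P)) :=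
    fun t => memLp_of_map_eq_gaussian (measurable_innovation t) (map_innovation hP hL hS₀ t)
  have hinnS : ∀ t, secondMoment (law q S₀ (stationaryChannel A B P)) (fun ω => source A B t ω -
      Matrix.toEuclideanLin A (prevOutput A B (stationaryChannel A B P) t ω)) =
      innovationCov A B P S₀ t := fun t =>
    secondMoment_of_map_eq_gaussian (measurable_innovation t) (innovationCov_nonneg hP hL hS₀ t)
      (map_innovation hP hL hS₀ t)
  have hint := fun t => integrable_logRatio P (predCov A B P) (memLp_error (q := q) hP hL hS₀ t)
    (hinn t)
  have hintf : Integrable (fun ω : Sample p q => logGain A P (predCov A B P) (n + 1)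
      (fun t => source A B (Fin.ofNat (n + 1) t : Fin (n + 1)) ω)
      (fun t => output A B (stationaryChannel A B P) (Fin.ofNat (n + 1) t : Fin (n + 1)) ω))
      (law q S₀ (stationaryChannel A B P)) := by
    simp only [hval]
    exact integrable_finsetSum _ fun t _ => hint t
  refine (mutualInformation_le hXm hYm _ hlog (map_source_output_eq_withDensity hP hL n)
    hintf).trans (le_of_eq ?_)
  simp only [hval]
  rw [integral_finsetSum _ fun t _ => hint t]
  congr 1
  refine Finset.sum_congr rfl fun t _ => ?_
  rw [integral_logRatio P _ (memLp_error hP hL hS₀ t) (hinn t), hinnS, secondMoment_error hP hL hS₀,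
    objective]

lemma informationRate_stationary_le (hP : P.PosDef) (hL : P ≤ predCov A B P) (hS₀ : 0 ≤ S₀)
    (n : ℕ) :
    informationRate A B S₀ (stationaryChannel A B P) n ≤
    ENNReal.ofReal ((∑ t ∈ Finset.range (n + 1), (objective A B P -
      (P⁻¹ * errorCov A B P S₀ t).trace / 2 +
        ((predCov A B P)⁻¹ * innovationCov A B P S₀ t).trace / 2)) / (n + 1)) := by
  rw [informationRate, natCast_add_one_eq_ofReal, ENNReal.ofReal_div_of_pos (by positivity)]
  gcongr
  exact mutualInformation_stationary_le hP hL hS₀ n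

lemma distortion_stationary (hP : P.PosDef) (hL : P ≤ predCov A B P) (hS₀ : 0 ≤ S₀) (n : ℕ) :
    distortion A B S₀ (stationaryChannel A B P) n =
      ENNReal.ofReal ((∑ t ∈ Finset.range (n + 1), (errorCov A B P S₀ t).trace) / (n + 1)) := by
  rw [distortion, natCast_add_one_eq_ofReal, ENNReal.ofReal_div_of_pos (by positivity),
    ENNReal.ofReal_sum_of_nonneg fun t _ => by
      simpa using trace_mono (errorCov_nonneg hP hL hS₀ t)]
  congr 1
  refine Finset.sum_congr rfl fun t _ => ?_
  rw [lintegral_enorm_sq (memLp_error hP hL hS₀ t), secondMoment_error hP hL hS₀]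

lemma tendsto_average {u : ℕ → ℝ} {l : ℝ} (h : Tendsto u atTop (𝓝 l)) :
    Tendsto (fun n : ℕ => (∑ t ∈ Finset.range (n + 1), u t) / ((n : ℝ) + 1)) atTop (𝓝 l) := by
  refine ((tendsto_add_atTop_iff_nat 1).2 h.cesaro).congr fun n => ?_
  push_cast
  rw [inv_mul_eq_div]

lemma tendsto_innovationCov (hA : Tendsto (fun j => A ^ j) atTop (𝓝 0)) (hP : P.PosDef)
    (hL : P ≤ predCov A B P) :
    Tendsto (innovationCov A B P S₀) atTop (𝓝 (predCov A B P)) := by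
  refine (tendsto_add_atTop_iff_nat 1).1 ?_
  have hc : Continuous fun X => predCov A B X := by
    unfold predCov
    fun_prop
  exact (hc.tendsto P).comp (tendsto_errorCov hA hP hL)

lemma tendsto_average_rate (hA : Tendsto (fun j => A ^ j) atTop (𝓝 0)) (hP : P.PosDef)
    (hL : P ≤ predCov A B P) :
    Tendsto (fun n : ℕ => (∑ t ∈ Finset.range (n + 1), (objective A B P -
      (P⁻¹ * errorCov A B P S₀ t).trace / 2 +
        ((predCov A B P)⁻¹ * innovationCov A B P S₀ t).trace / 2)) / ((n : ℝ) + 1)) atTop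
      (𝓝 (objective A B P)) := by
  refine tendsto_average ?_
  have h1 : Continuous fun X : Matrix (Fin p) (Fin p) ℝ => (P⁻¹ * X).trace / 2 := by fun_prop
  have h2 : Continuous fun X : Matrix (Fin p) (Fin p) ℝ =>
      ((predCov A B P)⁻¹ * X).trace / 2 := by fun_prop
  have h := (((h1.tendsto P).comp (tendsto_errorCov (S₀ := S₀) hA hP hL)).const_sub
    (objective A B P)).add ((h2.tendsto _).comp (tendsto_innovationCov (S₀ := S₀) hA hP hL))
  rw [Matrix.nonsing_inv_mul _ (det_ne_zero_of_posDef hP),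
    Matrix.nonsing_inv_mul _ (det_ne_zero_of_posDef (predCov_posDef hP hL)), sub_add_cancel] at h
  exact h

lemma tendsto_distortion_stationary (hA : Tendsto (fun j => A ^ j) atTop (𝓝 0)) (hP : P.PosDef)
    (hL : P ≤ predCov A B P) (hS₀ : 0 ≤ S₀) :
    Tendsto (fun n => distortion A B S₀ (stationaryChannel A B P) n) atTop
      (𝓝 (ENNReal.ofReal P.trace)) := by
  simp only [distortion_stationary hP hL hS₀]
  refine ENNReal.tendsto_ofReal (tendsto_average ?_)
  have h1 : Continuous fun X : Matrix (Fin p) (Fin p) ℝ => X.trace := by fun_prop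
  exact (h1.tendsto P).comp (tendsto_errorCov hA hP hL)

lemma innovationCov_predCov (hP : P.PosDef) (hL : P ≤ predCov A B P) (t : ℕ) :
    innovationCov A B P (predCov A B P) t = predCov A B P := by
  cases t with
  | zero => rfl
  | succ t => rw [innovationCov, errorCov_predCov hP hL]

/-- If the source starts with the covariance `Λ`, the rate is exactly the value of the objective:
the reproduction itself is the conditional mean. -/
lemma informationRate_stationary_predCov (hP : P.PosDef) (hL : P ≤ predCov A B P) (n : ℕ) :
    informationRate A B (predCov A B P) (stationaryChannel A B P) n =
      ENNReal.ofReal (objective A B P) := by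
  have hLP := predCov_posDef hP hL
  have hL0 := hLP.posSemidef.nonneg
  have hPP := Matrix.nonsing_inv_mul _ (det_ne_zero_of_posDef hP)
  have hLL := Matrix.nonsing_inv_mul _ (det_ne_zero_of_posDef hLP)
  have hn0 : (0 : ℝ) < (n : ℝ) + 1 := by positivity
  refine le_antisymm ((informationRate_stationary_le hP hL hL0 n).trans
    (ENNReal.ofReal_le_ofReal (le_of_eq ?_))) ?_
  · simp only [errorCov_predCov hP hL, innovationCov_predCov hP hL, hPP, hLL, sub_add_cancel]
    rw [Finset.sum_const, Finset.card_range, nsmul_eq_mul]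
    push_cast
    field_simp
  · have h := ofReal_le_mutualInformation (Q := stationaryChannel A B P) hP hL hL0
      (Nat.zero_le n) (m := 0) hLP (est := fun t y => y (Fin.last t)) (fun t => by fun_prop)
      (S := fun _ => P) (memLp_error hP hL hL0)
      (fun t => (secondMoment_error hP hL hL0 t).trans (errorCov_predCov hP hL t))
    rw [informationRate, natCast_add_one_eq_ofReal, ENNReal.le_div_iff_mul_le
      (Or.inl (by simpa using hn0)) (Or.inl ENNReal.ofReal_ne_top),
      ← ENNReal.ofReal_mul' hn0.le]
    refine le_trans (ENNReal.ofReal_le_ofReal (le_of_eq ?_)) h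
    simp only [hPP, hLL, sub_add_cancel, Finset.sum_const, Nat.card_Ico, nsmul_eq_mul,
      Function.iterate_zero_apply, Matrix.trace_one, Fintype.card_fin, tsub_zero]
    rw [objective]
    ring

lemma distortion_stationary_predCov (hP : P.PosDef) (hL : P ≤ predCov A B P) (n : ℕ) :
    distortion A B (predCov A B P) (stationaryChannel A B P) n = ENNReal.ofReal P.trace := by
  have hn0 : (0 : ℝ) < (n : ℝ) + 1 := by positivity
  rw [distortion_stationary hP hL (predCov_posDef hP hL).posSemidef.nonneg]
  simp only [errorCov_predCov hP hL]
  rw [Finset.sum_const, Finset.card_range, nsmul_eq_mul]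
  push_cast
  rw [mul_div_cancel_left₀ _ hn0.ne']

lemma tendsto_ofReal_of_eventually {u : ℕ → ℝ≥0∞} {R : ℝ}
    (h₁ : ∀ ε > 0, ∀ᶠ n in atTop, ENNReal.ofReal (R - ε) ≤ u n)
    (h₂ : ∀ ε > 0, ∀ᶠ n in atTop, u n ≤ ENNReal.ofReal (R + ε)) :
    Tendsto u atTop (𝓝 (ENNReal.ofReal R)) := by
  have hc₁ : Tendsto (fun ε : ℝ => ENNReal.ofReal (R - ε)) (𝓝[>] 0) (𝓝 (ENNReal.ofReal R)) := by
    have h : Continuous fun ε : ℝ => ENNReal.ofReal (R - ε) :=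
      ENNReal.continuous_ofReal.comp (by fun_prop)
    simpa using (h.tendsto 0).mono_left nhdsWithin_le_nhds
  have hc₂ : Tendsto (fun ε : ℝ => ENNReal.ofReal (R + ε)) (𝓝[>] 0) (𝓝 (ENNReal.ofReal R)) := by
    have h : Continuous fun ε : ℝ => ENNReal.ofReal (R + ε) :=
      ENNReal.continuous_ofReal.comp (by fun_prop)
    simpa using (h.tendsto 0).mono_left nhdsWithin_le_nhds
  refine tendsto_order.2 ⟨fun a ha => ?_, fun a ha => ?_⟩
  · obtain ⟨ε, hε, hε0⟩ := ((hc₁.eventually_const_lt ha).and self_mem_nhdsWithin).exists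
    filter_upwards [h₁ ε hε0] with n hn using hε.trans_le hn
  · obtain ⟨ε, hε, hε0⟩ := ((hc₂.eventually_lt_const ha).and self_mem_nhdsWithin).exists
    filter_upwards [h₂ ε hε0] with n hn using hn.trans_lt hε

/-- The rate of the stationary channel of a minimizer tends to the minimum. -/
lemma tendsto_informationRate_stationary (hA : Tendsto (fun j => A ^ j) atTop (𝓝 0))
    (hP : P ∈ feasibleSet A B D)
    (hmin : ∀ Y ∈ feasibleSet A B D, objective A B P ≤ objective A B Y) (hS₀ : 0 ≤ S₀) :
    Tendsto (fun n => informationRate A B S₀ (stationaryChannel A B P) n) atTop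
      (𝓝 (ENNReal.ofReal (objective A B P))) := by
  have hPd := hP.1
  have hL : P ≤ predCov A B P := hP.2.1
  refine tendsto_ofReal_of_eventually (fun ε hε => ?_) (fun ε hε => ?_)
  · obtain ⟨δ, hδ, N, hN⟩ := exists_le_informationRate hA hP hmin hS₀ hε
    have h1 : ∀ᶠ n : ℕ in atTop,
        (∑ t ∈ Finset.range (n + 1), (errorCov A B P S₀ t).trace) / ((n : ℝ) + 1) ≤ P.trace + δ := by
      have hc : Continuous fun X : Matrix (Fin p) (Fin p) ℝ => X.trace := by fun_prop
      exact (tendsto_average ((hc.tendsto P).comp (tendsto_errorCov hA hPd hL))).eventually_le_const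
        (by linarith)
    filter_upwards [h1, eventually_ge_atTop N] with n hn hnN
    refine hN n hnN _ ?_
    rw [distortion_stationary hPd hL hS₀]
    exact (ENNReal.ofReal_le_ofReal hn).trans (ENNReal.ofReal_add_le.trans
      (add_le_add_left hP.2.2 _))
  · filter_upwards [(tendsto_average_rate (S₀ := S₀) hA hPd hL).eventually_le_const
      (show objective A B P < objective A B P + ε by linarith)] with n hn
    exact (informationRate_stationary_le hPd hL hS₀ n).trans (ENNReal.ofReal_le_ofReal hn)

lemma finiteNRDF_le_timeInvariant (n : ℕ) :
    finiteNRDF A B S₀ n D ≤ finiteNRDFTimeInvariant A B S₀ n D :=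
  le_iInf fun Q => le_iInf fun hQ => le_iInf fun _ => le_iInf fun hD =>
    iInf_le_of_le Q (iInf_le_of_le hQ (iInf_le_of_le hD le_rfl))

/-- The stationary channels of `s P` with `s < 1` have a distortion below `D` after a finite time,
and rates near the minimum for `s` near `1`. -/
lemma eventually_finiteNRDFTimeInvariant_le (hA : Tendsto (fun j => A ^ j) atTop (𝓝 0))
    (hD : 0 < D) (hP : P ∈ feasibleSet A B D) (hS₀ : 0 ≤ S₀) {ε : ℝ} (hε : 0 < ε) :
    ∀ᶠ n in atTop, finiteNRDFTimeInvariant A B S₀ n D ≤ ENNReal.ofReal (objective A B P + ε) := by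
  obtain ⟨s, hs0, hs1, hs⟩ : ∃ s : ℝ, 0 < s ∧ s < 1 ∧
      objective A B (s • P) < objective A B P + ε := by
    have h1 : Tendsto (fun s : ℝ => s • P) (𝓝[<] 1) (𝓝[feasibleSet A B D] P) := by
      refine tendsto_nhdsWithin_iff.2 ⟨?_, ?_⟩
      · have hc : Continuous fun s : ℝ => s • P := by fun_prop
        simpa using (hc.tendsto 1).mono_left nhdsWithin_le_nhds
      · filter_upwards [Ioo_mem_nhdsLT (show (0 : ℝ) < 1 by norm_num)] with s hs
        exact smul_mem_feasibleSet hP hs.1 hs.2.le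
    have h2 := ((continuousOn_objective (A := A) (B := B) (D := D) P hP).tendsto.comp
      h1).eventually_lt_const (show objective A B P < objective A B P + ε by linarith)
    obtain ⟨s, hs, hs'⟩ := (h2.and (Ioo_mem_nhdsLT (show (0 : ℝ) < 1 by norm_num))).exists
    exact ⟨s, hs'.1, hs'.2, hs⟩
  have hsP := smul_mem_feasibleSet hP hs0 hs1.le
  have hPd := hsP.1
  have hL : s • P ≤ predCov A B (s • P) := hsP.2.1
  have hlt : ENNReal.ofReal (s • P).trace < D := by
    rcases eq_or_ne D ⊤ with rfl | hDt
    · exact ENNReal.ofReal_lt_top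
    have h1 : 0 < D.toReal := ENNReal.toReal_pos hD.ne' hDt
    have h2 : P.trace ≤ D.toReal := by
      have := hP.2.2
      rwa [ENNReal.ofReal_le_iff_le_toReal hDt] at this
    rw [ENNReal.ofReal_lt_iff_lt_toReal (by simpa using trace_mono hPd.posSemidef.nonneg) hDt,
      Matrix.trace_smul, smul_eq_mul]
    nlinarith
  filter_upwards [(tendsto_distortion_stationary hA hPd hL hS₀).eventually_lt_const hlt,
    (tendsto_average_rate (S₀ := S₀) hA hPd hL).eventually_le_const hs] with n hn hn'
  refine iInf_le_of_le (stationaryChannel A B (s • P)) (iInf_le_of_le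
    (stationaryChannel_isValid hPd hL) (iInf_le_of_le (fun t => ⟨rfl, rfl, rfl⟩)
      (iInf_le_of_le hn.le ?_)))
  exact (informationRate_stationary_le hPd hL hS₀ n).trans (ENNReal.ofReal_le_ofReal hn')

lemma eventually_le_finiteNRDF (hA : Tendsto (fun j => A ^ j) atTop (𝓝 0))
    (hP : P ∈ feasibleSet A B D)
    (hmin : ∀ Y ∈ feasibleSet A B D, objective A B P ≤ objective A B Y) (hS₀ : 0 ≤ S₀)
    {ε : ℝ} (hε : 0 < ε) :
    ∀ᶠ n in atTop, ENNReal.ofReal (objective A B P - ε) ≤ finiteNRDF A B S₀ n D := by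
  obtain ⟨δ, hδ, N, hN⟩ := exists_le_informationRate hA hP hmin hS₀ hε
  filter_upwards [eventually_ge_atTop N] with n hn
  exact le_iInf fun Q => le_iInf fun _ => le_iInf fun hQ =>
    hN n hn Q (hQ.trans le_self_add)

end Achievability

/-! ### Conditional means and covariances from independent errors -/

section ConditionalExpectation

variable {Ω α β : Type*} [mΩ : MeasurableSpace Ω] [MeasurableSpace α] [MeasurableSpace β]
  {μ : Measure Ω} [IsProbabilityMeasure μ] {n : ℕ}

lemma indepFun_of_map_eq_prod {X : Ω → α} {Y : Ω → β} (hX : Measurable X) (hY : Measurable Y)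
    {ν₁ : Measure α} {ν₂ : Measure β} [IsProbabilityMeasure ν₁] [IsProbabilityMeasure ν₂]
    (h : μ.map (fun ω => (X ω, Y ω)) = ν₁.prod ν₂) : IndepFun X Y μ := by
  have h1 : μ.map X = ν₁ := by
    have := congrArg (Measure.map Prod.fst) h
    rwa [Measure.map_map measurable_fst (hX.prodMk hY), Measure.map_fst_prod, measure_univ,
      one_smul] at this
  have h2 : μ.map Y = ν₂ := by
    have := congrArg (Measure.map Prod.snd) h
    rwa [Measure.map_map measurable_snd (hX.prodMk hY), Measure.map_snd_prod, measure_univ,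
      one_smul] at this
  rw [indepFun_iff_map_prod_eq_prod_map_map hX.aemeasurable hY.aemeasurable, h, h1, h2]

lemma condExp_comap_of_indepFun {E : Type*} [NormedAddCommGroup E] [NormedSpace ℝ E]
    [CompleteSpace E] {F : Ω → α} (hF : Measurable F) {Z : Ω → β} (hZ : Measurable Z)
    (hind : IndepFun F Z μ) {g : β → E} (hg : StronglyMeasurable g) :
    μ[fun ω => g (Z ω) | MeasurableSpace.comap F inferInstance] =ᵐ[μ]
      fun _ => ∫ ω, g (Z ω) ∂μ := by
  refine condExp_indep_eq hZ.comap_le hF.comap_le ?_ hind.symm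
  exact hg.comp_measurable (comap_measurable Z)

/-- If `X = Y + Z` with `Y` a function of `F` and `Z` centred and independent of `F`, then `Y` is the
conditional mean of `X` given `F`. -/
lemma condExp_eq_of_sub_indepFun {F : Ω → α} (hF : Measurable F) {X Y : Ω → Vec n}
    (hY : Measurable[MeasurableSpace.comap F inferInstance] Y) (hYi : Integrable Y μ)
    (hZ : Measurable fun ω => X ω - Y ω) (hZi : Integrable (fun ω => X ω - Y ω) μ)
    (hind : IndepFun F (fun ω => X ω - Y ω) μ) (h0 : ∫ ω, (X ω - Y ω) ∂μ = 0) :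
    μ[X | MeasurableSpace.comap F inferInstance] =ᵐ[μ] Y := by
  have e : X = Y + fun ω => X ω - Y ω := by
    funext ω
    simp
  have h1 := condExp_add hYi hZi (MeasurableSpace.comap F inferInstance)
  rw [← e, condExp_of_stronglyMeasurable hF.comap_le hY.stronglyMeasurable hYi] at h1
  have h2 := condExp_comap_of_indepFun (E := Vec n) hF hZ hind (g := fun z => z)
    stronglyMeasurable_id
  rw [h0] at h2
  filter_upwards [h1, h2] with ω hω1 hω2
  rw [hω1, Pi.add_apply, hω2, add_zero]

lemma condErrorCov_eq_of_sub_indepFun {F : Ω → α} (hF : Measurable F) {X Y : Ω → Vec n}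
    (hmean : μ[X | MeasurableSpace.comap F inferInstance] =ᵐ[μ] Y)
    (hZ : Measurable fun ω => X ω - Y ω) (hind : IndepFun F (fun ω => X ω - Y ω) μ) (i j : Fin n) :
    condErrorCov μ (MeasurableSpace.comap F inferInstance) X i j =ᵐ[μ]
      fun _ => secondMoment μ (fun ω => X ω - Y ω) i j := by
  have h : (fun ω => (X ω - (μ[X | MeasurableSpace.comap F inferInstance]) ω) i *
      (X ω - (μ[X | MeasurableSpace.comap F inferInstance]) ω) j) =ᵐ[μ]
      fun ω => (X ω - Y ω) i * (X ω - Y ω) j := by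
    filter_upwards [hmean] with ω hω
    rw [hω]
  exact (condExp_congr_ae h).trans (condExp_comap_of_indepFun hF hZ hind
    (g := fun z : Vec n => z i * z j) (Continuous.stronglyMeasurable (by fun_prop)))

end ConditionalExpectation

/-! ### The steady state of the filter -/

section SteadyState

open scoped MatrixOrder

variable {p q : ℕ} {A : Matrix (Fin p) (Fin p) ℝ} {B : Matrix (Fin p) (Fin q) ℝ}
  {S₀ P : Matrix (Fin p) (Fin p) ℝ} {Q : TestChannel p}

/-- The path `(y_0, …, y_{k-1})`. -/
noncomputable def outputPath (A : Matrix (Fin p) (Fin p) ℝ) (B : Matrix (Fin p) (Fin q) ℝ)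
    (Q : TestChannel p) (k : ℕ) (ω : Sample p q) (s : Fin k) : Vec p :=
  output A B Q s ω

@[fun_prop]
lemma measurable_outputPath (k : ℕ) : Measurable (outputPath A B Q k) :=
  measurable_pi_iff.2 fun _ => measurable_output _

/-- The most recent value `y_{k-1}` of a path, with `y_{-1} = 0`. -/
def lastOutput : (k : ℕ) → (Fin k → Vec p) → Vec p
  | 0, _ => 0
  | k + 1, y => y (Fin.last k)

@[fun_prop]
lemma measurable_lastOutput (k : ℕ) : Measurable (lastOutput (p := p) k) := by
  cases k with
  | zero => exact measurable_const
  | succ k => exact measurable_pi_apply _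

lemma lastOutput_outputPath (k : ℕ) (ω : Sample p q) :
    lastOutput k (outputPath A B Q k ω) = prevOutput A B Q k ω := by
  cases k <;> rfl

lemma outputPath_succ (k : ℕ) (ω : Sample p q) : outputPath A B Q (k + 1) ω =
    Fin.snoc (α := fun _ => Vec p) (outputPath A B Q k ω) (output A B Q k ω) := by
  funext s
  refine Fin.lastCases ?_ (fun s => ?_) s
  · simp [outputPath]
  · simp [outputPath]

lemma measurable_snoc (k : ℕ) : Measurable fun z : (Fin k → Vec p) × Vec p =>
    (Fin.snoc (α := fun _ => Vec p) z.1 z.2 : Fin (k + 1) → Vec p) := by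
  refine measurable_pi_iff.2 fun s => ?_
  refine Fin.lastCases ?_ (fun s => ?_) s
  · simpa using measurable_snd
  · simpa using (by fun_prop : Measurable fun z : (Fin k → Vec p) × Vec p => z.1 s)

/-- If the innovation is independent of the past and has covariance `Λ`, then the error `x_t - y_t`
is independent of the outputs up to time `t`: the pair of the error and `H ξ_t + v_t` is a rotation
of the pair `(ξ_t, v_t)`. -/
lemma indepFun_outputPath_error (hP : P.PosDef) (hL : P ≤ predCov A B P) {t : ℕ}
    (hlaw : (law q S₀ (stationaryChannel A B P)).map (innovation A B (stationaryChannel A B P) t) =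
      multivariateGaussian (0 : Vec p) (predCov A B P))
    (h : IndepFun (outputPath A B (stationaryChannel A B P) t)
      (innovation A B (stationaryChannel A B P) t) (law q S₀ (stationaryChannel A B P))) :
    IndepFun (outputPath A B (stationaryChannel A B P) (t + 1))
      (fun ω => source A B t ω - output A B (stationaryChannel A B P) t ω)
      (law q S₀ (stationaryChannel A B P)) := by
  set μ := law q S₀ (stationaryChannel A B P) with hμ
  set Q := stationaryChannel A B P with hQ
  have hpath : IsProbabilityMeasure (μ.map (outputPath A B Q t)) :=
    Measure.isProbabilityMeasure_map (by fun_prop)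
  have hF : Measurable fun ω => (outputPath A B Q t ω, innovation A B Q t ω) := by fun_prop
  have h1 := map_prodMk_channelNoise (S₀ := S₀) (Q := Q) hF t (fun z =>
    Prod.ext (funext fun s => prevOutput_resampleChannel (by omega) z)
      (innovation_resampleChannel t z))
  rw [← hμ, (indepFun_iff_map_prod_eq_prod_map_map (by fun_prop) (by fun_prop)).1 h, hlaw] at h1
  have hrot : MeasurePreserving (fun z : Vec p × Vec p =>
      (Matrix.toEuclideanLin (gainH A B P) z.1 + z.2,
        Matrix.toEuclideanLin (1 - gainH A B P) z.1 - z.2))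
      ((multivariateGaussian (0 : Vec p) (predCov A B P)).prod
        (multivariateGaussian (0 : Vec p) (Q.noiseCov t)))
      ((multivariateGaussian (0 : Vec p) (predCov A B P - P)).prod
        (multivariateGaussian (0 : Vec p) P)) :=
    Measure.measurePreserving_swap.comp ⟨by fun_prop, map_error_innovation hP hL⟩
  have hT := (measurePreserving_prodAssoc (μ.map (outputPath A B Q t))
      (multivariateGaussian (0 : Vec p) (predCov A B P - P))
      (multivariateGaussian (0 : Vec p) P)).symm.comp
    (((MeasurePreserving.id (μ.map (outputPath A B Q t))).prod hrot).comp
      ((measurePreserving_prodAssoc _ _ _).comp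
        (⟨hF.prodMk (by fun_prop), h1⟩ : MeasurePreserving _ μ _)))
  have hη : Measurable fun ω : Sample p q =>
    (outputPath A B Q t ω,
      Matrix.toEuclideanLin (gainH A B P) (innovation A B Q t ω) + ω.2.2 t) := by fun_prop
  have hind : IndepFun (fun ω : Sample p q => (outputPath A B Q t ω,
      Matrix.toEuclideanLin (gainH A B P) (innovation A B Q t ω) + ω.2.2 t))
      (fun ω => source A B t ω - output A B Q t ω) μ := by
    refine indepFun_of_map_eq_prod hη (by fun_prop) (Eq.trans ?_ hT.map_eq)
    congr 1
    funext ω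
    exact Prod.ext rfl (error_stationary t ω)
  have hg : Measurable fun z : (Fin t → Vec p) × Vec p => (Fin.snoc (α := fun _ => Vec p) z.1
      (Matrix.toEuclideanLin A (lastOutput t z.1) + z.2) : Fin (t + 1) → Vec p) :=
    (measurable_snoc t).comp (by fun_prop : Measurable fun z : (Fin t → Vec p) × Vec p =>
      (z.1, Matrix.toEuclideanLin A (lastOutput t z.1) + z.2))
  have h2 := hind.comp hg measurable_id
  rw [Function.id_comp] at h2
  convert h2 using 1
  funext ω
  simp only [Function.comp_apply, lastOutput_outputPath]
  rw [outputPath_succ, output_stationary]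

/-- If the error is independent of the outputs up to time `t`, so is the next innovation. -/
lemma indepFun_outputPath_innovation_succ {t : ℕ}
    (h : IndepFun (outputPath A B Q (t + 1)) (fun ω => source A B t ω - output A B Q t ω)
      (law q S₀ Q)) :
    IndepFun (outputPath A B Q (t + 1)) (innovation A B Q (t + 1)) (law q S₀ Q) := by
  have hF : Measurable fun ω : Sample p q =>
      (outputPath A B Q (t + 1) ω, source A B t ω - output A B Q t ω) := by fun_prop
  have h1 := map_prodMk_sourceNoise (S₀ := S₀) (Q := Q) hF t (fun z =>
    Prod.ext (funext fun s => prevOutput_resampleSource (by omega) z) (by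
      simp only [output]
      rw [source_resampleSource le_rfl, prevOutput_resampleSource le_rfl]))
  rw [(indepFun_iff_map_prod_eq_prod_map_map (by fun_prop) (by fun_prop)).1 h] at h1
  have hpath : IsProbabilityMeasure ((law q S₀ Q).map (outputPath A B Q (t + 1))) :=
    Measure.isProbabilityMeasure_map (by fun_prop)
  have herr : IsProbabilityMeasure ((law q S₀ Q).map fun ω => source A B t ω - output A B Q t ω) :=
    Measure.isProbabilityMeasure_map (by fun_prop)
  have hT := (measurePreserving_prodAssoc _ _ _).comp
    (⟨hF.prodMk (by fun_prop), h1⟩ : MeasurePreserving _ (law q S₀ Q) _)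
  have hind : IndepFun (outputPath A B Q (t + 1))
      (fun ω : Sample p q => (source A B t ω - output A B Q t ω, ω.2.1 t)) (law q S₀ Q) :=
    indepFun_of_map_eq_prod (by fun_prop) (by fun_prop) hT.map_eq
  have h2 := hind.comp measurable_id (by fun_prop : Measurable fun z : Vec p × Vec q =>
    Matrix.toEuclideanLin A z.1 + Matrix.toEuclideanLin B z.2)
  rw [Function.id_comp] at h2
  convert h2 using 1
  funext ω
  exact innovation_succ t ω

lemma indepFun_outputPath_innovation (hP : P.PosDef) (hL : P ≤ predCov A B P) (t : ℕ) :
    IndepFun (outputPath A B (stationaryChannel A B P) t)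
      (innovation A B (stationaryChannel A B P) t)
      (law q (predCov A B P) (stationaryChannel A B P)) := by
  have hL0 := (predCov_posDef hP hL).posSemidef.nonneg
  induction t with
  | zero =>
    have e : outputPath A B (stationaryChannel A B P) 0 = fun _ => Fin.elim0 :=
      Subsingleton.elim _ _
    rw [e]
    exact indepFun_const_left _ _
  | succ t ih =>
    refine indepFun_outputPath_innovation_succ (indepFun_outputPath_error hP hL ?_ ih)
    rw [map_innovation hP hL hL0, innovationCov_predCov hP hL]

lemma integral_eq_zero_of_map_eq_gaussian {Ω : Type*} [MeasurableSpace Ω] {μ : Measure Ω} {n : ℕ}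
    {Z : Ω → Vec n} (hZ : Measurable Z) {S : Matrix (Fin n) (Fin n) ℝ}
    (h : μ.map Z = multivariateGaussian 0 S) : ∫ ω, Z ω ∂μ = 0 := by
  have h1 := integral_map (μ := μ) hZ.aemeasurable (f := fun z : Vec n => z)
    aestronglyMeasurable_id
  rw [← h1, h]
  exact integral_id_multivariateGaussian

/-- When the source starts with covariance `Λ`, the reproduction is the conditional mean of the
source given the reproductions so far: the errors are centred and independent of them. -/
lemma filterInSteadyState_stationary (hP : P.PosDef) (hL : P ≤ predCov A B P) :
    FilterInSteadyState A B (stationaryChannel A B P) (predCov A B P) P := by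
  have hL0 := (predCov_posDef hP hL).posSemidef.nonneg
  intro t
  have hi := indepFun_outputPath_innovation (q := q) hP hL t
  have hil := map_innovation (q := q) hP hL hL0 t
  have hel := map_error (q := q) hP hL hL0 t
  have hil' := hil
  rw [innovationCov_predCov hP hL] at hil'
  have he := indepFun_outputPath_error hP hL hil' hi
  have hmi : Measurable fun ω => source A B t ω - Matrix.toEuclideanLin A
      (prevOutput A B (stationaryChannel A B P) t ω) := measurable_innovation t
  have hY2 : MemLp (prevOutput A B (stationaryChannel A B P) t) 2
      (law q (predCov A B P) (stationaryChannel A B P)) := memLp_prevOutput hL0 t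
  have hY2' : MemLp (output A B (stationaryChannel A B P) t) 2
      (law q (predCov A B P) (stationaryChannel A B P)) := memLp_prevOutput hL0 (t + 1)
  have c1 := condExp_eq_of_sub_indepFun (measurable_outputPath (t + 1)) (X := source A B t)
    (Y := output A B (stationaryChannel A B P) t) (measurable_output_pastOutputs (by omega))
    (hY2'.integrable one_le_two) (by fun_prop)
    ((memLp_error hP hL hL0 t).integrable one_le_two) he
    (integral_eq_zero_of_map_eq_gaussian (by fun_prop) hel)
  have hYm : Measurable[MeasurableSpace.comap (outputPath A B (stationaryChannel A B P) t)
      inferInstance] fun ω => Matrix.toEuclideanLin A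
        (prevOutput A B (stationaryChannel A B P) t ω) := by
    simp only [← lastOutput_outputPath]
    exact (by fun_prop : Measurable fun y : Fin t → Vec p =>
      Matrix.toEuclideanLin A (lastOutput t y)).comp (comap_measurable _)
  have c2 := condExp_eq_of_sub_indepFun (measurable_outputPath t) (X := source A B t)
    (Y := fun ω => Matrix.toEuclideanLin A (prevOutput A B (stationaryChannel A B P) t ω)) hYm
    ((memLp_toEuclideanLin hY2 A).integrable one_le_two) hmi
    ((memLp_of_map_eq_gaussian (measurable_innovation t) hil).integrable one_le_two) hi
    (integral_eq_zero_of_map_eq_gaussian hmi hil)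
  refine ⟨c1, c2, fun i j => ⟨?_, ?_⟩⟩
  · have := condErrorCov_eq_of_sub_indepFun (measurable_outputPath (t + 1)) c1 (by fun_prop) he i j
    rwa [secondMoment_error hP hL hL0, errorCov_predCov hP hL] at this
  · have := condErrorCov_eq_of_sub_indepFun (measurable_outputPath t) c2 hmi hi i j
    rwa [secondMoment_of_map_eq_gaussian hmi (innovationCov_nonneg hP hL hL0 t) hil,
      innovationCov_predCov hP hL] at this

end SteadyState

end GaussMarkov

theorem mainTheorem4 {p q : ℕ} (A : Matrix (Fin p) (Fin p) ℝ) (B : Matrix (Fin p) (Fin q) ℝ)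
    (S₀ : Matrix (Fin p) (Fin p) ℝ) (hS₀ : S₀.PosSemidef)
    (hAB : A.rank = p ∨ (q = p ∧ B.rank = p))
    (D : ℝ≥0∞) (hD : 0 < D)
    (hinv : ∃ P ∈ GaussMarkov.feasibleSet A B D,
      ∃! ν : Measure (GaussMarkov.Vec p),
        IsProbabilityMeasure ν ∧ (GaussMarkov.outputKernel A B P).Invariant ν) :
    ∃ R : ℝ, 0 ≤ R ∧
      -- the minimum of the asymptotic problem is attained, with value `R`
      IsLeast (GaussMarkov.objective A B '' GaussMarkov.feasibleSet A B D) R ∧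
      -- the limit exists, is finite, and equals the minimum
      Tendsto (fun n : ℕ => GaussMarkov.finiteNRDF A B S₀ n D) atTop (𝓝 (ENNReal.ofReal R)) ∧
      -- the same if only time-invariant test channels are admitted
      Tendsto (fun n : ℕ => GaussMarkov.finiteNRDFTimeInvariant A B S₀ n D) atTop
        (𝓝 (ENNReal.ofReal R)) ∧
      -- realization by the time-invariant test channel of any minimizer
      ∀ P ∈ GaussMarkov.feasibleSet A B D, GaussMarkov.objective A B P = R →
        (GaussMarkov.predCov A B P).PosDef ∧
        (GaussMarkov.stationaryChannel A B P).IsValid ∧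
        -- `H` is similar to a nonnegative diagonal matrix
        (∃ (E : Matrix (Fin p) (Fin p) ℝ) (d : Fin p → ℝ), IsUnit E.det ∧ (∀ i, 0 ≤ d i) ∧
          GaussMarkov.gainH A B P = E⁻¹ * Matrix.diagonal d * E) ∧
        -- from the given initial covariance, the performance is asymptotically optimal
        Tendsto (fun n : ℕ => GaussMarkov.informationRate A B S₀
          (GaussMarkov.stationaryChannel A B P) n) atTop (𝓝 (ENNReal.ofReal R)) ∧
        Tendsto (fun n : ℕ => GaussMarkov.distortion A B S₀
          (GaussMarkov.stationaryChannel A B P) n) atTop (𝓝 (ENNReal.ofReal P.trace)) ∧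
        Tendsto (fun t : ℕ => GaussMarkov.reproductionErrorCov A B S₀
          (GaussMarkov.stationaryChannel A B P) t) atTop (𝓝 P) ∧
        -- from the initial covariance `Λ`, these are exact at all times, and `(Λ, Π)` are the
        -- constant prediction and filtering error covariances
        (∀ n : ℕ,
          GaussMarkov.informationRate A B (GaussMarkov.predCov A B P)
            (GaussMarkov.stationaryChannel A B P) n = ENNReal.ofReal R ∧
          GaussMarkov.distortion A B (GaussMarkov.predCov A B P)
            (GaussMarkov.stationaryChannel A B P) n = ENNReal.ofReal P.trace) ∧
        GaussMarkov.FilterInSteadyState A B (GaussMarkov.stationaryChannel A B P)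
          (GaussMarkov.predCov A B P) P := by
  obtain ⟨P₀, hP₀, hinv⟩ := hinv
  have hA := GaussMarkov.tendsto_pow_zero_of_existsUnique_invariant hP₀.1 hP₀.2.1 hinv
  obtain ⟨X, hX, hmin⟩ := GaussMarkov.exists_minimizer hA hAB hP₀
  refine ⟨GaussMarkov.objective A B X, GaussMarkov.objective_nonneg hX.1 hX.2.1,
    ⟨⟨X, hX, rfl⟩, ?_⟩, ?_, ?_, fun P hP hPX => ?_⟩
  · rintro _ ⟨Y, hY, rfl⟩
    exact hmin Y hY
  · exact GaussMarkov.tendsto_ofReal_of_eventually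
      (fun ε hε => GaussMarkov.eventually_le_finiteNRDF hA hX hmin hS₀.nonneg hε)
      (fun ε hε => (GaussMarkov.eventually_finiteNRDFTimeInvariant_le hA hD hX hS₀.nonneg hε).mono
        fun n hn => (GaussMarkov.finiteNRDF_le_timeInvariant n).trans hn)
  · exact GaussMarkov.tendsto_ofReal_of_eventually
      (fun ε hε => (GaussMarkov.eventually_le_finiteNRDF hA hX hmin hS₀.nonneg hε).mono
        fun n hn => hn.trans (GaussMarkov.finiteNRDF_le_timeInvariant n))
      (fun ε hε => GaussMarkov.eventually_finiteNRDFTimeInvariant_le hA hD hX hS₀.nonneg hε)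
  · have hPd := hP.1
    have hL := hP.2.1
    rw [← hPX]
    exact ⟨GaussMarkov.predCov_posDef hPd hL, GaussMarkov.stationaryChannel_isValid hPd hL,
      GaussMarkov.gainH_similar_diagonal hPd hL,
      GaussMarkov.tendsto_informationRate_stationary hA hP
        (fun Y hY => hPX.trans_le (hmin Y hY)) hS₀.nonneg,
      GaussMarkov.tendsto_distortion_stationary hA hPd hL hS₀.nonneg,
      (GaussMarkov.tendsto_errorCov hA hPd hL).congr fun t =>
        (GaussMarkov.secondMoment_error hPd hL hS₀.nonneg t).symm,
      fun n => ⟨GaussMarkov.informationRate_stationary_predCov hPd hL n,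
        GaussMarkov.distortion_stationary_predCov hPd hL n⟩,
      GaussMarkov.filterInSteadyState_stationary hPd hL⟩
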